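/- **Setting.** Let $(\Omega,\mathcal F,\mathbb P)$ be a probability space, $X$ an $\mathbb R^d$-valued random vector, $\|\cdot\|_1$ the $\ell^1$-norm, $B_m=\{y:\|y\|_1\le m\}$, $\mathbb R_+=[0,\infty)$, $\mathbb R_+^0=(0,\infty)$. Let $\rho$ be a real-valued functional on a vector space of random variables containing $X_1,\dots,X_d$, with $\rho(\lambda Z)=\lambda\rho(Z)$ for $\lambda\ge 0$ and $\rho(Z_1+Z_2)\le\rho(Z_1)+\rho(Z_2)$. Put $r(y)=\rho(-\langle y,X\rangle)$, and assume that $r$ is continuous on $\mathbb R_+^d$, continuously differentiable on $(\mathbb R_+^0)^d$, and positive on the simplex $\{u\in\mathbb R_+^d:\sum_i u_i=1\}$. Let $b\in(\mathbb R^0_+)^d$ with $\sum_i b_i=1$, let $g:\mathbb R_+\to\mathbb R$ be continuously differentiable, convex and (strictly) increasing, and let $\Gamma_g(y)=g(r(y))-\sum_i b_i\log y_i$ on $(\mathbb R^0_+)^d$; its unique minimizer is denoted $y^\star$. Let $L:\mathbb R^2\to\mathbb R$, $(\xi,x)\mapsto L(\xi,x)$, be convex with $L(\xi,-\langle y,X\rangle)\in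 L^1(\mathbb P)$ for all $(\xi,y)\in\mathbb R\times\mathbb R_+^d$, and such that for every $y\in(\mathbb R_+^0)^d$ the function $\xi\mapsto\mathbb E[L(\xi,-\langle y,X\rangle)]$ has a unique minimizer, with minimum value $g(r(y))$. Assume: 1. for every $(\xi,y)\in\mathbb R\times(\mathbb R_+^0)^d$, almost surely the map $(\xi',y')\mapsto L(\xi',-\langle y',X\rangle)$ is continuously differentiable near $(\xi,y)$; 2. for every $R>0$, the supremum of $|\partial_\xi L(\xi,-\langle y,X\rangle)|+\|X\|_1|\partial_xL(\xi,-\langle y,X\rangle)|$ over $(\xi,y)\in\mathbb R\times(\mathbb R_+^0)^d$ with $|\xi|+\|y\|_1\le R$ is almost surely dominated by an integrable random variable; 3. $m\ge\|y^\star\|_1$ and, for $1\le i\le d$, $$\sup_{(\xi,y)\in\mathbb R\times(\mathbb R_+^d\cap B_m)}\left\{\mathbb E[(\partial_\xi L(\xi,-\langle y,X\rangle))^2]+\mathbb E[X_i^2(\partial_xL(\xi,-\langle y,X\rangle))^2]\right\}<\infty .$$ (Partial derivatives are set to $0$ where they do not exist.) For $z=(\xi,y)\in\mathbb R\times(\mathbb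 R_+^0)^d$ let $H(z,x)=L(\xi,-\langle y,x\rangle)-\sum_ib_i\log y_i$, $h(z)=\mathbb E[H(z,X)]$, $\partial_\xi H(z,x)=\partial_\xi L(\xi,-\langle y,x\rangle)$, $\partial_{y_i}H(z,x)=-x_i\partial_xL(\xi,-\langle y,x\rangle)-b_i/y_i$, $\underline y=\min_iy_i$, $\kappa(y)=\underline y\wedge1$, and $D_F(y,y')=\sum_iy_i\log(y_i/y_i')-\sum_iy_i+\sum_iy_i'$. For $y\in(\mathbb R_+^0)^d$, $v\in\mathbb R^d$ let $ye^{-v}=(y_ie^{-v_i})_i$, and let ${\rm P}^m_y(v)=ye^{-v}$ if $\|ye^{-v}\|_1\le m$, ${\rm P}^m_y(v)=\frac{m}{\|ye^{-v}\|_1}ye^{-v}$ otherwise. Let $(\gamma_k)_{k\ge1}$ be positive reals with $\sum_k\gamma_k=\infty$, $\sum_k\gamma_k^2<\infty$. Let $z^0=(\xi^0,y^0)$ be a random variable with values in $\mathbb R\times((\mathbb R_+^0)^d\cap B_m)$, let $X^1,X^2,\dots$ be i.i.d. copies of $X$, independent of $z^0$, let $\mathcal F_k=\sigma(z^0,X^1,\dots,X^k)$,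 and define $z^k=(\xi^k,y^k)$ by $$\xi^{k+1}=\xi^k-\gamma_{k+1}\partial_\xi H(z^k,X^{k+1}),\qquad y^{k+1}={\rm P}^m_{y^k}\big(\gamma_{k+1}\kappa(y^k)\nabla_yH(z^k,X^{k+1})\big).$$ **Theorem.** The function $h$ has a unique minimizer $z^\star=(\xi^\star,y^\star)$ on $\mathbb R\times(\mathbb R_+^0)^d$, its second component is the minimizer of $\Gamma_g$, and $z^n\to z^\star$ almost surely. Moreover, if $\mathbb E[(\xi^0)^2]<\infty$, there are an $(\mathcal F_n)$-martingale $(M_n)$ with $\sup_n\mathbb E[M_n^2]<\infty$ (which thus converges a.s. to a finite limit), a non-negative, integrable, adapted sequence $(Y_n)$ and a constant $N_\star$ with $\mathbb E[Y_{n+1}\mid\mathcal F_n]\le N_\star^2$ a.s. for all $n\ge0$, such that the weighted averages $\bar z^n=\sum_{k=1}^n\gamma_kz^{k-1}\big/\sum_{k=1}^n\gamma_k$ satisfy, almost surely, for all $n\ge1$, $$h(\bar z^n)-h(z^\star)\le\frac{\frac12(\xi^0-\xi^\star)^2+D_F(y^\star,y^0)-M_n+\frac12(m\vee1)\sum_{k=0}^n\gamma_{k+1}^2Y_{k+1}}{\big(\min_{0\le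 k\le n-1}\underline y^k\wedge1\big)\sum_{k=0}^n\gamma_{k+1}} .$$ -/

import Mathlib

open MeasureTheory ProbabilityTheory Filter Topology
open scoped NNReal ENNReal

noncomputable section

namespace RiskBudgeting

/-- The open positive orthant. -/
def posOrthant (d : ℕ) : Set (Fin d → ℝ) := {y | ∀ i, 0 < y i}

/-- The closed positive orthant. -/
def nonnegOrthant (d : ℕ) : Set (Fin d → ℝ) := {y | ∀ i, 0 ≤ y i}

/-- The `ℓ¹` norm of a vector. -/
def l1 {d : ℕ} (y : Fin d → ℝ) : ℝ := ∑ i, |y i|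

/-- The loss `-⟨y, x⟩` of the position `y` when the returns are `x`. -/
def loss {d : ℕ} (y x : Fin d → ℝ) : ℝ := -∑ i, y i * x i

/-- A risk measure `ρ` with domain a vector space `dom` of random variables is
positively homogeneous and sub-additive. -/
structure RBCompatible {Ω : Type*} (dom : Submodule ℝ (Ω → ℝ)) (ρ : (Ω → ℝ) → ℝ) : Prop where
  posHom : ∀ c : ℝ, 0 ≤ c → ∀ Z ∈ dom, ρ (c • Z) = c * ρ Z
  subAdd : ∀ Z₁ ∈ dom, ∀ Z₂ ∈ dom, ρ (Z₁ + Z₂) ≤ ρ Z₁ + ρ Z₂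

/-- The map `y ↦ ρ(-⟨y, X⟩)`. -/
def risk {Ω : Type*} {d : ℕ} (ρ : (Ω → ℝ) → ℝ) (X : Ω → Fin d → ℝ) (y : Fin d → ℝ) : ℝ :=
  ρ fun ω => loss y (X ω)

/-- The standing assumptions on the risk measure and the returns. -/
structure RiskAssumptions {Ω : Type*} {d : ℕ} (dom : Submodule ℝ (Ω → ℝ))
    (ρ : (Ω → ℝ) → ℝ) (X : Ω → Fin d → ℝ) : Prop where
  compatible : RBCompatible dom ρ
  mem_dom : ∀ i, (fun ω => X ω i) ∈ dom
  continuousOn : ContinuousOn (risk ρ X) (nonnegOrthant d)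
  contDiffOn : ContDiffOn ℝ 1 (risk ρ X) (posOrthant d)
  pos : ∀ u ∈ stdSimplex ℝ (Fin d), 0 < risk ρ X u

/-- `g : ℝ₊ → ℝ` is continuously differentiable, convex and increasing. -/
structure Distortion (g : ℝ → ℝ) : Prop where
  contDiffOn : ContDiffOn ℝ 1 g (Set.Ici 0)
  convexOn : ConvexOn ℝ (Set.Ici 0) g
  strictMonoOn : StrictMonoOn g (Set.Ici 0)

/-- `Γ_g(y) = g(ρ(-⟨y, X⟩)) - ∑ bᵢ log yᵢ`. -/
def Gam {Ω : Type*} {d : ℕ} (g : ℝ → ℝ) (ρ : (Ω → ℝ) → ℝ) (X : Ω → Fin d → ℝ)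
    (b : Fin d → ℝ) (y : Fin d → ℝ) : ℝ :=
  g (risk ρ X y) - ∑ i, b i * Real.log (y i)

/-- `∂_ξ L(ξ, x)`. -/
def dXi (L : ℝ → ℝ → ℝ) (ξ x : ℝ) : ℝ := deriv (fun s => L s x) ξ

/-- `∂_x L(ξ, x)`. -/
def dX (L : ℝ → ℝ → ℝ) (ξ x : ℝ) : ℝ := deriv (fun s => L ξ s) x

/-- The convex loss `L` represents `g ∘ r_ρ`: `g(r_ρ(y)) = min_ξ E[L(ξ, -⟨y, X⟩)]`, with a
unique minimizer for every `y` in the open orthant. -/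
structure Represents {Ω : Type*} [MeasurableSpace Ω] (P : Measure Ω) {d : ℕ} (g : ℝ → ℝ)
    (ρ : (Ω → ℝ) → ℝ) (X : Ω → Fin d → ℝ) (L : ℝ → ℝ → ℝ) : Prop where
  convexOn : ConvexOn ℝ Set.univ fun p : ℝ × ℝ => L p.1 p.2
  integrable : ∀ ξ : ℝ, ∀ y ∈ nonnegOrthant d, Integrable (fun ω => L ξ (loss y (X ω))) P
  min_eq : ∀ y ∈ posOrthant d, ∃ ξs : ℝ,
    (∀ ξ, ξ ≠ ξs → ∫ ω, L ξs (loss y (X ω)) ∂P < ∫ ω, L ξ (loss y (X ω)) ∂P) ∧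
    g (risk ρ X y) = ∫ ω, L ξs (loss y (X ω)) ∂P

/-- Regularity and integrability of `L`. Differentiability is asked at every point
`(ξ, y)` almost surely, with an exceptional event that may depend on the point. In the second
condition `Φ` dominates the supremum over the ball of radius `R`. -/
structure LossRegular {Ω : Type*} [MeasurableSpace Ω] (P : Measure Ω) {d : ℕ}
    (X : Ω → Fin d → ℝ) (L : ℝ → ℝ → ℝ) : Prop where
  contDiffAt : ∀ ξ : ℝ, ∀ y ∈ posOrthant d, ∀ᵐ ω ∂P,
    ContDiffAt ℝ 1 (fun z : ℝ × (Fin d → ℝ) => L z.1 (loss z.2 (X ω))) (ξ, y)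
  envelope : ∀ R : ℝ, 0 < R → ∃ Φ : Ω → ℝ, Integrable Φ P ∧
    ∀ᵐ ω ∂P, ∀ ξ : ℝ, ∀ y ∈ posOrthant d, |ξ| + l1 y ≤ R →
      |dXi L ξ (loss y (X ω))| + l1 (X ω) * |dX L ξ (loss y (X ω))| ≤ Φ ω

/-- Uniform second-moment bound over `ℝ × (ℝ₊^d ∩ B_m)`. -/
def SecondMomentBound {Ω : Type*} [MeasurableSpace Ω] (P : Measure Ω) {d : ℕ}
    (X : Ω → Fin d → ℝ) (L : ℝ → ℝ → ℝ) (m : ℝ) : Prop :=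
  ∃ C : ℝ≥0, ∀ i : Fin d, ∀ ξ : ℝ, ∀ y ∈ nonnegOrthant d, l1 y ≤ m →
    (∫⁻ ω, ENNReal.ofReal (dXi L ξ (loss y (X ω)) ^ 2) ∂P) +
      (∫⁻ ω, ENNReal.ofReal (X ω i ^ 2 * dX L ξ (loss y (X ω)) ^ 2) ∂P) ≤ C

/-- `H(z, x) = L(ξ, -⟨y, x⟩) - ∑ bᵢ log yᵢ` for `z = (ξ, y)`. -/
def H {d : ℕ} (L : ℝ → ℝ → ℝ) (b : Fin d → ℝ) (z : ℝ × (Fin d → ℝ)) (x : Fin d → ℝ) : ℝ :=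
  L z.1 (loss z.2 x) - ∑ i, b i * Real.log (z.2 i)

/-- `h(z) = E[H(z, X)]`. -/
def h {Ω : Type*} [MeasurableSpace Ω] (P : Measure Ω) {d : ℕ} (X : Ω → Fin d → ℝ)
    (L : ℝ → ℝ → ℝ) (b : Fin d → ℝ) (z : ℝ × (Fin d → ℝ)) : ℝ :=
  ∫ ω, H L b z (X ω) ∂P

/-- `∂_ξ H(z, x)`. -/
def gradXi {d : ℕ} (L : ℝ → ℝ → ℝ) (z : ℝ × (Fin d → ℝ)) (x : Fin d → ℝ) : ℝ :=
  dXi L z.1 (loss z.2 x)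

/-- `∇_y H(z, x)`, with components `-xᵢ ∂_x L(ξ, -⟨y, x⟩) - bᵢ / yᵢ`. -/
def gradY {d : ℕ} (L : ℝ → ℝ → ℝ) (b : Fin d → ℝ) (z : ℝ × (Fin d → ℝ)) (x : Fin d → ℝ) :
    Fin d → ℝ :=
  fun i => -x i * dX L z.1 (loss z.2 x) - b i / z.2 i

/-- The taming factor `κ(y) = min(y₁, …, y_d, 1)`. -/
def kap {d : ℕ} (y : Fin d → ℝ) : ℝ := min (⨅ i, y i) 1

/-- `D_F(y, y') = ∑ yᵢ log(yᵢ / y'ᵢ) - ∑ yᵢ + ∑ y'ᵢ`, the Bregman divergence of the negative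
entropy. -/
def DF {d : ℕ} (y w : Fin d → ℝ) : ℝ :=
  ∑ i, y i * Real.log (y i / w i) - ∑ i, y i + ∑ i, w i

/-- The entropic proximal map onto the `ℓ¹`-ball of radius `m`: `y e^{-v}` if its norm is at
most `m`, and otherwise its rescaling to norm `m`. -/
def prox {d : ℕ} (m : ℝ) (y v : Fin d → ℝ) : Fin d → ℝ :=
  let w : Fin d → ℝ := fun i => y i * Real.exp (-v i)
  if l1 w ≤ m then w else (m / l1 w) • w

/-- The stochastic mirror descent iterates; `γ k` and `Xs k` are used for `k ≥ 1` only. -/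
def smd {Ω : Type*} {d : ℕ} (L : ℝ → ℝ → ℝ) (b : Fin d → ℝ) (m : ℝ) (γ : ℕ → ℝ)
    (z₀ : Ω → ℝ × (Fin d → ℝ)) (Xs : ℕ → Ω → Fin d → ℝ) : ℕ → Ω → ℝ × (Fin d → ℝ)
  | 0, ω => z₀ ω
  | k + 1, ω =>
    let z := smd L b m γ z₀ Xs k ω
    let x := Xs (k + 1) ω
    (z.1 - γ (k + 1) * gradXi L z x,
      prox m z.2 fun i => γ (k + 1) * (kap z.2 * gradY L b z x i))

/-- The weighted average `(∑_{k=1}^n γ_k z^{k-1}) / ∑_{k=1}^n γ_k`. -/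
def average {d : ℕ} (γ : ℕ → ℝ) (z : ℕ → ℝ × (Fin d → ℝ)) (n : ℕ) : ℝ × (Fin d → ℝ) :=
  (∑ k ∈ Finset.Icc 1 n, γ k)⁻¹ • ∑ k ∈ Finset.Icc 1 n, γ k • z (k - 1)

/-- The filtration `F_k = σ(z⁰, X¹, …, X^k)`. -/
def natFiltration {Ω : Type*} [mΩ : MeasurableSpace Ω] {d : ℕ}
    (z₀ : Ω → ℝ × (Fin d → ℝ)) (hz₀ : Measurable z₀)
    (Xs : ℕ → Ω → Fin d → ℝ) (hXs : ∀ k, Measurable (Xs k)) : Filtration ℕ mΩ where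
  seq k := MeasurableSpace.comap z₀ inferInstance ⊔
    ⨆ j ∈ Finset.Icc 1 k, MeasurableSpace.comap (Xs j) inferInstance
  mono' := fun _ _ hkl => sup_le_sup_left
    (biSup_mono fun _ hj => Finset.Icc_subset_Icc_right hkl hj) _
  le' := fun _ => sup_le hz₀.comap_le (iSup₂_le fun j _ => (hXs j).comap_le)

/-- The samples `X¹, X², …` are i.i.d. copies of `X`, independent of the initial point. -/
structure Sampling {Ω : Type*} [MeasurableSpace Ω] (P : Measure Ω) {d : ℕ}
    (X : Ω → Fin d → ℝ) (z₀ : Ω → ℝ × (Fin d → ℝ)) (Xs : ℕ → Ω → Fin d → ℝ) : Prop where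
  indep : iIndepFun (fun k => Xs (k + 1)) P
  identDistrib : ∀ k, IdentDistrib (Xs (k + 1)) X P P
  indep_init : IndepFun z₀ (fun ω k => Xs (k + 1) ω) P

end RiskBudgeting

end

namespace RiskBudgeting

/-! ### The entropic divergence -/

/-! Only the `y`-part of the gradient is tamed by `κ(y)`. The natural Bregman function `½(ξ-ξ⋆)² +
D_F(y⋆,y)` therefore has drift `(ξ-ξ⋆) ∂_ξ h + κ(y) ⟨y-y⋆, ∇_y h⟩`, whereas convexity controls only
the sum with equal weights. The drift can have the wrong sign, and the proof replaces this function
by a corrected Lyapunov function `W` (`GradientModel.exists_isLyapunov`).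

Four mechanisms give the sign back. Near the minimizer, `κ(y)/κ(y⋆)` is close to `1` and the strong
convexity of `-log` absorbs the mismatch (`exists_local_drift`). For large `|ξ|` the `ξ`-derivative
has a uniform sign (`exists_slope`). Near the boundary of the orthant the tamed barrier term points
inwards with a fixed strength (`exists_boundary_drift`). On the compact region in between, `W`
contains a truncated Bregman-Moreau envelope of `h`: at a proximal point `z'` of `z`, convexity
makes the full product positive, while optimality in `ξ` alone keeps the `ξ`-part from being very
negative, so the product stays positive for every relative weight in `[k₀, 1]`
(`exists_moreau_drift`). The envelope is used instead of `h` because `h` is only `C¹`: a minimum of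
Bregman divergences has a quadratic upper bound along a mirror step (`DF_prox_le`,
`mirrorStep_moreau`). Taking the minimum over a finite net makes the selection of proximal points
measurable.

The outcome is the drift inequality `√κ(y) (h(z) - h(z⋆)) ≤` expected decrease of `W`. The factor
`√κ` tames the logarithmic blow-up of `h`. A Robbins-Siegmund argument, pathwise once the weighted
martingale and the noise series are known to converge, shows that `W(zⁿ)` converges and that `∑ γ √κ
(h - h⋆)` is finite. As `∑ γ = ∞`, the limit of `W(zⁿ)` is `0`. An `F₀`-measurable weight replaces
moments of `z⁰`.

For the rate, `min_k κ(yᵏ) ≤ √κ(y⁰) √κ(yᵏ)`, so the Lyapunov inequality is multiplied by `√κ(y⁰)`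
and combined with Jensen. Two excess terms remain: `√κ(y⁰) W(z⁰)` exceeds `½(ξ⁰-ξ⋆)²` by a square
integrable variable, and the denominator contains one step `γ_{n+1}` more than the average. Both are
dominated by a single `V ∈ L²`, and the martingale `E[V | F_n]` is subtracted from the martingale of
fluctuations to form `M_n`. -/

theorem entropy_term_ge_sqrt_sq {a w : ℝ} (ha : 0 < a) (hw : 0 < w) :
    (√a - √w) ^ 2 ≤ a * Real.log (a / w) - a + w := by
  have h1 : Real.log (a / w) = -(2 * Real.log (√w / √a)) := by
    have h2 : (√w / √a) ^ 2 = w / a := by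
      rw [div_pow, Real.sq_sqrt hw.le, Real.sq_sqrt ha.le]
    have h3 : Real.log (w / a) = 2 * Real.log (√w / √a) := by
      rw [← h2, Real.log_pow]; norm_num
    rw [← h3, ← Real.log_inv, inv_div]
  have hs : 0 < √a := Real.sqrt_pos.2 ha
  have ht : 0 < √w := Real.sqrt_pos.2 hw
  -- Using `log t ≤ t - 1` at `√(w/a)` instead of `w/a` gives `a log(a/w) ≥ 2a - 2√(aw)`, hence the
  -- Hellinger square.
  have h4 := Real.log_le_sub_one_of_pos (div_pos ht hs)
  have h5 : a * (√w / √a) = √a * √w := by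
    rw [mul_div_assoc', div_eq_iff hs.ne']
    nlinarith [Real.sq_sqrt ha.le]
  rw [h1]
  nlinarith [Real.sq_sqrt ha.le, Real.sq_sqrt hw.le, mul_le_mul_of_nonneg_left h4 ha.le]

theorem entropy_term_nonneg {a w : ℝ} (ha : 0 < a) (hw : 0 < w) :
    0 ≤ a * Real.log (a / w) - a + w :=
  (sq_nonneg _).trans (entropy_term_ge_sqrt_sq ha hw)

theorem entropy_term_ge_sq {a w m : ℝ} (ha : 0 < a) (hw : 0 < w) (ham : a ≤ m) (hwm : w ≤ m) :
    (a - w) ^ 2 / (4 * m) ≤ a * Real.log (a / w) - a + w := by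
  refine le_trans ?_ (entropy_term_ge_sqrt_sq ha hw)
  have hm : 0 < m := ha.trans_le ham
  rw [div_le_iff₀ (by positivity)]
  have h1 : (√a + √w) ^ 2 ≤ 4 * m := by
    nlinarith [Real.sq_sqrt ha.le, Real.sq_sqrt hw.le, sq_nonneg (√a - √w)]
  have h2 : (a - w) ^ 2 = (√a - √w) ^ 2 * (√a + √w) ^ 2 := by
    have : a - w = (√a - √w) * (√a + √w) := by
      nlinarith [Real.sq_sqrt ha.le, Real.sq_sqrt hw.le]
    rw [this]; ring
  rw [h2]
  exact mul_le_mul_of_nonneg_left h1 (sq_nonneg _)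

/-- The chi-square bound. Being quadratic in `a - w`, it makes a displacement of relative size `τ`
cost only `τ²`. -/
theorem entropy_term_le {a w : ℝ} (ha : 0 < a) (hw : 0 < w) :
    a * Real.log (a / w) - a + w ≤ (a - w) ^ 2 / w := by
  have h := mul_le_mul_of_nonneg_left (Real.log_le_sub_one_of_pos (div_pos ha hw)) ha.le
  have h2 : (a - w) ^ 2 / w = a * (a / w - 1) - a + w := by
    field_simp; ring
  linarith

variable {d : ℕ}

theorem DF_eq_sum (y w : Fin d → ℝ) :
    DF y w = ∑ i, (y i * Real.log (y i / w i) - y i + w i) := by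
  simp only [DF, Finset.sum_add_distrib, Finset.sum_sub_distrib]

theorem DF_nonneg {y w : Fin d → ℝ} (hy : y ∈ posOrthant d) (hw : w ∈ posOrthant d) :
    0 ≤ DF y w := by
  rw [DF_eq_sum]
  exact Finset.sum_nonneg fun i _ => entropy_term_nonneg (hy i) (hw i)

theorem le_l1 (y : Fin d → ℝ) (i : Fin d) : |y i| ≤ l1 y :=
  Finset.single_le_sum (f := fun i => |y i|) (fun _ _ => abs_nonneg _) (Finset.mem_univ i)

theorem l1_eq_sum {y : Fin d → ℝ} (hy : y ∈ posOrthant d) : l1 y = ∑ i, y i :=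
  Finset.sum_congr rfl fun i _ => abs_of_pos (hy i)

theorem apply_le_of_l1_le {y : Fin d → ℝ} {m : ℝ} (hm : l1 y ≤ m) (i : Fin d) : y i ≤ m :=
  (le_abs_self _).trans ((le_l1 y i).trans hm)

theorem DF_ge_sum_sq {y w : Fin d → ℝ} {m : ℝ} (hy : y ∈ posOrthant d) (hw : w ∈ posOrthant d)
    (hym : l1 y ≤ m) (hwm : l1 w ≤ m) : (∑ i, (y i - w i) ^ 2) / (4 * m) ≤ DF y w := by
  rw [DF_eq_sum, Finset.sum_div]
  exact Finset.sum_le_sum fun i _ => entropy_term_ge_sq (hy i) (hw i)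
    (apply_le_of_l1_le hym i) (apply_le_of_l1_le hwm i)

theorem DF_le_sum_sq_div {y w : Fin d → ℝ} (hy : y ∈ posOrthant d) (hw : w ∈ posOrthant d) :
    DF y w ≤ ∑ i, (y i - w i) ^ 2 / w i := by
  rw [DF_eq_sum]
  exact Finset.sum_le_sum fun i _ => entropy_term_le (hy i) (hw i)

theorem entropy_term_le_DF {y w : Fin d → ℝ} (hy : y ∈ posOrthant d) (hw : w ∈ posOrthant d)
    (i : Fin d) : y i * Real.log (y i / w i) - y i + w i ≤ DF y w := by
  rw [DF_eq_sum]
  exact Finset.single_le_sum (f := fun i => y i * Real.log (y i / w i) - y i + w i)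
    (fun j _ => entropy_term_nonneg (hy j) (hw j)) (Finset.mem_univ i)

/-! ### The taming factor -/

theorem kap_le_apply (y : Fin d → ℝ) (i : Fin d) : kap y ≤ y i :=
  (min_le_left _ _).trans (ciInf_le (Set.finite_range _).bddBelow i)

theorem kap_le_one (y : Fin d → ℝ) : kap y ≤ 1 := min_le_right _ _

theorem le_kap [Nonempty (Fin d)] {y : Fin d → ℝ} {c : ℝ} (h : ∀ i, c ≤ y i) (h1 : c ≤ 1) :
    c ≤ kap y := le_min (le_ciInf h) h1

theorem kap_pos [Nonempty (Fin d)] {y : Fin d → ℝ} (hy : y ∈ posOrthant d) : 0 < kap y := by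
  refine lt_min ?_ one_pos
  obtain ⟨i, hi⟩ := exists_eq_ciInf_of_finite (f := y)
  rw [← hi]; exact hy i

theorem exists_kap_eq [Nonempty (Fin d)] {y : Fin d → ℝ} (h : kap y < 1) : ∃ i, kap y = y i := by
  obtain ⟨i, hi⟩ := exists_eq_ciInf_of_finite (f := y)
  refine ⟨i, ?_⟩
  unfold kap at h ⊢
  rw [min_lt_iff] at h
  rw [hi]
  exact min_eq_left (by rcases h with h | h <;> linarith)

theorem kap_le_add [Nonempty (Fin d)] {y w : Fin d → ℝ} {c : ℝ} (hc : 0 ≤ c)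
    (h : ∀ i, y i ≤ w i + c) : kap y ≤ kap w + c := by
  rw [← sub_le_iff_le_add]
  exact le_kap (fun i => by linarith [kap_le_apply y i, h i]) (by linarith [kap_le_one y])

theorem abs_kap_sub_le [Nonempty (Fin d)] {y w : Fin d → ℝ} {c : ℝ} (hc : 0 ≤ c)
    (h : ∀ i, |y i - w i| ≤ c) : |kap y - kap w| ≤ c := by
  rw [abs_sub_le_iff]
  constructor
  · linarith [kap_le_add hc fun i => (by linarith [(abs_le.1 (h i)).2] : y i ≤ w i + c)]
  · linarith [kap_le_add hc fun i => (by linarith [(abs_le.1 (h i)).1] : w i ≤ y i + c)]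

theorem continuous_kap [Nonempty (Fin d)] : Continuous (kap : (Fin d → ℝ) → ℝ) := by
  have : LipschitzWith 1 (kap : (Fin d → ℝ) → ℝ) := by
    refine LipschitzWith.of_dist_le_mul fun y w => ?_
    rw [NNReal.coe_one, one_mul, Real.dist_eq]
    exact abs_kap_sub_le dist_nonneg fun i => by
      rw [← Real.dist_eq]; exact dist_le_pi_dist y w i
  exact this.continuous

/-! ### The proximal map -/

theorem l1_smul {c : ℝ} (hc : 0 ≤ c) (y : Fin d → ℝ) : l1 (c • y) = c * l1 y := by
  simp only [l1, Pi.smul_apply, smul_eq_mul, abs_mul, abs_of_nonneg hc, Finset.mul_sum]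

theorem l1_pos [Nonempty (Fin d)] {y : Fin d → ℝ} (hy : y ∈ posOrthant d) : 0 < l1 y := by
  rw [l1_eq_sum hy]
  exact Finset.sum_pos (fun i _ => hy i) Finset.univ_nonempty

theorem mul_exp_mem_posOrthant {y : Fin d → ℝ} (hy : y ∈ posOrthant d) (v : Fin d → ℝ) :
    (fun i => y i * Real.exp (-v i)) ∈ posOrthant d :=
  fun i => mul_pos (hy i) (Real.exp_pos _)

theorem prox_mem_posOrthant [Nonempty (Fin d)] {m : ℝ} (hm : 0 < m) {y : Fin d → ℝ}
    (hy : y ∈ posOrthant d) (v : Fin d → ℝ) : prox m y v ∈ posOrthant d := by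
  have hw := mul_exp_mem_posOrthant hy v
  unfold prox
  dsimp only
  split_ifs with h
  · exact hw
  · exact fun i => mul_pos (div_pos hm (l1_pos hw)) (hw i)

theorem l1_prox_le [Nonempty (Fin d)] {m : ℝ} (hm : 0 < m) {y : Fin d → ℝ}
    (hy : y ∈ posOrthant d) (v : Fin d → ℝ) : l1 (prox m y v) ≤ m := by
  have hw := mul_exp_mem_posOrthant hy v
  unfold prox
  dsimp only
  split_ifs with h
  · exact h
  · have h1 := l1_pos hw
    apply le_of_eq
    rw [l1_smul (div_pos hm h1).le, div_mul_cancel₀ _ h1.ne']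

theorem DF_mul_exp_sub {y y' v : Fin d → ℝ} (hy : y ∈ posOrthant d) (hy' : y' ∈ posOrthant d) :
    DF y' (fun i => y i * Real.exp (-v i)) =
      DF y' y + ∑ i, y' i * v i + (∑ i, y i * Real.exp (-v i) - ∑ i, y i) := by
  have h : ∀ i, y' i * Real.log (y' i / (y i * Real.exp (-v i))) =
      y' i * Real.log (y' i / y i) + y' i * v i := fun i => by
    rw [← div_div, Real.log_div (div_pos (hy' i) (hy i)).ne' (Real.exp_pos _).ne', Real.log_exp]
    ring
  simp only [DF, h, Finset.sum_add_distrib]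
  ring

theorem DF_smul {c : ℝ} (hc : 0 < c) {y' w : Fin d → ℝ} (hw : w ∈ posOrthant d)
    (hy' : y' ∈ posOrthant d) :
    DF y' (c • w) = DF y' w - (∑ i, y' i) * Real.log c + (c - 1) * ∑ i, w i := by
  have h : ∀ i, y' i * Real.log (y' i / (c * w i)) =
      y' i * Real.log (y' i / w i) - y' i * Real.log c := fun i => by
    rw [mul_comm c, ← div_div, Real.log_div (div_pos (hy' i) (hw i)).ne' hc.ne']
    ring
  simp only [DF, Pi.smul_apply, smul_eq_mul, h, Finset.sum_sub_distrib, ← Finset.sum_mul,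
    ← Finset.mul_sum]
  ring

theorem exp_neg_le_of_abs_le_one {x : ℝ} (hx : |x| ≤ 1) : Real.exp (-x) ≤ 1 - x + x ^ 2 := by
  have h := Real.abs_exp_sub_one_sub_id_le (x := -x) (by rwa [abs_neg])
  have := (abs_le.1 h).2
  nlinarith

/-- The one-step inequality of entropic mirror descent on the `ℓ¹`-ball. -/
theorem DF_prox_le [Nonempty (Fin d)] {m : ℝ} {y y' : Fin d → ℝ} (hy : y ∈ posOrthant d)
    (hym : l1 y ≤ m) (hy' : y' ∈ posOrthant d) (hym' : l1 y' ≤ m) (v : Fin d → ℝ) :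
    DF y' (prox m y v) ≤ DF y' y - ∑ i, v i * (y i - y' i) + 3 * m * ∑ i, v i ^ 2 := by
  have hm : 0 < m := (l1_pos hy).trans_le hym
  set w : Fin d → ℝ := fun i => y i * Real.exp (-v i) with hwdef
  have hw : w ∈ posOrthant d := mul_exp_mem_posOrthant hy v
  have hl : l1 w = ∑ i, w i := l1_eq_sum hw
  have hly : ∑ i, y i ≤ m := by rw [← l1_eq_sum hy]; exact hym
  have hly' : ∑ i, y' i ≤ m := by rw [← l1_eq_sum hy']; exact hym'
  have hly0 : 0 < ∑ i, y i := by rw [← l1_eq_sum hy]; exact l1_pos hy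
  have hly0' : 0 < ∑ i, y' i := by rw [← l1_eq_sum hy']; exact l1_pos hy'
  have hDw : DF y' w = DF y' y + ∑ i, y' i * v i + (∑ i, w i - ∑ i, y i) :=
    DF_mul_exp_sub hy hy'
  have hsplit : ∑ i, v i * (y i - y' i) = ∑ i, y i * v i - ∑ i, y' i * v i := by
    rw [← Finset.sum_sub_distrib]
    exact Finset.sum_congr rfl fun i _ => by ring
  have hsq0 : 0 ≤ ∑ i, v i ^ 2 := Finset.sum_nonneg fun i _ => sq_nonneg _
  set S := ∑ i, v i ^ 2 with hS
  have hvS : ∀ i, |v i| ≤ √S := fun i => by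
    rw [← Real.sqrt_sq_eq_abs]
    exact Real.sqrt_le_sqrt (Finset.single_le_sum (f := fun i => v i ^ 2)
      (fun _ _ => sq_nonneg _) (Finset.mem_univ i))
  have hprox : prox m y v = if l1 w ≤ m then w else (m / l1 w) • w := rfl
  -- Rescaling changes the divergence by `(∑ y') log(‖w‖/m) + m - ‖w‖`. This is at most `0`, by `∑
  -- y' ≤ m` and `log t ≤ t - 1`.
  have hcase : DF y' (prox m y v) ≤ DF y' w := by
    rw [hprox]
    split_ifs with h
    · exact le_rfl
    · push Not at h
      have h0 : 0 < l1 w := hm.trans h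
      rw [DF_smul (div_pos hm h0) hw hy', ← hl, Real.log_div hm.ne' h0.ne']
      have h1 : Real.log (l1 w) - Real.log m ≤ l1 w / m - 1 := by
        rw [← Real.log_div h0.ne' hm.ne']
        exact Real.log_le_sub_one_of_pos (div_pos h0 hm)
      have h2 : 0 ≤ Real.log (l1 w) - Real.log m := sub_nonneg.2 (Real.log_le_log hm h.le)
      have h3 : (∑ i, y' i) * (Real.log (l1 w) - Real.log m) ≤ m * (l1 w / m - 1) :=
        (mul_le_mul_of_nonneg_right hly' h2).trans (mul_le_mul_of_nonneg_left h1 hm.le)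
      have h4 : m * (l1 w / m - 1) = l1 w - m := by field_simp
      have h5 : (m / l1 w - 1) * l1 w = m - l1 w := by field_simp
      nlinarith
  -- For `S ≤ 1` all `|v i| ≤ 1` and the exponential is bounded by its quadratic expansion. For `S >
  -- 1` the bound comes from the projection: the new norm is at most `m` and the logarithm of the
  -- rescaling factor is at most `√S ≤ S`. The three errors of size `m S` in this case explain the
  -- constant `3 m`.
  rcases le_or_gt S 1 with hS1 | hS1
  · have hs1 : √S ≤ 1 := Real.sqrt_le_iff.2 ⟨one_pos.le, by simpa using hS1⟩
    have hw1 : ∑ i, w i ≤ ∑ i, y i - ∑ i, y i * v i + m * S := by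
      have hi : ∀ i, w i ≤ y i - y i * v i + m * v i ^ 2 := fun i => by
        have h1 := mul_le_mul_of_nonneg_left
          (exp_neg_le_of_abs_le_one ((hvS i).trans hs1)) (hy i).le
        have h2 := mul_le_mul_of_nonneg_right (apply_le_of_l1_le hym i) (sq_nonneg (v i))
        simp only [hwdef]
        nlinarith
      calc ∑ i, w i ≤ ∑ i, (y i - y i * v i + m * v i ^ 2) := Finset.sum_le_sum fun i _ => hi i
        _ = _ := by
          rw [Finset.sum_add_distrib, Finset.sum_sub_distrib, ← Finset.mul_sum]
    nlinarith [mul_nonneg hm.le hsq0]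
  · have hs1 : 1 ≤ √S := by rw [Real.one_le_sqrt]; exact hS1.le
    have hsS : √S ≤ S := by nlinarith [Real.sq_sqrt hsq0]
    have hyv : |∑ i, y i * v i| ≤ m * S := by
      calc |∑ i, y i * v i| ≤ ∑ i, |y i * v i| := Finset.abs_sum_le_sum_abs _ _
        _ ≤ ∑ i, y i * √S := Finset.sum_le_sum fun i _ => by
            rw [abs_mul, abs_of_pos (hy i)]
            exact mul_le_mul_of_nonneg_left (hvS i) (hy i).le
        _ = (∑ i, y i) * √S := by rw [Finset.sum_mul]
        _ ≤ m * S := mul_le_mul hly hsS (Real.sqrt_nonneg _) hm.le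
    have hyv2 := (abs_le.1 hyv).2
    have hmS : m ≤ m * S := by nlinarith
    rw [hprox]
    split_ifs with h
    · rw [hDw]
      rw [hl] at h
      linarith
    · push Not at h
      have h0 : 0 < l1 w := hm.trans h
      rw [DF_smul (div_pos hm h0) hw hy', ← hl, Real.log_div hm.ne' h0.ne', hDw, ← hl]
      have h1 : l1 w ≤ m * Real.exp √S := by
        rw [hl]
        calc ∑ i, w i ≤ ∑ i, y i * Real.exp √S := Finset.sum_le_sum fun i _ =>
              mul_le_mul_of_nonneg_left (Real.exp_le_exp.2
                ((neg_le_abs _).trans (hvS i))) (hy i).le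
          _ = (∑ i, y i) * Real.exp √S := by rw [Finset.sum_mul]
          _ ≤ _ := mul_le_mul_of_nonneg_right hly (Real.exp_pos _).le
      have h2 : Real.log (l1 w) - Real.log m ≤ √S := by
        have := Real.log_le_log h0 h1
        rw [Real.log_mul hm.ne' (Real.exp_pos _).ne', Real.log_exp] at this
        linarith
      have h2' : 0 ≤ Real.log (l1 w) - Real.log m := sub_nonneg.2 (Real.log_le_log hm h.le)
      have h3 : (∑ i, y' i) * (Real.log (l1 w) - Real.log m) ≤ m * S :=
        (mul_le_mul_of_nonneg_right hly' h2').trans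
          (mul_le_mul_of_nonneg_left (h2.trans hsS) hm.le)
      have h5 : (m / l1 w - 1) * l1 w = m - l1 w := by field_simp
      nlinarith

/-! ### A ramp with Lipschitz derivative -/

/-- `t ↦ ½ (t⁺)²`. -/
noncomputable def halfSq (t : ℝ) : ℝ := (max t 0) ^ 2 / 2

/-- The primitive of `clamp`, a smoothing of the positive part. -/
noncomputable def ramp (t : ℝ) : ℝ := halfSq t - halfSq (t - 1)

/-- The truncation of `t` to `[0, 1]`, which is the derivative of `ramp`. -/
noncomputable def clamp (t : ℝ) : ℝ := max t 0 - max (t - 1) 0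

theorem clamp_nonneg (t : ℝ) : 0 ≤ clamp t := by
  unfold clamp
  rcases le_total (t - 1) 0 with h | h <;> rcases le_total t 0 with h' | h'
  all_goals simp only [max_eq_left, max_eq_right, h, h']
  all_goals linarith

theorem clamp_le_one (t : ℝ) : clamp t ≤ 1 := by
  unfold clamp
  rcases le_total (t - 1) 0 with h | h <;> rcases le_total t 0 with h' | h'
  all_goals simp only [max_eq_left, max_eq_right, h, h']
  all_goals linarith

theorem clamp_of_nonpos {t : ℝ} (ht : t ≤ 0) : clamp t = 0 := by
  unfold clamp
  rw [max_eq_right ht, max_eq_right (by linarith)]; ring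

theorem clamp_of_one_le {t : ℝ} (ht : 1 ≤ t) : clamp t = 1 := by
  unfold clamp
  rw [max_eq_left (by linarith), max_eq_left (by linarith)]; ring

theorem pos_of_clamp_ne_zero {t : ℝ} (ht : clamp t ≠ 0) : 0 < t := by
  by_contra h
  exact ht (clamp_of_nonpos (not_lt.1 h))

theorem min_le_clamp (t : ℝ) : min t 1 ≤ clamp t := by
  rcases le_total t 0 with h | h
  · rw [clamp_of_nonpos h]; exact (min_le_left _ _).trans h
  · rcases le_total t 1 with h' | h'
    · unfold clamp
      rw [max_eq_left h, max_eq_right (by linarith)]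
      exact (min_le_left _ _).trans (by linarith)
    · rw [clamp_of_one_le h']; exact min_le_right _ _

theorem ramp_of_nonpos {t : ℝ} (ht : t ≤ 0) : ramp t = 0 := by
  unfold ramp halfSq
  rw [max_eq_right ht, max_eq_right (by linarith)]; ring

theorem ramp_nonneg (t : ℝ) : 0 ≤ ramp t := by
  unfold ramp halfSq
  rcases le_total (t - 1) 0 with h | h <;> rcases le_total t 0 with h' | h'
  all_goals simp only [max_eq_left, max_eq_right, h, h']
  all_goals nlinarith

theorem ramp_le_abs (t : ℝ) : ramp t ≤ |t| := by
  have h0 := le_abs_self t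
  have h1 := abs_nonneg t
  unfold ramp halfSq
  rcases le_total (t - 1) 0 with h | h <;> rcases le_total t 0 with h' | h'
  all_goals simp only [max_eq_left, max_eq_right, h, h']
  all_goals nlinarith

theorem ramp_mono : Monotone ramp := by
  intro s t hst
  unfold ramp halfSq
  rcases le_total (t - 1) 0 with h | h <;> rcases le_total t 0 with h' | h' <;>
  rcases le_total (s - 1) 0 with h2 | h2 <;> rcases le_total s 0 with h2' | h2'
  all_goals simp only [max_eq_left, max_eq_right, h, h', h2, h2']
  all_goals nlinarith

/-- The derivative `clamp` is `1`-Lipschitz, so the Taylor remainder is at most `s² / 2`.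
Composition with `ramp` thus preserves quadratic upper bounds along a mirror step. -/
theorem ramp_add_le (t s : ℝ) : ramp (t + s) ≤ ramp t + clamp t * s + s ^ 2 / 2 := by
  unfold ramp clamp halfSq
  rcases le_total (t - 1) 0 with h | h <;> rcases le_total t 0 with h' | h' <;>
  rcases le_total (t + s - 1) 0 with h2 | h2 <;> rcases le_total (t + s) 0 with h2' | h2'
  all_goals simp only [max_eq_left, max_eq_right, h, h', h2, h2']
  all_goals nlinarith

/-- The slope is at most `1`. An error that is already of second order passes through `ramp` without
being squared. -/
theorem ramp_add_le_add {t s : ℝ} (hs : 0 ≤ s) : ramp (t + s) ≤ ramp t + s := by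
  unfold ramp halfSq
  rcases le_total (t - 1) 0 with h | h <;> rcases le_total t 0 with h' | h' <;>
  rcases le_total (t + s - 1) 0 with h2 | h2 <;> rcases le_total (t + s) 0 with h2' | h2'
  all_goals simp only [max_eq_left, max_eq_right, h, h', h2, h2']
  all_goals nlinarith

theorem continuous_clamp : Continuous clamp := by
  unfold clamp; fun_prop

theorem continuous_ramp : Continuous ramp := by
  unfold ramp halfSq; fun_prop

/-! ### Abstract model: convex function with continuous gradient and logarithmic barrier -/

/-- The region in which the iterates live. -/
def feasible (d : ℕ) (m : ℝ) : Set (ℝ × (Fin d → ℝ)) := {z | z.2 ∈ posOrthant d ∧ l1 z.2 ≤ m}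

/-- `f(z) - ∑ bᵢ log yᵢ` for `z = (ξ, y)`. -/
noncomputable def logBarrier (b : Fin d → ℝ) (f : ℝ × (Fin d → ℝ) → ℝ) (z : ℝ × (Fin d → ℝ)) : ℝ :=
  f z - ∑ i, b i * Real.log (z.2 i)

/-- A convex function `f` on `ℝ × (0, ∞)^d` with continuous gradient `(p, q)`, bounded on the
feasible region, for which `zs` is the unique minimizer of `logBarrier b f`. -/
structure GradientModel (b : Fin d → ℝ) (m B : ℝ) (f p : ℝ × (Fin d → ℝ) → ℝ)
    (q : ℝ × (Fin d → ℝ) → Fin d → ℝ) (zs : ℝ × (Fin d → ℝ)) : Prop where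
  b_pos : ∀ i, 0 < b i
  b_sum : ∑ i, b i = 1
  zs_mem : zs ∈ feasible d m
  grad : ∀ z z' : ℝ × (Fin d → ℝ), z.2 ∈ posOrthant d → z'.2 ∈ posOrthant d →
    f z + (z'.1 - z.1) * p z + ∑ i, (z'.2 i - z.2 i) * q z i ≤ f z'
  cont_p : ContinuousOn p {z | z.2 ∈ posOrthant d}
  cont_q : ∀ i, ContinuousOn (fun z => q z i) {z | z.2 ∈ posOrthant d}
  bound_p : ∀ z ∈ feasible d m, |p z| ≤ B
  bound_q : ∀ z ∈ feasible d m, ∀ i, |q z i| ≤ B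
  lt_of_ne : ∀ z : ℝ × (Fin d → ℝ), z.2 ∈ posOrthant d → z ≠ zs →
    logBarrier b f zs < logBarrier b f z

theorem sum_abs_sub_le {m : ℝ} {y y' : Fin d → ℝ} (hy : l1 y ≤ m) (hy' : l1 y' ≤ m) :
    ∑ i, |y i - y' i| ≤ 2 * m := by
  calc ∑ i, |y i - y' i| ≤ ∑ i, (|y i| + |y' i|) := Finset.sum_le_sum fun i _ => abs_sub _ _
    _ = l1 y + l1 y' := by rw [Finset.sum_add_distrib]; rfl
    _ ≤ 2 * m := by linarith

theorem abs_sum_mul_le {B : ℝ} {u v : Fin d → ℝ} (hv : ∀ i, |v i| ≤ B) :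
    |∑ i, u i * v i| ≤ B * ∑ i, |u i| := by
  calc |∑ i, u i * v i| ≤ ∑ i, |u i * v i| := Finset.abs_sum_le_sum_abs _ _
    _ ≤ ∑ i, B * |u i| := Finset.sum_le_sum fun i _ => by
        rw [abs_mul, mul_comm]; exact mul_le_mul_of_nonneg_right (hv i) (abs_nonneg _)
    _ = _ := by rw [Finset.mul_sum]

theorem isOpen_snd_mem_posOrthant : IsOpen {z : ℝ × (Fin d → ℝ) | z.2 ∈ posOrthant d} := by
  have : {z : ℝ × (Fin d → ℝ) | z.2 ∈ posOrthant d} = ⋂ i, {z | 0 < z.2 i} := by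
    ext z; simp [posOrthant]
  rw [this]
  exact isOpen_iInter_of_finite fun i => isOpen_lt continuous_const (by fun_prop)

namespace GradientModel

variable {b : Fin d → ℝ} {m B : ℝ} {f p : ℝ × (Fin d → ℝ) → ℝ}
  {q : ℝ × (Fin d → ℝ) → Fin d → ℝ} {zs : ℝ × (Fin d → ℝ)}

theorem nonempty (hM : GradientModel b m B f p q zs) : Nonempty (Fin d) := by
  by_contra h
  rw [not_nonempty_iff] at h
  have := hM.b_sum
  simp at this

theorem m_pos (hM : GradientModel b m B f p q zs) : 0 < m :=
  haveI := hM.nonempty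
  (l1_pos hM.zs_mem.1).trans_le hM.zs_mem.2

theorem B_nonneg (hM : GradientModel b m B f p q zs) : 0 ≤ B :=
  (abs_nonneg _).trans (hM.bound_p zs hM.zs_mem)

theorem b_le_one (hM : GradientModel b m B f p q zs) (i : Fin d) : b i ≤ 1 := by
  rw [← hM.b_sum]
  exact Finset.single_le_sum (f := b) (fun j _ => (hM.b_pos j).le) (Finset.mem_univ i)

theorem le_logBarrier (hM : GradientModel b m B f p q zs) {z : ℝ × (Fin d → ℝ)}
    (hz : z.2 ∈ posOrthant d) : logBarrier b f zs ≤ logBarrier b f z := by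
  by_cases h : z = zs
  · rw [h]
  · exact (hM.lt_of_ne z hz h).le

theorem logBarrier_grad (hM : GradientModel b m B f p q zs) {z z' : ℝ × (Fin d → ℝ)}
    (hz : z.2 ∈ posOrthant d) (hz' : z'.2 ∈ posOrthant d) :
    logBarrier b f z + (z'.1 - z.1) * p z + ∑ i, (z'.2 i - z.2 i) * (q z i - b i / z.2 i)
      ≤ logBarrier b f z' := by
  have h1 := hM.grad z z' hz hz'
  have h2 : ∑ i, b i * Real.log (z'.2 i) ≤
      ∑ i, b i * Real.log (z.2 i) + ∑ i, (z'.2 i - z.2 i) * (b i / z.2 i) := by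
    rw [← Finset.sum_add_distrib]
    refine Finset.sum_le_sum fun i _ => ?_
    have h3 := Real.log_le_sub_one_of_pos (div_pos (hz' i) (hz i))
    rw [Real.log_div (hz' i).ne' (hz i).ne'] at h3
    have h4 := mul_le_mul_of_nonneg_left h3 (hM.b_pos i).le
    have h5 : b i * (z'.2 i / z.2 i - 1) = (z'.2 i - z.2 i) * (b i / z.2 i) := by
      have := (hz i).ne'
      field_simp
    linarith
  have h6 : ∑ i, (z'.2 i - z.2 i) * (q z i - b i / z.2 i) =
      ∑ i, (z'.2 i - z.2 i) * q z i - ∑ i, (z'.2 i - z.2 i) * (b i / z.2 i) := by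
    rw [← Finset.sum_sub_distrib]
    exact Finset.sum_congr rfl fun i _ => by ring
  unfold logBarrier
  linarith

/-- The gain over `logBarrier_grad` is the strong convexity of `-log` on `(0, m]`, read off from the
quadratic lower bound on the entropy. There is no such gain in the variable `ξ`. -/
theorem logBarrier_grad_strong (hM : GradientModel b m B f p q zs) {z z' : ℝ × (Fin d → ℝ)}
    (hz : z ∈ feasible d m) (hz' : z' ∈ feasible d m) :
    logBarrier b f z + (z'.1 - z.1) * p z + ∑ i, (z'.2 i - z.2 i) * (q z i - b i / z.2 i)
      + ∑ i, b i * (z.2 i - z'.2 i) ^ 2 / (4 * m ^ 2) ≤ logBarrier b f z' := by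
  have h1 := hM.grad z z' hz.1 hz'.1
  have hm := hM.m_pos
  have h2 : ∑ i, b i * Real.log (z'.2 i) + ∑ i, b i * (z.2 i - z'.2 i) ^ 2 / (4 * m ^ 2) ≤
      ∑ i, b i * Real.log (z.2 i) + ∑ i, (z'.2 i - z.2 i) * (b i / z.2 i) := by
    rw [← Finset.sum_add_distrib, ← Finset.sum_add_distrib]
    refine Finset.sum_le_sum fun i _ => ?_
    have hy := hz.1 i
    have hym := apply_le_of_l1_le hz.2 i
    have h3 := entropy_term_ge_sq hy (hz'.1 i) hym (apply_le_of_l1_le hz'.2 i)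
    rw [Real.log_div hy.ne' (hz'.1 i).ne'] at h3
    have h4 : (z.2 i - z'.2 i) ^ 2 / (4 * m ^ 2) ≤
        Real.log (z.2 i) - Real.log (z'.2 i) - 1 + z'.2 i / z.2 i := by
      have h5 : (z.2 i - z'.2 i) ^ 2 / (4 * m ^ 2) ≤ (z.2 i - z'.2 i) ^ 2 / (4 * m) / z.2 i := by
        rw [div_div]
        exact div_le_div_of_nonneg_left (sq_nonneg _) (by positivity) (by nlinarith)
      refine h5.trans ?_
      rw [div_le_iff₀ hy]
      refine h3.trans (le_of_eq ?_)
      field_simp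
    have h6 := mul_le_mul_of_nonneg_left h4 (hM.b_pos i).le
    have h5 : b i * (z'.2 i / z.2 i - 1) = (z'.2 i - z.2 i) * (b i / z.2 i) := by
      field_simp
    rw [mul_div_assoc]
    nlinarith
  have h6 : ∑ i, (z'.2 i - z.2 i) * (q z i - b i / z.2 i) =
      ∑ i, (z'.2 i - z.2 i) * q z i - ∑ i, (z'.2 i - z.2 i) * (b i / z.2 i) := by
    rw [← Finset.sum_sub_distrib]
    exact Finset.sum_congr rfl fun i _ => by ring
  unfold logBarrier
  linarith

/-- `f z'` is squeezed between the subgradient inequality at `z` and the one at `z'`; the latter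
converges because `p` and `q` are continuous. -/
theorem continuousOn_f (hM : GradientModel b m B f p q zs) :
    ContinuousOn f {z | z.2 ∈ posOrthant d} := by
  intro z hz
  have hp : Tendsto (fun z' => p z') (𝓝[{z | z.2 ∈ posOrthant d}] z) (𝓝 (p z)) := hM.cont_p z hz
  have hq : ∀ i, Tendsto (fun z' => q z' i) (𝓝[{z | z.2 ∈ posOrthant d}] z) (𝓝 (q z i)) :=
    fun i => hM.cont_q i z hz
  have hid : Tendsto (fun z' : ℝ × (Fin d → ℝ) => z') (𝓝[{z | z.2 ∈ posOrthant d}] z) (𝓝 z) :=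
    tendsto_id.mono_left nhdsWithin_le_nhds
  have h1 : Tendsto (fun z' : ℝ × (Fin d → ℝ) => z'.1) (𝓝[{z | z.2 ∈ posOrthant d}] z) (𝓝 z.1) :=
    (continuous_fst.tendsto z).comp hid
  have h2 : ∀ i, Tendsto (fun z' : ℝ × (Fin d → ℝ) => z'.2 i)
      (𝓝[{z | z.2 ∈ posOrthant d}] z) (𝓝 (z.2 i)) := fun i =>
    (((continuous_apply i).comp continuous_snd).tendsto z).comp hid
  have hlow : Tendsto (fun z' : ℝ × (Fin d → ℝ) =>
      f z + (z'.1 - z.1) * p z + ∑ i, (z'.2 i - z.2 i) * q z i)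
      (𝓝[{z | z.2 ∈ posOrthant d}] z) (𝓝 (f z)) := by
    have := ((tendsto_const_nhds (x := f z)).add ((h1.sub_const z.1).mul_const (p z))).add
      (tendsto_finsetSum Finset.univ fun i _ => ((h2 i).sub_const (z.2 i)).mul_const (q z i))
    simpa using this
  have hup : Tendsto (fun z' : ℝ × (Fin d → ℝ) =>
      f z - (z.1 - z'.1) * p z' - ∑ i, (z.2 i - z'.2 i) * q z' i)
      (𝓝[{z | z.2 ∈ posOrthant d}] z) (𝓝 (f z)) := by
    have := ((tendsto_const_nhds (x := f z)).sub
      (((tendsto_const_nhds (x := z.1)).sub h1).mul hp)).sub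
      (tendsto_finsetSum Finset.univ fun i _ =>
        ((tendsto_const_nhds (x := z.2 i)).sub (h2 i)).mul (hq i))
    simpa using this
  refine tendsto_of_tendsto_of_tendsto_of_le_of_le' hlow hup ?_ ?_
  · filter_upwards [self_mem_nhdsWithin] with z' hz'
    exact hM.grad z z' hz hz'
  · filter_upwards [self_mem_nhdsWithin] with z' hz'
    linarith [hM.grad z' z hz' hz]

theorem continuousOn_logBarrier (hM : GradientModel b m B f p q zs) :
    ContinuousOn (logBarrier b f) {z | z.2 ∈ posOrthant d} := by
  refine hM.continuousOn_f.sub (continuousOn_finsetSum _ fun i _ => continuousOn_const.mul ?_)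
  exact ContinuousOn.log (by fun_prop) fun z hz => (hz i).ne'

theorem continuousOn_grad_logBarrier (hM : GradientModel b m B f p q zs) (i : Fin d) :
    ContinuousOn (fun z => q z i - b i / z.2 i) {z | z.2 ∈ posOrthant d} :=
  (hM.cont_q i).sub (continuousOn_const.div (by fun_prop) fun z hz => (hz i).ne')

/-- At a point slightly displaced from `zs` in the direction `σ eᵢ`, minimality and the subgradient
inequality give the directional derivative a sign. Continuity carries it to `zs`, and both signs of
`σ` are used. -/
theorem grad_logBarrier_zs_eq_zero (hM : GradientModel b m B f p q zs) (i : Fin d) :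
    q zs i - b i / zs.2 i = 0 := by
  have key : ∀ σ : ℝ, σ ≠ 0 → 0 ≤ σ * (q zs i - b i / zs.2 i) := by
    intro σ _
    set path : ℝ → ℝ × (Fin d → ℝ) := fun s => (zs.1, zs.2 + s • Pi.single i σ) with hpath
    have hcont : Continuous path := by fun_prop
    have h0 : path 0 = zs := by simp [hpath]
    have hopen : ∀ᶠ s in 𝓝 (0 : ℝ), path s ∈ {z : ℝ × (Fin d → ℝ) | z.2 ∈ posOrthant d} := by
      refine hcont.continuousAt.eventually_mem ?_
      rw [h0]
      exact isOpen_snd_mem_posOrthant.mem_nhds hM.zs_mem.1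
    have hQ : Tendsto (fun s => σ * (q (path s) i - b i / (path s).2 i)) (𝓝[>] 0)
        (𝓝 (σ * (q zs i - b i / zs.2 i))) := by
      refine Tendsto.const_mul _ ?_
      have h1 : ContinuousAt (fun z => q z i - b i / z.2 i) (path 0) := by
        rw [h0]
        exact (hM.continuousOn_grad_logBarrier i).continuousAt
          (isOpen_snd_mem_posOrthant.mem_nhds hM.zs_mem.1)
      have h2 := (h1.comp hcont.continuousAt).tendsto
      simp only [Function.comp_def, h0] at h2
      exact h2.mono_left nhdsWithin_le_nhds
    refine ge_of_tendsto hQ ?_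
    filter_upwards [hopen.filter_mono nhdsWithin_le_nhds, self_mem_nhdsWithin] with s hs hs0
    have h1 := hM.logBarrier_grad (z := path s) (z' := zs) hs hM.zs_mem.1
    have h2 := hM.le_logBarrier hs
    have h3 : ∑ j, (zs.2 j - (path s).2 j) * (q (path s) j - b j / (path s).2 j) =
        -(s * (σ * (q (path s) i - b i / (path s).2 i))) := by
      rw [Finset.sum_eq_single i]
      · simp [hpath]; ring
      · intro j _ hj; simp [hpath, hj]
      · simp
    have h4 : (path s).1 = zs.1 := rfl
    rw [h3, h4, sub_self, zero_mul] at h1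
    have h5 : 0 ≤ s * (σ * (q (path s) i - b i / (path s).2 i)) := by linarith
    exact nonneg_of_mul_nonneg_right h5 hs0
  have h1 := key 1 one_ne_zero
  have h2 := key (-1) (by norm_num)
  linarith

/-! ### The model for large `|ξ|` and near the boundary of the orthant -/

/-- Uniformly in `y`, `f` grows at least linearly in `|ξ|`. -/
theorem exists_linear_growth (hM : GradientModel b m B f p q zs) {σ : ℝ} (hσ : σ ^ 2 = 1) :
    ∃ a C R : ℝ, 0 < a ∧ ∀ z ∈ feasible d m, R ≤ σ * (z.1 - zs.1) →
      a * (σ * (z.1 - zs.1)) - C ≤ f z := by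
  have := hM.nonempty
  have hm := hM.m_pos
  have hzp := hM.zs_mem.1
  have hσ0 : σ ≠ 0 := by rintro rfl; norm_num at hσ
  set z₁ : ℝ × (Fin d → ℝ) := (zs.1 + σ, zs.2) with hz₁
  set a := f z₁ - f zs with ha
  -- The barrier depends on `y` only, so along `y = y⋆` strict minimality of `logBarrier b f` is
  -- strict minimality of `f`.
  have ha0 : 0 < a := by
    have h1 := hM.lt_of_ne z₁ hzp (by
      intro h
      have := congrArg Prod.fst h
      simp [hz₁] at this
      exact hσ0 this)
    have h2 : logBarrier b f z₁ - logBarrier b f zs = a := by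
      simp only [logBarrier, hz₁, ha]; ring
    linarith
  set k := kap zs.2 with hk
  have hk0 : 0 < k := kap_pos hzp
  -- Small enough that the reflected point `y'' = y⋆ + τ (y⋆ - y)` keeps all coordinates above `k /
  -- 2` for every feasible `y`. These points fill a compact part of the orthant, where `f (ξ⋆, ·)`
  -- is bounded.
  set τ := k / (2 * m) with hτ
  have hτ0 : 0 < τ := by positivity
  have hτm : τ * m = k / 2 := by rw [hτ]; field_simp
  have hcpt : IsCompact (Set.Icc (fun _ : Fin d => k / 2) (fun _ => (1 + τ) * m)) := isCompact_Icc
  have hcont : ContinuousOn (fun y : Fin d → ℝ => f (zs.1, y))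
      (Set.Icc (fun _ : Fin d => k / 2) (fun _ => (1 + τ) * m)) := by
    refine hM.continuousOn_f.comp (by fun_prop) fun y hy i => ?_
    exact lt_of_lt_of_le (by positivity) (hy.1 i)
  obtain ⟨C, hC⟩ := hcpt.exists_bound_of_continuousOn hcont
  refine ⟨a, -(((1 + τ) * f zs - C) / τ), (1 + τ) / τ, ha0, fun z hz htτ => ?_⟩
  set t := σ * (z.1 - zs.1) with ht
  have hzt : z.1 - zs.1 = σ * t := by rw [ht, ← mul_assoc, ← pow_two, hσ, one_mul]
  set y'' : Fin d → ℝ := fun i => zs.2 i + τ * (zs.2 i - z.2 i) with hy''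
  have hy''mem : y'' ∈ Set.Icc (fun _ : Fin d => k / 2) (fun _ => (1 + τ) * m) := by
    constructor
    · intro i
      have h1 := kap_le_apply zs.2 i
      have h2 := mul_le_mul_of_nonneg_left (apply_le_of_l1_le hz.2 i) hτ0.le
      have h3 := mul_pos hτ0 (hzp i)
      simp only [hy'']
      nlinarith
    · intro i
      have h1 := apply_le_of_l1_le hM.zs_mem.2 i
      have h2 := mul_pos hτ0 (hz.1 i)
      simp only [hy'']
      nlinarith
  have hy''pos : y'' ∈ posOrthant d := fun i =>
    lt_of_lt_of_le (by positivity : (0 : ℝ) < k / 2) (hy''mem.1 i)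
  have hfC : f (zs.1, y'') ≤ C := (le_abs_self _).trans (hC y'' hy''mem)
  set t' := τ * t / (1 + τ) with ht'
  have ht'1 : 1 ≤ t' := by
    rw [div_le_iff₀ hτ0] at htτ
    rw [ht', le_div_iff₀ (by positivity)]; linarith
  have ht't : (1 + τ) * t' = τ * t := by rw [ht']; field_simp
  -- The convex combination `(τ z + (ξ⋆, y'')) / (1 + τ)`, which lies on the line `y = y⋆`.
  -- Convexity transfers the growth of `f` on this line to `z`.
  set mid : ℝ × (Fin d → ℝ) := (zs.1 + σ * t', zs.2) with hmid
  have hmz := hM.grad mid z hzp hz.1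
  have hmz'' := hM.grad mid (zs.1, y'') hzp hy''pos
  have hsum : τ * ∑ i, (z.2 i - mid.2 i) * q mid i + ∑ i, (y'' i - mid.2 i) * q mid i = 0 := by
    rw [Finset.mul_sum, ← Finset.sum_add_distrib]
    exact Finset.sum_eq_zero fun i _ => by simp only [hy'', hmid]; ring
  have hfirst : τ * ((z.1 - mid.1) * p mid) + (zs.1 - mid.1) * p mid = 0 := by
    have : τ * (z.1 - mid.1) + (zs.1 - mid.1) = 0 := by
      simp only [hmid]
      linear_combination τ * hzt - σ * ht't
    linear_combination p mid * this
  have hconv : (1 + τ) * f mid ≤ τ * f z + C := by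
    have := mul_le_mul_of_nonneg_left hmz hτ0.le
    simp only at hmz''
    linear_combination this + hmz'' + hfC - hsum - hfirst
  -- The slope of `f` at `z₁` dominates the secant slope `a` from `zs` to `z₁`, so `f` grows at rate
  -- `a` beyond `z₁`; this needs `t' ≥ 1`.
  have h1m := hM.grad z₁ mid hzp hzp
  have h1s := hM.grad z₁ zs hzp hzp
  have e1 : mid.1 - z₁.1 = σ * (t' - 1) := by simp only [hmid, hz₁]; ring
  have e2 : zs.1 - z₁.1 = -σ := by simp only [hz₁]; ring
  have e3 : ∑ i, (mid.2 i - z₁.2 i) * q z₁ i = 0 :=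
    Finset.sum_eq_zero fun i _ => by simp only [hmid, hz₁]; ring
  have e4 : ∑ i, (zs.2 i - z₁.2 i) * q z₁ i = 0 :=
    Finset.sum_eq_zero fun i _ => by simp only [hz₁]; ring
  rw [e1, e3] at h1m
  rw [e2, e4] at h1s
  have hσp : a ≤ σ * p z₁ := by linarith
  have hmidlow : f zs + t' * a ≤ f mid := by
    have := mul_le_mul_of_nonneg_left hσp (sub_nonneg.2 ht'1)
    linear_combination this + h1m + ha
  rw [sub_neg_eq_add, ← sub_nonneg]
  have h2 : τ * (f z - (a * t + ((1 + τ) * f zs - C) / τ)) =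
      τ * f z - a * (τ * t) - (1 + τ) * f zs + C := by
    field_simp; ring
  have h3 : 0 ≤ τ * (f z - (a * t + ((1 + τ) * f zs - C) / τ)) := by
    rw [h2, ← ht't]
    have := mul_le_mul_of_nonneg_left hmidlow (by positivity : 0 ≤ 1 + τ)
    linear_combination this + hconv
  exact nonneg_of_mul_nonneg_right h3 hτ0

/-- Uniformly in `y`, the `ξ`-derivative of `f` points away from `zs.1` for large `|ξ|`. -/
theorem exists_slope_of_sign (hM : GradientModel b m B f p q zs) {σ : ℝ} (hσ : σ ^ 2 = 1) :
    ∃ R s : ℝ, 0 < s ∧ ∀ z ∈ feasible d m, R ≤ σ * (z.1 - zs.1) → s ≤ σ * p z := by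
  obtain ⟨a, C, R, ha0, hgrow⟩ := hM.exists_linear_growth hσ
  -- `f (ξ⋆, y) ≤ f zs + 2 m B` uniformly in `y`, so the subgradient inequality from `z` to `(ξ⋆,
  -- y)` turns linear growth into `t σ p(z) ≥ a t - C'`. The threshold on `t` makes the right side
  -- at least `a t / 2`.
  set C' := f zs + 2 * m * B + C with hC'
  refine ⟨max (max R (2 * C' / a)) 1, a / 2, by positivity, fun z hz hR => ?_⟩
  have hfz := hgrow z hz ((le_max_left _ _).trans ((le_max_left _ _).trans hR))
  set t := σ * (z.1 - zs.1) with ht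
  have ht1 : 1 ≤ t := (le_max_right _ _).trans hR
  have htC : 2 * C' / a ≤ t := (le_max_right _ _).trans ((le_max_left _ _).trans hR)
  have hzt : z.1 - zs.1 = σ * t := by rw [ht, ← mul_assoc, ← pow_two, hσ, one_mul]
  have hzy : ((zs.1, z.2) : ℝ × (Fin d → ℝ)) ∈ feasible d m := hz
  have hup := hM.grad (zs.1, z.2) zs hz.1 hM.zs_mem.1
  have hup2 := abs_sum_mul_le (u := fun i => zs.2 i - z.2 i) (hM.bound_q _ hzy)
  have hup3 := mul_le_mul_of_nonneg_left (sum_abs_sub_le hM.zs_mem.2 hz.2) hM.B_nonneg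
  have hback := hM.grad z (zs.1, z.2) hz.1 hz.1
  simp only [sub_self, zero_mul, Finset.sum_const_zero, add_zero] at hup hback
  have hup4 := (abs_le.1 hup2).1
  have hfin : a * t - C' ≤ t * (σ * p z) := by
    have : (zs.1 - z.1) * p z = -(t * (σ * p z)) := by
      linear_combination (-p z) * hzt
    rw [this] at hback
    simp only [hC']
    linarith
  have htpos : 0 < t := by linarith
  have hC2 : C' ≤ t * (a / 2) := by
    rw [div_le_iff₀ ha0] at htC
    linarith
  have : t * (a / 2) ≤ t * (σ * p z) := by linarith
  exact le_of_mul_le_mul_left this htpos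

theorem exists_slope (hM : GradientModel b m B f p q zs) :
    ∃ R s : ℝ, 0 < R ∧ 0 < s ∧ ∀ z ∈ feasible d m,
      (R ≤ z.1 - zs.1 → s ≤ p z) ∧ (z.1 - zs.1 ≤ -R → p z ≤ -s) := by
  obtain ⟨R₁, s₁, hs₁, h₁⟩ := hM.exists_slope_of_sign (σ := 1) (by norm_num)
  obtain ⟨R₂, s₂, hs₂, h₂⟩ := hM.exists_slope_of_sign (σ := -1) (by norm_num)
  refine ⟨max (max R₁ R₂) 1, min s₁ s₂, by positivity, lt_min hs₁ hs₂, fun z hz => ⟨fun h => ?_,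
    fun h => ?_⟩⟩
  · have := h₁ z hz (by rw [one_mul]; exact (le_max_left _ _).trans ((le_max_left _ _).trans h))
    linarith [min_le_left s₁ s₂]
  · have h3 : R₂ ≤ max (max R₁ R₂) 1 := (le_max_right _ _).trans (le_max_left _ _)
    have := h₂ z hz (by linarith)
    linarith [min_le_right s₁ s₂]

/-- The gap grows like `-log κ` near the boundary, and `√κ (-log κ) ≤ 2`. The exponent `1/2` leaves
another factor `√κ(y⁰)` available in the rate. -/
theorem exists_sqrt_kap_mul_le (hM : GradientModel b m B f p q zs) :
    ∃ C : ℝ, 0 ≤ C ∧ ∀ z ∈ feasible d m,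
      √(kap z.2) * (logBarrier b f z - logBarrier b f zs) ≤
        √(kap z.2) * ((z.1 - zs.1) * p z) + C := by
  have := hM.nonempty
  have hm := hM.m_pos
  have hB := hM.B_nonneg
  set S := ∑ i, b i * Real.log (zs.2 i) with hS
  refine ⟨2 * m * B + |S| + 2, by positivity, fun z hz => ?_⟩
  have hk := kap_pos hz.1
  have hk1 := kap_le_one z.2
  set k := kap z.2 with hkdef
  have hs0 : 0 < √k := Real.sqrt_pos.2 hk
  have hs1 : √k ≤ 1 := Real.sqrt_le_iff.2 ⟨one_pos.le, by simpa using hk1⟩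
  have hback := hM.grad z (zs.1, z.2) hz.1 hz.1
  have hzy : ((zs.1, z.2) : ℝ × (Fin d → ℝ)) ∈ feasible d m := hz
  have hup := hM.grad (zs.1, z.2) zs hz.1 hM.zs_mem.1
  have hup2 := abs_sum_mul_le (u := fun i => zs.2 i - z.2 i) (hM.bound_q _ hzy)
  have hup3 := mul_le_mul_of_nonneg_left (sum_abs_sub_le hM.zs_mem.2 hz.2) hB
  simp only [sub_self, zero_mul, Finset.sum_const_zero, add_zero] at hup hback
  have hup4 := (abs_le.1 hup2).1
  have hlog : -∑ i, b i * Real.log (z.2 i) ≤ -Real.log k := by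
    rw [neg_le_neg_iff]
    calc Real.log k = ∑ i, b i * Real.log k := by rw [← Finset.sum_mul, hM.b_sum, one_mul]
      _ ≤ _ := Finset.sum_le_sum fun i _ => mul_le_mul_of_nonneg_left
        (Real.log_le_log hk (kap_le_apply z.2 i)) (hM.b_pos i).le
  have hlk : √k * -Real.log k ≤ 2 := by
    have h1 : Real.log k = 2 * Real.log √k := by
      rw [Real.log_sqrt hk.le]; ring
    have h2 := Real.log_le_sub_one_of_pos (inv_pos.2 hs0)
    rw [Real.log_inv] at h2
    have h3 := mul_le_mul_of_nonneg_left h2 hs0.le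
    have h4 : √k * ((√k)⁻¹ - 1) = 1 - √k := by field_simp
    rw [h1]; nlinarith
  have hdiff : logBarrier b f z - logBarrier b f zs ≤
      (z.1 - zs.1) * p z + (2 * m * B + |S|) + -Real.log k := by
    unfold logBarrier
    rw [← hS]
    have := le_abs_self S
    linarith
  have h0 : 0 ≤ 2 * m * B + |S| := by positivity
  have := mul_le_mul_of_nonneg_left hdiff hs0.le
  have h5 := mul_le_mul_of_nonneg_right hs1 h0
  nlinarith

/-- The taming is designed for this: `κ ≤ yᵢ` and `bᵢ ≤ 1` give `κ bᵢ / yᵢ ≤ 1`, so the tamed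
gradient is bounded by `B + 1`. -/
theorem abs_kap_mul_sum_le (hM : GradientModel b m B f p q zs) {z : ℝ × (Fin d → ℝ)}
    (hz : z ∈ feasible d m) {y' : Fin d → ℝ} (hy' : l1 y' ≤ m) :
    |kap z.2 * ∑ i, (z.2 i - y' i) * (q z i - b i / z.2 i)| ≤ (B + 1) * (2 * m) := by
  have := hM.nonempty
  have hk := kap_pos hz.1
  have h1 : kap z.2 * ∑ i, (z.2 i - y' i) * (q z i - b i / z.2 i) =
      ∑ i, (z.2 i - y' i) * (kap z.2 * (q z i - b i / z.2 i)) := by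
    rw [Finset.mul_sum]; exact Finset.sum_congr rfl fun i _ => by ring
  rw [h1]
  refine (abs_sum_mul_le (B := B + 1) fun i => ?_).trans
    (mul_le_mul_of_nonneg_left (sum_abs_sub_le hz.2 hy') (by linarith [hM.B_nonneg]))
  have h2 : |kap z.2 * q z i| ≤ B := by
    rw [abs_mul, abs_of_pos hk]
    nlinarith [kap_le_one z.2, hM.bound_q z hz i, abs_nonneg (q z i), hM.B_nonneg]
  have h3 : |kap z.2 * (b i / z.2 i)| ≤ 1 := by
    rw [abs_of_pos (mul_pos hk (div_pos (hM.b_pos i) (hz.1 i))), mul_div_assoc',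
      div_le_one (hz.1 i)]
    nlinarith [kap_le_apply z.2 i, hM.b_le_one i, hM.b_pos i]
  rw [mul_sub]
  exact (abs_sub _ _).trans (by linarith)

/-- Near the boundary of the orthant the tamed gradient points inwards. -/
theorem exists_boundary_drift (hM : GradientModel b m B f p q zs) :
    ∃ ε c : ℝ, 0 < ε ∧ 0 < c ∧ ∀ z ∈ feasible d m, kap z.2 ≤ ε →
      c ≤ kap z.2 * ∑ i, (z.2 i - zs.2 i) * (q z i - b i / z.2 i) := by
  have := hM.nonempty
  have hm := hM.m_pos
  have hB := hM.B_nonneg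
  obtain ⟨j, hj⟩ := exists_eq_ciInf_of_finite (f := fun i => b i * zs.2 i)
  set c := b j * zs.2 j with hc
  have hc0 : 0 < c := mul_pos (hM.b_pos j) (hM.zs_mem.1 j)
  have hcle : ∀ i, c ≤ b i * zs.2 i := fun i => by
    have : c = ⨅ i, b i * zs.2 i := hj
    rw [this]; exact ciInf_le (Set.finite_range _).bddBelow i
  set A := 2 * m * B + 1 with hA
  have hA0 : 0 < A := by positivity
  refine ⟨min (1 / 2) (c / (2 * A)), c / 2, by positivity, by positivity, fun z hz hk => ?_⟩
  have hk0 := kap_pos hz.1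
  set k := kap z.2 with hkdef
  obtain ⟨i₀, hi₀⟩ := exists_kap_eq (y := z.2) (by
    have := hk.trans (min_le_left _ _)
    rw [← hkdef]; linarith)
  have h1 : ∑ i, (z.2 i - zs.2 i) * (q z i - b i / z.2 i) =
      ∑ i, (z.2 i - zs.2 i) * q z i - 1 + ∑ i, b i * zs.2 i / z.2 i := by
    rw [← hM.b_sum, ← Finset.sum_sub_distrib, ← Finset.sum_add_distrib]
    refine Finset.sum_congr rfl fun i _ => ?_
    have := (hz.1 i).ne'
    field_simp
    ring
  have h2 := (abs_le.1 ((abs_sum_mul_le (u := fun i => z.2 i - zs.2 i) (hM.bound_q z hz)).trans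
    (mul_le_mul_of_nonneg_left (sum_abs_sub_le hz.2 hM.zs_mem.2) hB))).1
  -- At a coordinate `i₀` attaining the minimum, `κ` cancels `y i₀` and leaves `b i₀ y⋆ i₀ ≥ c`.
  -- Everything else is at least `-κ A`.
  have h3 : c ≤ k * ∑ i, b i * zs.2 i / z.2 i := by
    have h4 : b i₀ * zs.2 i₀ / z.2 i₀ ≤ ∑ i, b i * zs.2 i / z.2 i :=
      Finset.single_le_sum (f := fun i => b i * zs.2 i / z.2 i)
        (fun i _ => div_nonneg (mul_nonneg (hM.b_pos i).le (hM.zs_mem.1 i).le) (hz.1 i).le)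
        (Finset.mem_univ i₀)
    have h5 := mul_le_mul_of_nonneg_left h4 hk0.le
    have h6 : k * (b i₀ * zs.2 i₀ / z.2 i₀) = b i₀ * zs.2 i₀ := by
      have : k = z.2 i₀ := hi₀
      have h7 := (hz.1 i₀).ne'
      rw [this]; field_simp
    linarith [hcle i₀]
  have h8 : k * A ≤ c / 2 := by
    have := hk.trans (min_le_right _ _)
    rw [le_div_iff₀ (by positivity)] at this
    linarith
  rw [h1]
  have h9 := mul_le_mul_of_nonneg_left h2 hk0.le
  nlinarith

end GradientModel

/-! ### Bregman divergence and Bregman-Moreau envelope -/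

/-- `½ (ξ - ξ')² + D_F(y', y)`. -/
noncomputable def bregman (z' z : ℝ × (Fin d → ℝ)) : ℝ :=
  (z.1 - z'.1) ^ 2 / 2 + DF z'.2 z.2

/-- The objective whose minimum over `z'` is the Moreau envelope of `φ` at `z`. -/
noncomputable def moreau (φ : ℝ × (Fin d → ℝ) → ℝ) (η : ℝ) (z' z : ℝ × (Fin d → ℝ)) : ℝ :=
  φ z' + bregman z' z / η

theorem bregman_self (z : ℝ × (Fin d → ℝ)) : bregman z z = 0 := by
  simp [bregman, DF]

theorem bregman_nonneg {z z' : ℝ × (Fin d → ℝ)} (hz : z.2 ∈ posOrthant d)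
    (hz' : z'.2 ∈ posOrthant d) : 0 ≤ bregman z' z :=
  add_nonneg (by positivity) (DF_nonneg hz' hz)

/-- The `ℓ¹` distance on `ℝ × ℝ^d`. -/
noncomputable def l1Dist (z z' : ℝ × (Fin d → ℝ)) : ℝ := |z.1 - z'.1| + ∑ i, |z.2 i - z'.2 i|

theorem l1Dist_nonneg (z z' : ℝ × (Fin d → ℝ)) : 0 ≤ l1Dist z z' :=
  add_nonneg (abs_nonneg _) (Finset.sum_nonneg fun _ _ => abs_nonneg _)

theorem abs_fst_le_l1Dist (z z' : ℝ × (Fin d → ℝ)) : |z.1 - z'.1| ≤ l1Dist z z' :=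
  le_add_of_nonneg_right (Finset.sum_nonneg fun _ _ => abs_nonneg _)

theorem dist_snd_le_l1Dist (z z' : ℝ × (Fin d → ℝ)) : dist z.2 z'.2 ≤ l1Dist z z' := by
  rw [dist_pi_le_iff (l1Dist_nonneg z z')]
  intro i
  rw [Real.dist_eq]
  refine (Finset.single_le_sum (f := fun i => |z.2 i - z'.2 i|) (fun _ _ => abs_nonneg _)
    (Finset.mem_univ i)).trans (le_add_of_nonneg_left (abs_nonneg _))

theorem sq_sum_abs_le (u : Fin d → ℝ) : (∑ i, |u i|) ^ 2 ≤ d * ∑ i, u i ^ 2 := by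
  have := sq_sum_le_card_mul_sum_sq (s := Finset.univ) (f := fun i => |u i|)
  simpa using this

/-- Cauchy-Schwarz over the `d + 1` coordinates. The factor `4 m + 4` exceeds both `2`, for the
`ξ`-term, and the constant `4 m` of `DF_ge_sum_sq`. -/
theorem bregman_ge {m : ℝ} (hm : 0 < m) {z z' : ℝ × (Fin d → ℝ)} (hz : z ∈ feasible d m)
    (hz' : z' ∈ feasible d m) :
    l1Dist z z' ^ 2 / ((d + 1) * (4 * m + 4)) ≤ bregman z' z := by
  have h1 := DF_ge_sum_sq hz'.1 hz.1 hz'.2 hz.2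
  have h2 := sq_sum_abs_le fun i => z.2 i - z'.2 i
  have h3 : ∑ i, (z'.2 i - z.2 i) ^ 2 = ∑ i, (z.2 i - z'.2 i) ^ 2 :=
    Finset.sum_congr rfl fun i _ => by ring
  rw [h3] at h1
  set T := ∑ i, |z.2 i - z'.2 i|
  set S := ∑ i, (z.2 i - z'.2 i) ^ 2
  set x := |z.1 - z'.1| with hx
  have hxx : (z.1 - z'.1) ^ 2 = x ^ 2 := by rw [hx, sq_abs]
  have hS : 0 ≤ S := Finset.sum_nonneg fun i _ => sq_nonneg _
  have hd : (0 : ℝ) ≤ d := Nat.cast_nonneg d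
  have h4 : l1Dist z z' ^ 2 ≤ (d + 1) * (x ^ 2 + S) := by
    unfold l1Dist
    rcases hd.eq_or_lt with h0 | h0
    · rw [← h0] at h2 ⊢
      have : T = 0 := by nlinarith
      change (x + T) ^ 2 ≤ _
      rw [this]; nlinarith
    · change (x + T) ^ 2 ≤ _
      have h5 : 2 * x * T ≤ d * x ^ 2 + T ^ 2 / d := by
        have : d * x ^ 2 + T ^ 2 / d - 2 * x * T = (d * x - T) ^ 2 / d := by
          field_simp; ring
        have : 0 ≤ (d * x - T) ^ 2 / d := by positivity
        linarith
      have h6 : T ^ 2 / d ≤ S := by rw [div_le_iff₀ h0]; linarith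
      nlinarith
  have h7 : (x ^ 2 + S) / (4 * m + 4) ≤ bregman z' z := by
    have h8 : S / (4 * m + 4) ≤ S / (4 * m) :=
      div_le_div_of_nonneg_left hS (by positivity) (by linarith)
    have h9 : x ^ 2 / (4 * m + 4) ≤ x ^ 2 / 2 :=
      div_le_div_of_nonneg_left (sq_nonneg _) (by norm_num) (by linarith)
    unfold bregman
    rw [add_div, hxx]
    linarith
  refine le_trans ?_ h7
  rw [div_le_div_iff₀ (by positivity) (by positivity)]
  have : 0 ≤ 4 * m + 4 := by positivity
  nlinarith

/-- A compact convex part of the feasible region. -/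
def truncatedRegion (c : ℝ × (Fin d → ℝ)) (m r ε : ℝ) : Set (ℝ × (Fin d → ℝ)) :=
  {z | |z.1 - c.1| ≤ r ∧ (∀ i, ε ≤ z.2 i) ∧ l1 z.2 ≤ m}

theorem truncatedRegion_subset {c : ℝ × (Fin d → ℝ)} {m r ε : ℝ} (hε : 0 < ε) :
    truncatedRegion c m r ε ⊆ feasible d m :=
  fun _ hz => ⟨fun i => hε.trans_le (hz.2.1 i), hz.2.2⟩

theorem continuous_l1 : Continuous (l1 : (Fin d → ℝ) → ℝ) := by
  unfold l1; fun_prop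

theorem isCompact_truncatedRegion (c : ℝ × (Fin d → ℝ)) (m r ε : ℝ) :
    IsCompact (truncatedRegion c m r ε) := by
  have hclosed : IsClosed (truncatedRegion c m r ε) := by
    have : truncatedRegion c m r ε = {z | |z.1 - c.1| ≤ r} ∩ ((⋂ i, {z | ε ≤ z.2 i}) ∩
        {z | l1 z.2 ≤ m}) := by
      ext z; simp [truncatedRegion]
    rw [this]
    exact (isClosed_le (by fun_prop) continuous_const).inter
      ((isClosed_iInter fun i => isClosed_le continuous_const (by fun_prop)).inter
        (isClosed_le (continuous_l1.comp continuous_snd) continuous_const))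
  refine IsCompact.of_isClosed_subset
    ((isCompact_Icc (a := c.1 - r) (b := c.1 + r)).prod
      (isCompact_Icc (a := fun _ : Fin d => -m) (b := fun _ => m))) hclosed fun z hz => ?_
  have h1 := abs_le.1 hz.1
  refine ⟨⟨by linarith, by linarith⟩, fun i => ?_, fun i => ?_⟩
  · exact (abs_le.1 ((le_l1 z.2 i).trans hz.2.2)).1
  · exact (abs_le.1 ((le_l1 z.2 i).trans hz.2.2)).2

theorem continuousOn_moreau {φ : ℝ × (Fin d → ℝ) → ℝ}
    (hφ : ContinuousOn φ {z | z.2 ∈ posOrthant d}) (η : ℝ) :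
    ContinuousOn (fun x : (ℝ × (Fin d → ℝ)) × (ℝ × (Fin d → ℝ)) => moreau φ η x.1 x.2)
      ({z | z.2 ∈ posOrthant d} ×ˢ {z | z.2 ∈ posOrthant d}) := by
  have h1 : ContinuousOn (fun x : (ℝ × (Fin d → ℝ)) × (ℝ × (Fin d → ℝ)) => φ x.1)
      ({z | z.2 ∈ posOrthant d} ×ˢ {z | z.2 ∈ posOrthant d}) :=
    hφ.comp continuousOn_fst fun x hx => hx.1
  have h2 : ContinuousOn (fun x : (ℝ × (Fin d → ℝ)) × (ℝ × (Fin d → ℝ)) => DF x.1.2 x.2.2)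
      ({z | z.2 ∈ posOrthant d} ×ˢ {z | z.2 ∈ posOrthant d}) := by
    unfold DF
    refine ContinuousOn.add (ContinuousOn.sub (continuousOn_finsetSum _ fun i _ => ?_)
      (by fun_prop)) (by fun_prop)
    refine ContinuousOn.mul (by fun_prop) (ContinuousOn.log ?_ fun x hx =>
      (div_pos (hx.1 i) (hx.2 i)).ne')
    exact ContinuousOn.div (by fun_prop) (by fun_prop) fun x hx => (hx.2 i).ne'
  unfold moreau bregman
  exact h1.add ((ContinuousOn.add (by fun_prop) h2).div_const _)

/-- A finite net in a compact set almost realises the minimum of the Moreau objective. -/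
theorem exists_moreau_net {φ : ℝ × (Fin d → ℝ) → ℝ}
    (hφ : ContinuousOn φ {z | z.2 ∈ posOrthant d}) (η : ℝ) {K : Set (ℝ × (Fin d → ℝ))}
    (hK : IsCompact K) (hKpos : K ⊆ {z | z.2 ∈ posOrthant d}) {e : ℝ} (he : 0 < e) :
    ∃ F : Finset (ℝ × (Fin d → ℝ)), (∀ z ∈ F, z ∈ K) ∧
      ∀ z ∈ K, ∀ w ∈ K, ∃ z'' ∈ F, moreau φ η z'' z ≤ moreau φ η w z + e := by
  -- Joint uniform continuity on `K ×ˢ K` lets one net of competitors serve every base point `z`.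
  have hu : UniformContinuousOn
      (fun x : (ℝ × (Fin d → ℝ)) × (ℝ × (Fin d → ℝ)) => moreau φ η x.1 x.2) (K ×ˢ K) :=
    (hK.prod hK).uniformContinuousOn_of_continuous
      ((continuousOn_moreau hφ η).mono (Set.prod_mono hKpos hKpos))
  rw [Metric.uniformContinuousOn_iff] at hu
  obtain ⟨r, hr, hur⟩ := hu e he
  obtain ⟨t, htK, htf, hcov⟩ := hK.finite_cover_balls hr
  refine ⟨htf.toFinset, fun z hz => htK (htf.mem_toFinset.1 hz), fun z hz w hw => ?_⟩
  obtain ⟨x, hx, hwx⟩ := Set.mem_iUnion₂.1 (hcov hw)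
  refine ⟨x, htf.mem_toFinset.2 hx, ?_⟩
  have h1 := hur (x, z) ⟨htK hx, hz⟩ (w, z) ⟨hw, hz⟩ (by
    rw [Prod.dist_eq, dist_self, max_eq_left dist_nonneg, dist_comm]
    exact hwx)
  rw [Real.dist_eq] at h1
  have := (abs_lt.1 h1).2
  simp only at this
  linarith

/-- Proximal points lie at distance `O(η)`. With `N` the distance and `β` the Bregman cost, a
function with Lipschitz constant `A` pays for at most `β / η ≤ A N + e`, while `β` is at least
quadratic in `N`. -/
theorem le_mul_of_sq_div_le {N A c η e β : ℝ} (hc : 0 < c) (hη : 0 < η) (hA : 0 ≤ A)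
    (h1 : N ^ 2 / c ≤ β) (h2 : β / η ≤ A * N + e) (he : e ≤ η) :
    N ≤ ((A + 1) * c + 1) * η := by
  by_contra hcon
  push Not at hcon
  rw [div_le_iff₀ hc] at h1
  rw [div_le_iff₀ hη] at h2
  have hAc : 0 ≤ (A + 1) * c * η := by positivity
  have h4 : η ≤ N := by linarith
  have h6 : (A + 1) * c * η < N := by linarith
  have h7 : (A + 1) * c * η * N < N * N := mul_lt_mul_of_pos_right h6 (hη.trans_le h4)
  have h8 : A * N + e ≤ (A + 1) * N := by linarith
  have h9 : (A * N + e) * η * c ≤ (A + 1) * N * η * c :=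
    mul_le_mul_of_nonneg_right (mul_le_mul_of_nonneg_right h8 hη.le) hc.le
  have h10 := mul_le_mul_of_nonneg_right h2 hc.le
  linarith

/-- Here `u` is the `ξ`-part and `S` the untamed `y`-part of the inner product. In `u + k S = k (u +
S) + (1 - k) u` the first term is at least `k₀ (c - e)` and the second at least `-(e + k₀ c / 4)`.
-/
theorem tamed_sum_ge {k₀ k c e u S : ℝ} (hk₀ : 0 < k₀) (hk : k₀ ≤ k) (hk1 : k ≤ 1)
    (he : e ≤ k₀ * c / 8) (he0 : 0 ≤ e) (hsum : c - e ≤ u + S) (hu : -(e + k₀ * c / 4) ≤ u) :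
    k₀ * c / 2 ≤ u + k * S := by
  have hkc : 0 ≤ k₀ * c := by linarith
  have hc : 0 ≤ c := nonneg_of_mul_nonneg_right hkc hk₀
  have hkc1 : k₀ * c ≤ c := by nlinarith
  have t1 : k₀ * (c - e) ≤ k * (u + S) :=
    mul_le_mul hk hsum (by linarith) (hk₀.le.trans hk)
  have t2 : (1 - k) * -(e + k₀ * c / 4) ≤ (1 - k) * u :=
    mul_le_mul_of_nonneg_left hu (sub_nonneg.2 hk1)
  have t3 : 0 ≤ k * (e + k₀ * c / 4) := mul_nonneg (hk₀.le.trans hk) (by linarith)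
  have t4 : k₀ * e ≤ e := by nlinarith
  linarith

/-! ### Drift at Moreau proximal points and near the minimizer -/

namespace GradientModel

variable {b : Fin d → ℝ} {m B : ℝ} {f p : ℝ × (Fin d → ℝ) → ℝ}
  {q : ℝ × (Fin d → ℝ) → Fin d → ℝ} {zs : ℝ × (Fin d → ℝ)}

/-- A one-sided Lipschitz bound. Only the gradient at `z`, whose coordinates are at least `ε`, is
involved; `z'` may be close to the boundary. -/
theorem logBarrier_sub_le (hM : GradientModel b m B f p q zs) {r ε : ℝ} (hε : 0 < ε)
    {z z' : ℝ × (Fin d → ℝ)} (hz : z ∈ truncatedRegion zs m r ε)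
    (hz' : z'.2 ∈ posOrthant d) :
    logBarrier b f z - logBarrier b f z' ≤ (B + 1 / ε) * l1Dist z z' := by
  have hzf := truncatedRegion_subset hε hz
  have h1 := hM.logBarrier_grad hzf.1 hz'
  have h2 : |∑ i, (z'.2 i - z.2 i) * (q z i - b i / z.2 i)| ≤
      (B + 1 / ε) * ∑ i, |z'.2 i - z.2 i| := by
    refine abs_sum_mul_le fun i => (abs_sub _ _).trans (add_le_add (hM.bound_q z hzf i) ?_)
    rw [abs_of_pos (div_pos (hM.b_pos i) (hzf.1 i))]
    exact div_le_div₀ one_pos.le (hM.b_le_one i) hε (hz.2.1 i)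
  have h3 : ∑ i, |z'.2 i - z.2 i| = ∑ i, |z.2 i - z'.2 i| :=
    Finset.sum_congr rfl fun i _ => abs_sub_comm _ _
  have h4 : |(z'.1 - z.1) * p z| ≤ (B + 1 / ε) * |z.1 - z'.1| := by
    rw [abs_mul, abs_sub_comm, mul_comm]
    refine mul_le_mul_of_nonneg_right ((hM.bound_p z hzf).trans ?_) (abs_nonneg _)
    have : 0 ≤ 1 / ε := by positivity
    linarith
  rw [h3] at h2
  have h5 := (abs_le.1 h2).1
  have h6 := (abs_le.1 h4).1
  unfold l1Dist
  rw [mul_add]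
  linarith

/-- Moving from `z` towards the minimizer decreases `logBarrier b f` at first order, at a cost of
second order in `bregman`. -/
theorem exists_segment_point (hM : GradientModel b m B f p q zs) {r ε δ τ : ℝ} (hr : 0 < r)
    (hε : 0 < ε) (hzs : zs ∈ truncatedRegion zs m r ε) {z : ℝ × (Fin d → ℝ)}
    (hz : z ∈ truncatedRegion zs m r ε) (hzδ : logBarrier b f zs + δ ≤ logBarrier b f z)
    (hτ0 : 0 ≤ τ) (hτ1 : τ ≤ 1) :
    ∃ w ∈ truncatedRegion zs m r ε, logBarrier b f w ≤ logBarrier b f z - τ * δ ∧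
      bregman w z ≤ τ ^ 2 * (r ^ 2 / 2 + d * (m ^ 2 / ε)) := by
  have hKf : truncatedRegion zs m r ε ⊆ feasible d m := truncatedRegion_subset hε
  have hzf := hKf hz
  set w : ℝ × (Fin d → ℝ) := (z.1 + τ * (zs.1 - z.1), fun i => z.2 i + τ * (zs.2 i - z.2 i))
    with hw
  have hwK : w ∈ truncatedRegion zs m r ε := by
    refine ⟨?_, fun i => ?_, ?_⟩
    · have : w.1 - zs.1 = (1 - τ) * (z.1 - zs.1) := by simp only [hw]; ring
      rw [this, abs_mul, abs_of_nonneg (by linarith)]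
      nlinarith [hz.1, abs_nonneg (z.1 - zs.1)]
    · have h1 := hz.2.1 i
      have h2 := hzs.2.1 i
      simp only [hw]
      nlinarith
    · have hwp : w.2 ∈ posOrthant d := fun i => by
        have h1 := hz.2.1 i
        have h2 := hzs.2.1 i
        refine lt_of_lt_of_le hε ?_
        simp only [hw]
        nlinarith
      have h1 := hzf.2
      have h2 := hM.zs_mem.2
      rw [l1_eq_sum hzf.1] at h1
      rw [l1_eq_sum hM.zs_mem.1] at h2
      have h3 : ∑ i, w.2 i = (1 - τ) * ∑ i, z.2 i + τ * ∑ i, zs.2 i := by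
        rw [Finset.mul_sum, Finset.mul_sum, ← Finset.sum_add_distrib]
        exact Finset.sum_congr rfl fun i _ => by simp only [hw]; ring
      rw [l1_eq_sum hwp, h3]
      nlinarith
  have hwf := hKf hwK
  have hφw : logBarrier b f w ≤ logBarrier b f z - τ * δ := by
    have g1 := hM.logBarrier_grad hwf.1 hzf.1
    have g2 := hM.logBarrier_grad hwf.1 hM.zs_mem.1
    have e1 : (1 - τ) * (z.1 - w.1) + τ * (zs.1 - w.1) = 0 := by simp only [hw]; ring
    have e2 : (1 - τ) * ∑ i, (z.2 i - w.2 i) * (q w i - b i / w.2 i) +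
        τ * ∑ i, (zs.2 i - w.2 i) * (q w i - b i / w.2 i) = 0 := by
      rw [Finset.mul_sum, Finset.mul_sum, ← Finset.sum_add_distrib]
      exact Finset.sum_eq_zero fun i _ => by simp only [hw]; ring
    have g3 := mul_le_mul_of_nonneg_left g1 (sub_nonneg.2 hτ1)
    have g4 := mul_le_mul_of_nonneg_left g2 hτ0
    have g5 := mul_le_mul_of_nonneg_left hzδ hτ0
    linear_combination g3 + g4 + g5 - p w * e1 - e2
  have hbw : bregman w z ≤ τ ^ 2 * (r ^ 2 / 2 + d * (m ^ 2 / ε)) := by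
    have h1 : DF w.2 z.2 ≤ ∑ _i : Fin d, τ ^ 2 * (m ^ 2 / ε) := by
      refine (DF_le_sum_sq_div hwf.1 hzf.1).trans (Finset.sum_le_sum fun i _ => ?_)
      have h2 : w.2 i - z.2 i = τ * (zs.2 i - z.2 i) := by simp only [hw]; ring
      have h3 : (zs.2 i - z.2 i) ^ 2 ≤ m ^ 2 := by
        have a1 := apply_le_of_l1_le hM.zs_mem.2 i
        have a2 := apply_le_of_l1_le hzf.2 i
        have a3 := hM.zs_mem.1 i
        have a4 := hzf.1 i
        exact sq_le_sq' (by linarith) (by linarith)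
      rw [h2, mul_pow, mul_div_assoc]
      exact mul_le_mul_of_nonneg_left (div_le_div₀ (sq_nonneg _) h3 hε (hz.2.1 i)) (sq_nonneg _)
    rw [Finset.sum_const, Finset.card_univ, Fintype.card_fin, nsmul_eq_mul] at h1
    have h4 : (z.1 - w.1) ^ 2 ≤ τ ^ 2 * r ^ 2 := by
      have : z.1 - w.1 = τ * (z.1 - zs.1) := by simp only [hw]; ring
      rw [this, mul_pow]
      exact mul_le_mul_of_nonneg_left (sq_le_sq.2 (by rw [abs_of_pos hr]; exact hz.1)) (sq_nonneg _)
    unfold bregman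
    linarith
  exact ⟨w, hwK, hφw, hbw⟩

/-- Away from the minimizer, the tamed gradient points away from the Moreau proximal point. -/
theorem exists_moreau_drift (hM : GradientModel b m B f p q zs) {r ε δ : ℝ} (hr : 0 < r)
    (hε : 0 < ε) (hzs : zs ∈ truncatedRegion zs m r ε) (hδ : 0 < δ) :
    ∃ (η c : ℝ) (F : Finset (ℝ × (Fin d → ℝ))), 0 < η ∧ 0 < c ∧ F.Nonempty ∧
      (∀ z ∈ F, z ∈ truncatedRegion zs m r ε) ∧
      ∀ z ∈ truncatedRegion zs m r ε, ∀ z' ∈ F,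
        (∀ z'' ∈ F, moreau (logBarrier b f) η z' z ≤ moreau (logBarrier b f) η z'' z) →
        moreau (logBarrier b f) η z' z ≤ logBarrier b f z + δ ∧
        (logBarrier b f zs + δ ≤ logBarrier b f z →
          c ≤ (z.1 - z'.1) * p z + kap z.2 * ∑ i, (z.2 i - z'.2 i) * (q z i - b i / z.2 i) ∧
          logBarrier b f z - δ / 2 ≤ moreau (logBarrier b f) η z' z) := by
  have := hM.nonempty
  have hm := hM.m_pos
  have hB := hM.B_nonneg
  set K := truncatedRegion zs m r ε with hKdef
  have hKcpt : IsCompact K := isCompact_truncatedRegion zs m r ε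
  have hKf : K ⊆ feasible d m := truncatedRegion_subset hε
  have hKpos : K ⊆ {z | z.2 ∈ posOrthant d} := fun z hz => (hKf hz).1
  set φ := logBarrier b f with hφdef
  have hφ : ContinuousOn φ {z | z.2 ∈ posOrthant d} := hM.continuousOn_logBarrier
  set k₀ := min ε 1 with hk₀
  have hk₀0 : 0 < k₀ := lt_min hε one_pos
  set A := B + 1 / ε with hA
  have hA0 : 0 < A := by positivity
  set cV := ((d : ℝ) + 1) * (4 * m + 4) with hcV
  have hcV0 : 0 < cV := by positivity
  set CV := r ^ 2 / 2 + d * (m ^ 2 / ε) with hCV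
  have hCV0 : 0 < CV := by positivity
  -- Along the segment to `zs` the Moreau objective decreases by at least `τ δ - τ² CV / η`. The
  -- optimal `τ = δ η / (2 CV)` gives the decrease `c₁ η`.
  set c₁ := δ ^ 2 / (4 * CV) with hc₁
  have hc₁0 : 0 < c₁ := by positivity
  set C₄ := (A + 1) * cV + 1 with hC₄
  have hC₄0 : 0 < C₄ := by positivity
  have hup : UniformContinuousOn p K :=
    hKcpt.uniformContinuousOn_of_continuous (hM.cont_p.mono hKpos)
  rw [Metric.uniformContinuousOn_iff] at hup
  obtain ⟨ρ, hρ, hpρ⟩ := hup (k₀ * c₁ / (4 * C₄)) (by positivity)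
  -- The three bounds ensure, in turn, that the optimal `τ` is at most `1`, that the Moreau value is
  -- within `δ / 2` of `φ z`, and that the proximal point is close enough for `p` to vary by less
  -- than `k₀ c₁ / (4 C₄)`.
  set η := min (min (2 * CV / δ) (δ / (2 * (A * C₄)))) (ρ / (2 * C₄)) with hη
  have hη0 : 0 < η := by positivity
  have hη1 : η ≤ 2 * CV / δ := (min_le_left _ _).trans (min_le_left _ _)
  have hη2 : η ≤ δ / (2 * (A * C₄)) := (min_le_left _ _).trans (min_le_right _ _)
  have hη3 : η ≤ ρ / (2 * C₄) := min_le_right _ _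
  -- The error of the net must be small compared with the decrease `c₁ η`, which is itself of order
  -- `η`; hence `e` is chosen after `η`.
  set e := min (min (k₀ * c₁ * η / 8) η) δ with he
  have he0 : 0 < e := by positivity
  have he1 : e ≤ k₀ * c₁ * η / 8 := (min_le_left _ _).trans (min_le_left _ _)
  have he2 : e ≤ η := (min_le_left _ _).trans (min_le_right _ _)
  have he3 : e ≤ δ := min_le_right _ _
  obtain ⟨F, hFK, hF⟩ := exists_moreau_net hφ η hKcpt hKpos he0
  obtain ⟨z₀, hz₀F, -⟩ := hF zs hzs zs hzs
  refine ⟨η, k₀ * c₁ * η / 2, F, hη0, by positivity, ⟨z₀, hz₀F⟩, hFK, fun z hz z' hz'F hmin => ?_⟩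
  have hz' := hFK z' hz'F
  have hzf := hKf hz
  have hzf' := hKf hz'
  have hopt : ∀ w ∈ K, moreau φ η z' z ≤ moreau φ η w z + e := fun w hw => by
    obtain ⟨z'', hz'', h⟩ := hF z hz w hw
    exact (hmin z'' hz'').trans h
  have hself : moreau φ η z z = φ z := by
    rw [moreau, bregman_self, zero_div, add_zero]
  have hoptz := hopt z hz
  rw [hself] at hoptz
  refine ⟨by linarith, fun hzδ => ?_⟩
  have hlip := hM.logBarrier_sub_le hε hz hzf'.1
  rw [← hφdef, ← hA] at hlip
  have hbreg := bregman_ge hm hzf hzf'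
  rw [← hcV] at hbreg
  set N := l1Dist z z' with hN
  have hN0 : 0 ≤ N := l1Dist_nonneg z z'
  have hmoreau : moreau φ η z' z = φ z' + bregman z' z / η := rfl
  have hNη : N ≤ C₄ * η := by
    exact le_mul_of_sq_div_le hcV0 hη0 hA0.le hbreg (by linarith) he2
  have hlow : φ z - δ / 2 ≤ moreau φ η z' z := by
    have h1 : 0 ≤ bregman z' z / η := div_nonneg (bregman_nonneg hzf.1 hzf'.1) hη0.le
    have h2 : A * N ≤ δ / 2 := by
      rw [le_div_iff₀ (by positivity)] at hη2
      have := mul_le_mul_of_nonneg_left hNη hA0.le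
      linarith
    linarith
  refine ⟨?_, hlow⟩
  -- comparison with a point on the segment to the minimizer
  have hdec : φ z' ≤ φ z - c₁ * η + e := by
    set τ := δ * η / (2 * CV) with hτ
    have hτ0 : 0 < τ := by positivity
    have hτ1 : τ ≤ 1 := by
      rw [hτ, div_le_one (by positivity)]
      rw [le_div_iff₀ hδ] at hη1
      linarith
    obtain ⟨w, hwK, hφw, hbw⟩ := hM.exists_segment_point hr hε hzs hz hzδ hτ0.le hτ1
    have h1 := hopt w hwK
    have h2 : bregman w z / η ≤ τ ^ 2 * CV / η := div_le_div_of_nonneg_right hbw hη0.le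
    have h3 : τ * δ - τ ^ 2 * CV / η = c₁ * η := by
      rw [hτ, hc₁]; field_simp; ring
    have h4 : 0 ≤ bregman z' z / η := div_nonneg (bregman_nonneg hzf.1 hzf'.1) hη0.le
    have h5 : moreau φ η w z = φ w + bregman w z / η := rfl
    linarith
  -- comparison in the first variable
  have hfirst : -e ≤ (z.1 - z'.1) * p (z.1, z'.2) := by
    have hwK : ((z.1, z'.2) : ℝ × (Fin d → ℝ)) ∈ K := ⟨hz.1, hz'.2⟩
    -- The competitor `(ξ, y')` has the same `y`-cost as `z'` and no `ξ`-cost, so `φ z' ≤ φ (ξ, y')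
    -- + e`. The subgradient inequality at `(ξ, y')` then gives the sign.
    have h1 := hopt _ hwK
    have h2 := hM.logBarrier_grad (z := (z.1, z'.2)) (z' := z') hzf'.1 hzf'.1
    simp only [sub_self, zero_mul, Finset.sum_const_zero, add_zero] at h2
    have h3 : moreau φ η (z.1, z'.2) z = φ (z.1, z'.2) + DF z'.2 z.2 / η := by
      simp [moreau, bregman]
    have h4 : moreau φ η z' z = φ z' + (z.1 - z'.1) ^ 2 / 2 / η + DF z'.2 z.2 / η := by
      simp only [moreau, bregman]; ring
    have h5 : 0 ≤ (z.1 - z'.1) ^ 2 / 2 / η := by positivity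
    change φ (z.1, z'.2) + _ ≤ φ z' at h2
    linarith
  -- The sign is known for `p (ξ, y')`, but the algorithm uses `p z`. Multiplied by `|ξ - ξ'| ≤ C₄
  -- η`, the difference costs at most `k₀ c₁ η / 4`.
  have hpdiff : |p z - p (z.1, z'.2)| ≤ k₀ * c₁ / (4 * C₄) := by
    have hwK : ((z.1, z'.2) : ℝ × (Fin d → ℝ)) ∈ K := ⟨hz.1, hz'.2⟩
    have h1 := hpρ z hz _ hwK (by
      rw [Prod.dist_eq]
      simp only [dist_self]
      rw [max_eq_right dist_nonneg]
      refine (dist_snd_le_l1Dist z z').trans_lt ?_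
      rw [le_div_iff₀ (by positivity)] at hη3
      nlinarith)
    rw [Real.dist_eq] at h1
    exact h1.le
  have hpz : -(e + k₀ * c₁ * η / 4) ≤ (z.1 - z'.1) * p z := by
    have h1 : |(z.1 - z'.1) * (p z - p (z.1, z'.2))| ≤ k₀ * c₁ * η / 4 := by
      rw [abs_mul]
      calc |z.1 - z'.1| * |p z - p (z.1, z'.2)| ≤ (C₄ * η) * (k₀ * c₁ / (4 * C₄)) :=
            mul_le_mul ((abs_fst_le_l1Dist z z').trans hNη) hpdiff (abs_nonneg _) (by positivity)
        _ = k₀ * c₁ * η / 4 := by field_simp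
    have h2 := (abs_le.1 h1).1
    linarith
  have hgrad := hM.logBarrier_grad hzf.1 hzf'.1
  have hk : k₀ ≤ kap z.2 := le_kap (fun i => (min_le_left _ _).trans (hz.2.1 i)) (min_le_right _ _)
  have hk1 := kap_le_one z.2
  set k := kap z.2
  set S := ∑ i, (z.2 i - z'.2 i) * (q z i - b i / z.2 i) with hS
  have hSneg : ∑ i, (z'.2 i - z.2 i) * (q z i - b i / z.2 i) = -S := by
    rw [hS, ← Finset.sum_neg_distrib]
    exact Finset.sum_congr rfl fun i _ => by ring
  rw [hSneg] at hgrad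
  have hsum : c₁ * η - e ≤ (z.1 - z'.1) * p z + S := by
    change φ z + _ + _ ≤ φ z' at hgrad
    linarith
  have := tamed_sum_ge hk₀0 hk hk1 (c := c₁ * η) (by linarith) he0.le hsum (by linarith)
  linarith

/-- Close to the minimizer the squared distance is a Lyapunov function. -/
theorem exists_local_drift (hM : GradientModel b m B f p q zs) {r ε : ℝ} (hε : 0 < ε) :
    ∃ δ : ℝ, 0 < δ ∧ ∀ z ∈ truncatedRegion zs m r ε,
      logBarrier b f z ≤ logBarrier b f zs + 3 * δ →
      logBarrier b f z - logBarrier b f zs ≤ (z.1 - zs.1) * p z +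
        (kap zs.2)⁻¹ * (kap z.2 * ∑ i, (z.2 i - zs.2 i) * (q z i - b i / z.2 i)) := by
  have := hM.nonempty
  have hm := hM.m_pos
  set K := truncatedRegion zs m r ε with hKdef
  have hKcpt : IsCompact K := isCompact_truncatedRegion zs m r ε
  have hKf : K ⊆ feasible d m := truncatedRegion_subset hε
  have hKpos : K ⊆ {z | z.2 ∈ posOrthant d} := fun z hz => (hKf hz).1
  have hk0 : 0 < kap zs.2 := kap_pos hM.zs_mem.1
  obtain ⟨j, hj⟩ := exists_eq_ciInf_of_finite (f := b)
  have hbj : ∀ i, b j ≤ b i := fun i => by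
    rw [hj]; exact ciInf_le (Set.finite_range _).bddBelow i
  have hbj0 := hM.b_pos j
  have hd : (0 : ℝ) ≤ d := Nat.cast_nonneg d
  set w := (kap zs.2)⁻¹ with hw
  have hw0 : 0 < w := by positivity
  -- With `T` the `ℓ¹` distance of `y` to `y⋆`, the taming mismatch is `w |κ(y) - κ(y⋆)| |S| ≤ w T ·
  -- ρ T`, and `T² ≤ d V`. This `ρ` makes it smaller than the strong convexity term `b j V / (4
  -- m²)`, where `b j` is the smallest weight.
  set ρ := b j / (4 * m ^ 2) / (w * (d + 1)) with hρ
  have hρ0 : 0 < ρ := by positivity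
  have hev : ∀ᶠ z in 𝓝 zs, ∀ i, |q z i - b i / z.2 i| ≤ ρ := by
    rw [eventually_all]
    intro i
    have h1 := (hM.continuousOn_grad_logBarrier i).continuousAt
      (isOpen_snd_mem_posOrthant.mem_nhds hM.zs_mem.1)
    have h2 : Tendsto (fun z => q z i - b i / z.2 i) (𝓝 zs) (𝓝 0) := by
      have := h1.tendsto
      rwa [hM.grad_logBarrier_zs_eq_zero i] at this
    have h3 := h2 (Metric.closedBall_mem_nhds 0 hρ0)
    filter_upwards [h3] with z hz
    simpa [Real.dist_eq] using hz
  obtain ⟨s, hs, hball⟩ := Metric.eventually_nhds_iff_ball.1 hev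
  -- On the compact set `K` without the ball, the gap has a positive minimum. A quarter of it leaves
  -- room for the level `3 δ`.
  obtain ⟨δ, hδ, hδK⟩ : ∃ δ : ℝ, 0 < δ ∧ ∀ z ∈ K, z ∉ Metric.ball zs s →
      logBarrier b f zs + 3 * δ < logBarrier b f z := by
    have hcpt : IsCompact (K \ Metric.ball zs s) := hKcpt.diff Metric.isOpen_ball
    rcases (K \ Metric.ball zs s).eq_empty_or_nonempty with h0 | hne
    · refine ⟨1, one_pos, fun z hz hzb => ?_⟩
      have : z ∈ K \ Metric.ball zs s := ⟨hz, hzb⟩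
      rw [h0] at this
      exact this.elim
    · obtain ⟨z₁, hz₁, hmin⟩ := hcpt.exists_isMinOn hne
        (hM.continuousOn_logBarrier.mono fun z hz => hKpos hz.1)
      have hlt := hM.lt_of_ne z₁ (hKpos hz₁.1) (by
        rintro rfl
        exact hz₁.2 (Metric.mem_ball_self hs))
      refine ⟨(logBarrier b f z₁ - logBarrier b f zs) / 4, by linarith, fun z hz hzb => ?_⟩
      have : logBarrier b f z₁ ≤ logBarrier b f z := hmin ⟨hz, hzb⟩
      linarith
  refine ⟨δ, hδ, fun z hz hle => ?_⟩
  have hzb : z ∈ Metric.ball zs s := by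
    by_contra hcon
    linarith [hδK z hz hcon]
  have hQ := hball z hzb
  have hzf := hKf hz
  have hstr := hM.logBarrier_grad_strong hzf hM.zs_mem
  set S := ∑ i, (z.2 i - zs.2 i) * (q z i - b i / z.2 i) with hS
  have hSneg : ∑ i, (zs.2 i - z.2 i) * (q z i - b i / z.2 i) = -S := by
    rw [hS, ← Finset.sum_neg_distrib]
    exact Finset.sum_congr rfl fun i _ => by ring
  rw [hSneg] at hstr
  set T := ∑ i, |z.2 i - zs.2 i| with hT
  set V := ∑ i, (z.2 i - zs.2 i) ^ 2 with hV
  have hT0 : 0 ≤ T := Finset.sum_nonneg fun _ _ => abs_nonneg _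
  have hV0 : 0 ≤ V := Finset.sum_nonneg fun _ _ => sq_nonneg _
  have hTV : T ^ 2 ≤ d * V := sq_sum_abs_le _
  have hSb : |S| ≤ ρ * T := abs_sum_mul_le hQ
  have hkk : |kap z.2 - kap zs.2| ≤ T := abs_kap_sub_le hT0 fun i =>
    Finset.single_le_sum (f := fun i => |z.2 i - zs.2 i|) (fun _ _ => abs_nonneg _)
      (Finset.mem_univ i)
  have hquad : b j / (4 * m ^ 2) * V ≤ ∑ i, b i * (z.2 i - zs.2 i) ^ 2 / (4 * m ^ 2) := by
    rw [hV, Finset.mul_sum]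
    refine Finset.sum_le_sum fun i _ => ?_
    rw [div_mul_eq_mul_div]
    exact div_le_div_of_nonneg_right (mul_le_mul_of_nonneg_right (hbj i) (sq_nonneg _))
      (by positivity)
  have hdiff : |(w * kap z.2 - 1) * S| ≤ b j / (4 * m ^ 2) * V := by
    have h1 : w * kap z.2 - 1 = w * (kap z.2 - kap zs.2) := by
      rw [mul_sub, hw, inv_mul_cancel₀ hk0.ne']
    rw [h1, abs_mul, abs_mul, abs_of_pos hw0]
    calc w * |kap z.2 - kap zs.2| * |S| ≤ w * T * (ρ * T) :=
          mul_le_mul (mul_le_mul_of_nonneg_left hkk hw0.le) hSb (abs_nonneg _) (by positivity)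
      _ = w * ρ * T ^ 2 := by ring
      _ ≤ w * ρ * (d * V) := mul_le_mul_of_nonneg_left hTV (by positivity)
      _ ≤ w * ρ * ((d + 1) * V) := mul_le_mul_of_nonneg_left (by linarith) (by positivity)
      _ = b j / (4 * m ^ 2) * V := by rw [hρ]; field_simp
  have hd1 := (abs_le.1 hdiff).1
  have e1 : (z.1 - zs.1) * p z + w * (kap z.2 * S) =
      (z.1 - zs.1) * p z + S + (w * kap z.2 - 1) * S := by ring
  rw [e1]
  linarith

end GradientModel

/-! ### Quadratic upper bounds along a mirror step -/

/-- `U` decreases along a mirror step up to second order, with linear part `(α, β)`. -/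
def MirrorStep (m : ℝ) (U α : ℝ × (Fin d → ℝ) → ℝ) (β : ℝ × (Fin d → ℝ) → Fin d → ℝ)
    (C : ℝ) : Prop :=
  ∀ z ∈ feasible d m, ∀ (a : ℝ) (v : Fin d → ℝ),
    U (z.1 - a, prox m z.2 v) ≤ U z - (α z * a + ∑ i, β z i * v i) + C * (a ^ 2 + ∑ i, v i ^ 2)

theorem MirrorStep.add {m : ℝ} {U₁ U₂ α₁ α₂ : ℝ × (Fin d → ℝ) → ℝ}
    {β₁ β₂ : ℝ × (Fin d → ℝ) → Fin d → ℝ} {C₁ C₂ : ℝ} (h₁ : MirrorStep m U₁ α₁ β₁ C₁)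
    (h₂ : MirrorStep m U₂ α₂ β₂ C₂) :
    MirrorStep m (fun z => U₁ z + U₂ z) (fun z => α₁ z + α₂ z) (fun z i => β₁ z i + β₂ z i)
      (C₁ + C₂) := fun z hz a v => by
  have := h₁ z hz a v
  have := h₂ z hz a v
  simp only [add_mul, Finset.sum_add_distrib]
  linarith

theorem MirrorStep.const_mul {m : ℝ} {U α : ℝ × (Fin d → ℝ) → ℝ}
    {β : ℝ × (Fin d → ℝ) → Fin d → ℝ} {C : ℝ} (h : MirrorStep m U α β C) {A : ℝ} (hA : 0 ≤ A) :
    MirrorStep m (fun z => A * U z) (fun z => A * α z) (fun z i => A * β z i) (A * C) :=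
  fun z hz a v => by
    have := mul_le_mul_of_nonneg_left (h z hz a v) hA
    simp only [mul_assoc, ← Finset.mul_sum]
    linarith

theorem sum_nonneg_sq (v : Fin d → ℝ) : 0 ≤ ∑ i, v i ^ 2 := Finset.sum_nonneg fun _ _ => sq_nonneg _

theorem sq_sum_mul_sub_le {m : ℝ} {y y' : Fin d → ℝ} (hy : l1 y ≤ m) (hy' : l1 y' ≤ m)
    (v : Fin d → ℝ) : (∑ i, v i * (y i - y' i)) ^ 2 ≤ 4 * m ^ 2 * ∑ i, v i ^ 2 := by
  have h1 : |∑ i, (y i - y' i) * v i| ≤ √(∑ i, v i ^ 2) * ∑ i, |y i - y' i| := by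
    refine abs_sum_mul_le fun i => ?_
    rw [← Real.sqrt_sq_eq_abs]
    exact Real.sqrt_le_sqrt (Finset.single_le_sum (f := fun i => v i ^ 2)
      (fun _ _ => sq_nonneg _) (Finset.mem_univ i))
  have h2 : ∑ i, v i * (y i - y' i) = ∑ i, (y i - y' i) * v i :=
    Finset.sum_congr rfl fun i _ => mul_comm _ _
  have h3 := h1.trans (mul_le_mul_of_nonneg_left (sum_abs_sub_le hy hy') (Real.sqrt_nonneg _))
  have h4 := pow_le_pow_left₀ (abs_nonneg _) h3 2
  rw [sq_abs, mul_pow, Real.sq_sqrt (sum_nonneg_sq v)] at h4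
  rw [h2]
  linarith

theorem mirrorStep_sq (m : ℝ) (c : ℝ) :
    MirrorStep (d := d) m (fun z => (z.1 - c) ^ 2 / 2) (fun z => z.1 - c) (fun _ _ => 0) (1 / 2) :=
  fun z _ a v => by
    have := sum_nonneg_sq v
    simp only [zero_mul, Finset.sum_const_zero]
    linarith [sq_nonneg a, (by ring : (z.1 - a - c) ^ 2 = (z.1 - c) ^ 2 - 2 * ((z.1 - c) * a) + a ^ 2)]

theorem mirrorStep_ramp_fst (m c R : ℝ) :
    MirrorStep (d := d) m (fun z => ramp (z.1 - c - R) + ramp (-(z.1 - c) - R))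
      (fun z => clamp (z.1 - c - R) - clamp (-(z.1 - c) - R)) (fun _ _ => 0) 1 :=
  fun z _ a v => by
    have h0 := sum_nonneg_sq v
    have h1 := ramp_add_le (z.1 - c - R) (-a)
    have h2 := ramp_add_le (-(z.1 - c) - R) a
    simp only [zero_mul, Finset.sum_const_zero]
    have e1 : z.1 - a - c - R = z.1 - c - R + -a := by ring
    have e2 : -(z.1 - a - c) - R = -(z.1 - c) - R + a := by ring
    rw [e1, e2]
    nlinarith

theorem mirrorStep_DF [Nonempty (Fin d)] {m : ℝ} {c : ℝ × (Fin d → ℝ)} (hc : c ∈ feasible d m) :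
    MirrorStep m (fun z => DF c.2 z.2) (fun _ => 0) (fun z i => z.2 i - c.2 i) (3 * m) :=
  fun z hz a v => by
    have hm : 0 < m := (l1_pos hc.1).trans_le hc.2
    have h1 := DF_prox_le hz.1 hz.2 hc.1 hc.2 v
    have h2 : ∑ i, (z.2 i - c.2 i) * v i = ∑ i, v i * (z.2 i - c.2 i) :=
      Finset.sum_congr rfl fun i _ => mul_comm _ _
    simp only [h2]
    nlinarith [mul_nonneg hm.le (sq_nonneg a)]

/-- The linear term `X` contributes `X² / 2 ≤ 2 m² S` through the curvature of `ramp`. The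
second-order error `3 m S` of `DF_prox_le` passes with slope at most `1`. -/
theorem mirrorStep_ramp_DF [Nonempty (Fin d)] {m : ℝ} {c : ℝ × (Fin d → ℝ)}
    (hc : c ∈ feasible d m) (k : ℝ) :
    MirrorStep m (fun z => ramp (DF c.2 z.2 - k)) (fun _ => 0)
      (fun z i => clamp (DF c.2 z.2 - k) * (z.2 i - c.2 i)) (2 * m ^ 2 + 3 * m) :=
  fun z hz a v => by
    have hm : 0 < m := (l1_pos hc.1).trans_le hc.2
    have h1 := DF_prox_le hz.1 hz.2 hc.1 hc.2 v
    have hS := sum_nonneg_sq v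
    have h3 := sq_sum_mul_sub_le hz.2 hc.2 v
    have h4 : ∑ i, clamp (DF c.2 z.2 - k) * (z.2 i - c.2 i) * v i =
        clamp (DF c.2 z.2 - k) * ∑ i, v i * (z.2 i - c.2 i) := by
      rw [Finset.mul_sum]
      exact Finset.sum_congr rfl fun i _ => by ring
    simp only [h4]
    set X := ∑ i, v i * (z.2 i - c.2 i)
    set S := ∑ i, v i ^ 2
    set D := DF c.2 z.2
    have h5 : ramp (DF c.2 (prox m z.2 v) - k) ≤ ramp (D - k + -X + 3 * m * S) :=
      ramp_mono (by linarith)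
    have h6 := ramp_add_le_add (t := D - k + -X) (s := 3 * m * S) (by positivity)
    have h7 := ramp_add_le (D - k) (-X)
    have h8 : 0 ≤ (2 * m ^ 2 + 3 * m) * a ^ 2 := by positivity
    linarith

/-- The truncated Moreau envelope, along a selection `sel` of proximal points. -/
noncomputable def cappedMoreau (φ : ℝ × (Fin d → ℝ) → ℝ) (η cap : ℝ)
    (sel : ℝ × (Fin d → ℝ) → ℝ × (Fin d → ℝ)) (z : ℝ × (Fin d → ℝ)) : ℝ :=
  min (moreau φ η (sel z) z) cap

/-- The derivative factor of the smoothed truncated Moreau envelope. -/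
noncomputable def moreauSlope (φ : ℝ × (Fin d → ℝ) → ℝ) (η cap l δ : ℝ)
    (sel : ℝ × (Fin d → ℝ) → ℝ × (Fin d → ℝ)) (z : ℝ × (Fin d → ℝ)) : ℝ :=
  if moreau φ η (sel z) z < cap then clamp ((moreau φ η (sel z) z - l) / δ) / (δ * η) else 0

theorem moreauSlope_nonneg {φ : ℝ × (Fin d → ℝ) → ℝ} {η cap l δ : ℝ} (hη : 0 < η) (hδ : 0 < δ)
    (sel : ℝ × (Fin d → ℝ) → ℝ × (Fin d → ℝ)) (z : ℝ × (Fin d → ℝ)) :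
    0 ≤ moreauSlope φ η cap l δ sel z := by
  unfold moreauSlope
  split_ifs
  · exact div_nonneg (clamp_nonneg _) (by positivity)
  · exact le_rfl

theorem moreauSlope_le {φ : ℝ × (Fin d → ℝ) → ℝ} {η cap l δ : ℝ} (hη : 0 < η) (hδ : 0 < δ)
    (sel : ℝ × (Fin d → ℝ) → ℝ × (Fin d → ℝ)) (z : ℝ × (Fin d → ℝ)) :
    moreauSlope φ η cap l δ sel z ≤ 1 / (δ * η) := by
  unfold moreauSlope
  split_ifs
  · exact div_le_div_of_nonneg_right (clamp_le_one _) (by positivity)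
  · positivity

/-- This is what the cap is for: `ξ` is unbounded, yet wherever the cap is inactive the proximal
point is at bounded `ξ`-distance, so the linear part of the envelope is bounded. -/
theorem abs_sub_sel_le {φ : ℝ × (Fin d → ℝ) → ℝ} {η cap lo : ℝ} (hη : 0 < η)
    {z z' : ℝ × (Fin d → ℝ)} (hz : z.2 ∈ posOrthant d) (hz' : z'.2 ∈ posOrthant d)
    (hlo : lo ≤ φ z') (hcap : moreau φ η z' z < cap) : (z.1 - z'.1) ^ 2 ≤ 2 * η * (cap - lo) := by
  have h1 := DF_nonneg hz' hz
  unfold moreau bregman at hcap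
  have h2 : ((z.1 - z'.1) ^ 2 / 2 + DF z'.2 z.2) / η ≤ cap - lo := by linarith
  rw [div_le_iff₀ hη] at h2
  linarith

/-- A minimum inherits quadratic upper bounds: the proximal point of `z` is kept as competitor at
the new point, and the bound for its Bregman divergence is used. Where the cap is active the linear
part is `0`, and the new value does not exceed the cap. -/
theorem mirrorStep_moreau [Nonempty (Fin d)] {m : ℝ} {φ : ℝ × (Fin d → ℝ) → ℝ}
    {η cap l δ lo : ℝ} (hη : 0 < η) (hδ : 0 < δ) {F : Finset (ℝ × (Fin d → ℝ))}
    (hF : ∀ z ∈ F, z ∈ feasible d m) (hlo : ∀ z ∈ F, lo ≤ φ z)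
    {sel : ℝ × (Fin d → ℝ) → ℝ × (Fin d → ℝ)} (hsel : ∀ z, sel z ∈ F)
    (hmin : ∀ z, ∀ z' ∈ F, moreau φ η (sel z) z ≤ moreau φ η z' z) :
    ∃ C, MirrorStep m (fun z => ramp ((cappedMoreau φ η cap sel z - l) / δ))
      (fun z => moreauSlope φ η cap l δ sel z * (z.1 - (sel z).1))
      (fun z i => moreauSlope φ η cap l δ sel z * (z.2 i - (sel z).2 i)) C := by
  -- If `cap < lo` the cap is active at every point of the orthant and the function is constant
  -- there.
  by_cases hlc : lo ≤ cap
  swap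
  · refine ⟨0, fun z hz a v => ?_⟩
    have hge : ∀ z : ℝ × (Fin d → ℝ), z.2 ∈ posOrthant d → cap ≤ moreau φ η (sel z) z :=
      fun z hz => by
        have h1 := bregman_nonneg hz (hF _ (hsel z)).1
        have h2 := div_nonneg h1 hη.le
        have h3 := hlo _ (hsel z)
        unfold moreau
        linarith
    have hm : 0 < m := (l1_pos hz.1).trans_le hz.2
    have e1 : cappedMoreau φ η cap sel z = cap := min_eq_right (hge z hz.1)
    have e2 : cappedMoreau φ η cap sel (z.1 - a, prox m z.2 v) = cap :=
      min_eq_right (hge _ (prox_mem_posOrthant hm hz.1 v))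
    have e3 : moreauSlope φ η cap l δ sel z = 0 := by
      unfold moreauSlope
      rw [if_neg (not_lt.2 (hge z hz.1))]
    simp [e1, e2, e3]
  obtain ⟨z₀, hz₀⟩ : ∃ z, z ∈ feasible d m := ⟨_, hF _ (hsel (0, 0))⟩
  have hm : 0 < m := (l1_pos hz₀.1).trans_le hz₀.2
  refine ⟨(2 * η * (cap - lo) + 4 * m ^ 2) / (δ * η) ^ 2 + (1 + 3 * m) / (δ * η),
    fun z hz a v => ?_⟩
  have hcl : 0 ≤ cap - lo := sub_nonneg.2 hlc
  have hS := sum_nonneg_sq v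
  have hzp : prox m z.2 v ∈ posOrthant d := prox_mem_posOrthant hm hz.1 v
  have hsz := hF _ (hsel z)
  have h1 := DF_prox_le hz.1 hz.2 hsz.1 hsz.2 v
  have h3 := sq_sum_mul_sub_le hz.2 hsz.2 v
  set z' := sel z with hz'
  set zp : ℝ × (Fin d → ℝ) := (z.1 - a, prox m z.2 v) with hzpdef
  set X := ∑ i, v i * (z.2 i - z'.2 i) with hX
  set S := ∑ i, v i ^ 2 with hSdef
  set s := moreauSlope φ η cap l δ sel z with hs
  have hsum : ∑ i, s * (z.2 i - z'.2 i) * v i = s * X := by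
    rw [hX, Finset.mul_sum]
    exact Finset.sum_congr rfl fun i _ => by ring
  rw [hsum]
  change ramp ((cappedMoreau φ η cap sel zp - l) / δ) ≤ ramp ((cappedMoreau φ η cap sel z - l) / δ) -
    (s * (z.1 - z'.1) * a + s * X) + _ * (a ^ 2 + S)
  set lin := -((z.1 - z'.1) * a + X) / η with hlin
  set quad := (a ^ 2 / 2 + 3 * m * S) / η with hquad
  have hquad0 : 0 ≤ quad := by positivity
  have hstep : moreau φ η (sel zp) zp ≤ moreau φ η z' z + lin + quad := by
    refine (hmin zp z' (hsel z)).trans ?_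
    have h4 : bregman z' zp ≤ bregman z' z + -((z.1 - z'.1) * a + X) + (a ^ 2 / 2 + 3 * m * S) := by
      unfold bregman
      simp only [hzpdef]
      linarith [(by ring : (z.1 - a - z'.1) ^ 2 = (z.1 - z'.1) ^ 2 - 2 * ((z.1 - z'.1) * a) + a ^ 2)]
    have h5 := div_le_div_of_nonneg_right h4 hη.le
    rw [add_div, add_div] at h5
    unfold moreau
    linarith
  have hCpos : 0 ≤ ((2 * η * (cap - lo) + 4 * m ^ 2) / (δ * η) ^ 2 + (1 + 3 * m) / (δ * η)) *
      (a ^ 2 + S) := by positivity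
  by_cases hcap : moreau φ η z' z < cap
  · have hsq := abs_sub_sel_le hη hz.1 hsz.1 (hlo _ (hsel z)) hcap
    have e1 : cappedMoreau φ η cap sel z = moreau φ η z' z := min_eq_left hcap.le
    have e3 : s = clamp ((moreau φ η z' z - l) / δ) / (δ * η) := by
      rw [hs]; unfold moreauSlope; rw [if_pos hcap]
    set Φ := moreau φ η z' z with hΦ
    have h6 : ramp ((cappedMoreau φ η cap sel zp - l) / δ) ≤
        ramp ((Φ - l) / δ + lin / δ + quad / δ) := by
      refine ramp_mono ?_
      rw [← add_div, ← add_div]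
      refine div_le_div_of_nonneg_right ?_ hδ.le
      have : cappedMoreau φ η cap sel zp ≤ moreau φ η (sel zp) zp := min_le_left _ _
      linarith
    have h7 := ramp_add_le_add (t := (Φ - l) / δ + lin / δ) (s := quad / δ) (by positivity)
    have h8 := ramp_add_le ((Φ - l) / δ) (lin / δ)
    have h9 : clamp ((Φ - l) / δ) * (lin / δ) = -(s * (z.1 - z'.1) * a + s * X) := by
      rw [e3, hlin]; field_simp
    have h10 : (lin / δ) ^ 2 / 2 ≤ (2 * η * (cap - lo) + 4 * m ^ 2) / (δ * η) ^ 2 * (a ^ 2 + S) := by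
      have e4 : (lin / δ) ^ 2 / 2 = ((z.1 - z'.1) * a + X) ^ 2 / 2 / (δ * η) ^ 2 := by
        rw [hlin]; field_simp
      rw [e4, div_mul_eq_mul_div]
      refine div_le_div_of_nonneg_right ?_ (by positivity)
      have h11 : ((z.1 - z'.1) * a) ^ 2 ≤ 2 * η * (cap - lo) * a ^ 2 := by
        rw [mul_pow]; exact mul_le_mul_of_nonneg_right hsq (sq_nonneg a)
      have h12 : ((z.1 - z'.1) * a + X) ^ 2 ≤ 2 * (((z.1 - z'.1) * a) ^ 2 + X ^ 2) := add_sq_le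
      have h13 : 0 ≤ 2 * η * (cap - lo) * S := by positivity
      have h14 : 0 ≤ 4 * m ^ 2 * a ^ 2 := by positivity
      linarith
    have h15 : quad / δ ≤ (1 + 3 * m) / (δ * η) * (a ^ 2 + S) := by
      have e5 : quad / δ = (a ^ 2 / 2 + 3 * m * S) / (δ * η) := by
        rw [hquad]; field_simp
      rw [e5, div_mul_eq_mul_div]
      refine div_le_div_of_nonneg_right ?_ (by positivity)
      have h13 : 0 ≤ m * a ^ 2 := by positivity
      have h14 : 0 ≤ a ^ 2 := by positivity
      linarith
    rw [e1, add_mul]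
    linarith
  · have e1 : cappedMoreau φ η cap sel z = cap := min_eq_right (not_lt.1 hcap)
    have e3 : s = 0 := by
      rw [hs]; unfold moreauSlope; rw [if_neg hcap]
    have h6 : ramp ((cappedMoreau φ η cap sel zp - l) / δ) ≤ ramp ((cap - l) / δ) :=
      ramp_mono (div_le_div_of_nonneg_right (by
        have : cappedMoreau φ η cap sel zp ≤ cap := min_le_right _ _
        linarith) hδ.le)
    rw [e1, e3, zero_mul, zero_mul, zero_mul, add_zero, sub_zero]
    linarith

/-- Minimizers of finitely many measurable functions can be selected measurably. -/
theorem exists_measurable_argmin {E F : Type*} [MeasurableSpace E] [MeasurableSpace F]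
    [DecidableEq F] (φ : F → E → ℝ) (hφ : ∀ w, Measurable (φ w)) (s : Finset F)
    (hs : s.Nonempty) :
    ∃ sel : E → F, Measurable sel ∧ Measurable (fun z => φ (sel z) z) ∧ (∀ z, sel z ∈ s) ∧
      ∀ z, ∀ w ∈ s, φ (sel z) z ≤ φ w z := by
  induction hs using Finset.Nonempty.cons_induction with
  | singleton a =>
    exact ⟨fun _ => a, measurable_const, hφ a, fun _ => Finset.mem_singleton_self a,
      fun z w hw => by rw [Finset.mem_singleton.1 hw]⟩
  | cons a s ha hs ih =>
    obtain ⟨sel, h1, h2, h3, h4⟩ := ih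
    have hset : MeasurableSet {z | φ a z ≤ φ (sel z) z} := measurableSet_le (hφ a) h2
    classical
    refine ⟨fun z => if φ a z ≤ φ (sel z) z then a else sel z,
      Measurable.ite hset measurable_const h1, ?_, fun z => ?_, fun z w hw => ?_⟩
    · have : (fun z => φ (if φ a z ≤ φ (sel z) z then a else sel z) z) =
          fun z => if φ a z ≤ φ (sel z) z then φ a z else φ (sel z) z := by
        funext z; split_ifs <;> rfl
      rw [this]
      exact Measurable.ite hset (hφ a) h2
    · dsimp only
      split_ifs
      · exact Finset.mem_cons_self a s
      · exact Finset.mem_cons_of_mem (h3 z)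
    · dsimp only
      rcases Finset.mem_cons.1 hw with rfl | hw
      · split_ifs with h
        · exact le_rfl
        · exact (not_le.1 h).le
      · split_ifs with h
        · exact h.trans (h4 z w hw)
        · exact h4 z w hw

theorem measurable_DF (y : Fin d → ℝ) : Measurable (fun z : ℝ × (Fin d → ℝ) => DF y z.2) := by
  unfold DF
  refine Measurable.add (Measurable.sub (Finset.measurable_fun_sum _ fun i _ => ?_)
    measurable_const) (Finset.measurable_fun_sum _ fun i _ => by fun_prop)
  exact measurable_const.mul (Real.measurable_log.comp
    (measurable_const.div (by fun_prop)))

theorem measurable_moreau (φ : ℝ × (Fin d → ℝ) → ℝ) (η : ℝ) (z' : ℝ × (Fin d → ℝ)) :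
    Measurable (moreau φ η z') := by
  unfold moreau bregman
  exact measurable_const.add ((Measurable.add (by fun_prop) (measurable_DF _)).div_const _)

/-! ### Construction of the Lyapunov function -/

/-- A Lyapunov function `W` for tamed stochastic mirror descent, with linear part `(α, β)`. -/
structure IsLyapunov (b : Fin d → ℝ) (m : ℝ) (f p : ℝ × (Fin d → ℝ) → ℝ)
    (q : ℝ × (Fin d → ℝ) → Fin d → ℝ) (zs : ℝ × (Fin d → ℝ))
    (W α : ℝ × (Fin d → ℝ) → ℝ) (β : ℝ × (Fin d → ℝ) → Fin d → ℝ) (C : ℝ) : Prop where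
  nonneg : 0 ≤ C
  measurable_W : Measurable W
  measurable_α : Measurable α
  measurable_β : ∀ i, Measurable fun z => β z i
  bound_α : ∀ z ∈ feasible d m, |α z| ≤ C * (1 + |z.1 - zs.1|)
  bound_β : ∀ z ∈ feasible d m, ∀ i, |β z i| ≤ C
  lower : ∀ z ∈ feasible d m, (z.1 - zs.1) ^ 2 / 2 + DF zs.2 z.2 ≤ W z
  upper : ∀ z ∈ feasible d m,
    W z ≤ (z.1 - zs.1) ^ 2 / 2 + C * (1 + |z.1 - zs.1|) + C * DF zs.2 z.2
  tendsto : Tendsto W (𝓝[feasible d m] zs) (𝓝 0)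
  drift : ∀ z ∈ feasible d m, √(kap z.2) * (logBarrier b f z - logBarrier b f zs) ≤
    α z * p z + ∑ i, β z i * (kap z.2 * (q z i - b i / z.2 i))
  step : MirrorStep m W α β C

theorem DF_self (y : Fin d → ℝ) : DF y y = 0 := by
  simp [DF]

theorem DF_le_of_le_kap {m ε : ℝ} (hε : 0 < ε) {y w : Fin d → ℝ} (hy : y ∈ posOrthant d)
    (hym : l1 y ≤ m) (hw : w ∈ posOrthant d) (hwm : l1 w ≤ m) (hk : ε ≤ kap w) :
    DF y w ≤ d * (m ^ 2 / ε) := by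
  have h1 : DF y w ≤ ∑ _i : Fin d, m ^ 2 / ε := by
    refine (DF_le_sum_sq_div hy hw).trans (Finset.sum_le_sum fun i _ => ?_)
    have a1 := apply_le_of_l1_le hym i
    have a2 := apply_le_of_l1_le hwm i
    have a3 := hy i
    have a4 := hw i
    exact div_le_div₀ (sq_nonneg _) (sq_le_sq' (by linarith) (by linarith)) hε
      (hk.trans (kap_le_apply w i))
  simpa using h1

/-- `yᵢ log(yᵢ / wᵢ)` tends to infinity as `wᵢ` tends to `0`. Since all terms are nonnegative, a
bound on the divergence bounds each `wᵢ` from below. -/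
theorem exists_pos_le_of_DF_le [Nonempty (Fin d)] {y : Fin d → ℝ} (hy : y ∈ posOrthant d) (M : ℝ) :
    ∃ ε, 0 < ε ∧ ∀ w ∈ posOrthant d, DF y w ≤ M → ∀ i, ε ≤ w i := by
  obtain ⟨j, hj⟩ := exists_eq_ciInf_of_finite (f := fun i => y i * Real.exp (-((M + y i) / y i)))
  refine ⟨y j * Real.exp (-((M + y j) / y j)), mul_pos (hy j) (Real.exp_pos _), fun w hw hM i => ?_⟩
  have h0 : y j * Real.exp (-((M + y j) / y j)) ≤ y i * Real.exp (-((M + y i) / y i)) := by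
    rw [hj]
    exact ciInf_le (f := fun i => y i * Real.exp (-((M + y i) / y i)))
      (Set.finite_range _).bddBelow i
  refine h0.trans ?_
  have h1 := (entropy_term_le_DF hy hw i).trans hM
  have h2 : Real.log (y i / w i) ≤ (M + y i) / y i := by
    rw [le_div_iff₀ (hy i)]
    linarith [hw i]
  rw [Real.log_div (hy i).ne' (hw i).ne'] at h2
  have h3 : Real.log (y i * Real.exp (-((M + y i) / y i))) ≤ Real.log (w i) := by
    rw [Real.log_mul (hy i).ne' (Real.exp_pos _).ne', Real.log_exp]
    linarith
  exact (Real.log_le_log_iff (mul_pos (hy i) (Real.exp_pos _)) (hw i)).1 h3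

theorem continuousAt_DF {y : Fin d → ℝ} {z : ℝ × (Fin d → ℝ)} (hy : y ∈ posOrthant d)
    (hz : z.2 ∈ posOrthant d) : ContinuousAt (fun z : ℝ × (Fin d → ℝ) => DF y z.2) z := by
  unfold DF
  refine ContinuousAt.add (ContinuousAt.sub (tendsto_finsetSum _ fun i _ => ?_)
    continuousAt_const) (by fun_prop)
  refine ContinuousAt.mul continuousAt_const (ContinuousAt.log ?_ (div_pos (hy i) (hz i)).ne')
  exact continuousAt_const.div (by fun_prop) (hz i).ne'

/-- The case distinction behind the drift inequality. -/
theorem drift_combination {κ H t p S c₁ c₂ s U w A₁ A₂ A₃ B C₁ C₃ CU R s₀ c₀ c sm δ : ℝ}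
    {inK : Prop} {far bdry : Prop}
    (hw : 0 ≤ w) (hκ0 : 0 ≤ κ) (hκ1 : κ ≤ 1) (hA₁ : 0 ≤ A₁) (hA₂ : 0 ≤ A₂) (hA₃ : 0 ≤ A₃)
    (hCU : 0 ≤ CU)
    (hB : |p| ≤ B) (hS : |S| ≤ C₁) (hH0 : 0 ≤ H) (hH : κ * H ≤ κ * (t * p) + C₃)
    (hc₁ : 0 ≤ c₁ * p) (hc₂ : 0 ≤ c₂ * S) (hs0 : 0 ≤ s) (hs : s ≤ sm) (hU : -CU ≤ U)
    (hR : 0 ≤ R)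
    (hfar : far → s₀ ≤ c₁ * p ∧ 0 ≤ t * p) (hnfar : ¬far → |t| ≤ R)
    (hbdry : bdry → c₀ ≤ c₂ * S)
    (hK : inK → 0 ≤ s * U) (hKt : inK → |t| ≤ R)
    (hmid : inK → 3 * δ < H → c ≤ s * U)
    (hnear : inK → H ≤ 3 * δ → H ≤ t * p + w * S)
    (hout : ¬inK → far ∨ bdry)
    (hA₂' : R * B + w * C₁ + R * B + C₃ ≤ A₂ * c)
    (hA₁' : R * B + w * C₁ + A₂ * (sm * CU) + (R * B + C₃) ≤ A₁ * c₀)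
    (hA₃' : w * C₁ + A₂ * (sm * CU) + C₃ ≤ A₃ * s₀) :
    κ * H ≤ t * p + A₃ * (c₁ * p) + w * S + A₁ * (c₂ * S) + A₂ * (s * U) := by
  have hB0 : 0 ≤ B := (abs_nonneg _).trans hB
  have hsU : -(sm * CU) ≤ s * U := by
    have h1 := mul_le_mul_of_nonneg_left hU hs0
    have h2 := mul_le_mul_of_nonneg_right hs hCU
    linarith
  have hA2sU : -(A₂ * (sm * CU)) ≤ A₂ * (s * U) := by
    have := mul_le_mul_of_nonneg_left hsU hA₂
    linarith
  have hwS : -(w * C₁) ≤ w * S := by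
    have := mul_le_mul_of_nonneg_left (abs_le.1 hS).1 hw
    linarith
  have ha3 := mul_nonneg hA₃ hc₁
  have ha1 := mul_nonneg hA₁ hc₂
  have htp : |t| ≤ R → |t * p| ≤ R * B := fun h => by
    rw [abs_mul]; exact mul_le_mul h hB (abs_nonneg _) hR
  have hκtp : |t| ≤ R → κ * (t * p) ≤ R * B := fun h => by
    have h1 := le_abs_self (t * p)
    have h2 := htp h
    have h3 := mul_le_mul_of_nonneg_left (h1.trans h2) hκ0
    have h4 := mul_le_mul_of_nonneg_right hκ1 (mul_nonneg hR hB0)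
    linarith
  -- Inside the core with small gap the Bregman part suffices, and with larger gap the Moreau piece
  -- pays through `A₂`. Outside, `A₃` pays for large `|ξ|` and `A₁` near the boundary. For large
  -- `|ξ|` the unbounded term `t p` needs no bound: it is nonnegative, so `κ t p ≤ t p`.
  by_cases hin : inK
  · have ha2 := mul_nonneg hA₂ (hK hin)
    by_cases h3 : H ≤ 3 * δ
    · have h4 := hnear hin h3
      have h5 := mul_le_mul_of_nonneg_right hκ1 hH0
      linarith
    · have h4 := mul_le_mul_of_nonneg_left (hmid hin (not_le.1 h3)) hA₂
      have h5 := (abs_le.1 (htp (hKt hin))).1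
      have h6 := hκtp (hKt hin)
      linarith
  · by_cases hf : far
    · obtain ⟨h4, h5⟩ := hfar hf
      have h6 := mul_le_mul_of_nonneg_left h4 hA₃
      have h7 := mul_le_mul_of_nonneg_right hκ1 h5
      linarith
    · have hb := hbdry ((hout hin).resolve_left hf)
      have h6 := mul_le_mul_of_nonneg_left hb hA₁
      have h7 := (abs_le.1 (htp (hnfar hf))).1
      have h8 := hκtp (hnfar hf)
      linarith

theorem ramp_fst_drift {R s t p : ℝ} (hR : 0 < R) (hs : 0 < s) (h1 : R ≤ t → s ≤ p)
    (h2 : t ≤ -R → p ≤ -s) :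
    0 ≤ (clamp (t - R) - clamp (-t - R)) * p ∧
      (R + 1 < |t| → s ≤ (clamp (t - R) - clamp (-t - R)) * p ∧ 0 ≤ t * p) := by
  refine ⟨?_, fun h => ?_⟩
  · rcases le_total R t with h | h
    · rw [clamp_of_nonpos (t := -t - R) (by linarith), sub_zero]
      exact mul_nonneg (clamp_nonneg _) (hs.le.trans (h1 h))
    · rw [clamp_of_nonpos (t := t - R) (by linarith), zero_sub, neg_mul, ← mul_neg]
      rcases le_total t (-R) with h' | h'
      · exact mul_nonneg (clamp_nonneg _) (by linarith [h2 h'])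
      · rw [clamp_of_nonpos (t := -t - R) (by linarith), zero_mul]
  · rcases lt_abs.1 h with h | h
    · rw [clamp_of_nonpos (t := -t - R) (by linarith), clamp_of_one_le (by linarith)]
      have := h1 (by linarith)
      exact ⟨by linarith, mul_nonneg (by linarith) (by linarith)⟩
    · rw [clamp_of_nonpos (t := t - R) (by linarith), clamp_of_one_le (by linarith)]
      have := h2 (by linarith)
      exact ⟨by linarith, mul_nonneg_of_nonpos_of_nonpos (by linarith) (by linarith)⟩

theorem measurable_moreauSlope {φ : ℝ × (Fin d → ℝ) → ℝ} {η cap l δ : ℝ}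
    {sel : ℝ × (Fin d → ℝ) → ℝ × (Fin d → ℝ)}
    (h : Measurable fun z => moreau φ η (sel z) z) :
    Measurable (moreauSlope φ η cap l δ sel) := by
  unfold moreauSlope
  refine Measurable.ite (measurableSet_lt h measurable_const) ?_ measurable_const
  exact (continuous_clamp.measurable.comp ((h.sub_const _).div_const _)).div_const _

/-- The ingredient of the Lyapunov function that controls the region between the minimizer and
the boundary: a bounded function `G` with derivative factor `s` at the proximal points `sel`. -/
structure IsMoreauPiece (b : Fin d → ℝ) (m : ℝ) (f p : ℝ × (Fin d → ℝ) → ℝ)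
    (q : ℝ × (Fin d → ℝ) → Fin d → ℝ) (zs : ℝ × (Fin d → ℝ)) (r k δ : ℝ)
    (G s : ℝ × (Fin d → ℝ) → ℝ) (sel : ℝ × (Fin d → ℝ) → ℝ × (Fin d → ℝ))
    (C Gmax sm c ρ : ℝ) : Prop where
  step : MirrorStep m G (fun z => s z * (z.1 - (sel z).1)) (fun z i => s z * (z.2 i - (sel z).2 i)) C
  G_nonneg : ∀ z, 0 ≤ G z
  G_le : ∀ z, G z ≤ Gmax
  G_zero : ∀ᶠ z in 𝓝[feasible d m] zs, G z = 0
  measurable_G : Measurable G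
  measurable_s : Measurable s
  measurable_sel : Measurable sel
  s_nonneg : ∀ z, 0 ≤ s z
  s_le : ∀ z, s z ≤ sm
  sel_mem : ∀ z, sel z ∈ feasible d m
  sel_near : ∀ z, |(sel z).1 - zs.1| ≤ r
  sq_le : ∀ z ∈ feasible d m, s z ≠ 0 → (z.1 - (sel z).1) ^ 2 ≤ ρ
  c_pos : 0 < c
  ρ_nonneg : 0 ≤ ρ
  drift_nonneg : ∀ z ∈ feasible d m, |z.1 - zs.1| ≤ r → DF zs.2 z.2 ≤ k →
    0 ≤ s z * ((z.1 - (sel z).1) * p z +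
      kap z.2 * ∑ i, (z.2 i - (sel z).2 i) * (q z i - b i / z.2 i))
  drift_ge : ∀ z ∈ feasible d m, |z.1 - zs.1| ≤ r → DF zs.2 z.2 ≤ k →
    logBarrier b f zs + 3 * δ < logBarrier b f z →
    c ≤ s z * ((z.1 - (sel z).1) * p z +
      kap z.2 * ∑ i, (z.2 i - (sel z).2 i) * (q z i - b i / z.2 i))

namespace GradientModel

variable {b : Fin d → ℝ} {m B : ℝ} {f p : ℝ × (Fin d → ℝ) → ℝ}
  {q : ℝ × (Fin d → ℝ) → Fin d → ℝ} {zs : ℝ × (Fin d → ℝ)}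

/-- `G` is `ramp` of `(envelope - l) / δ` with `l = φ zs + 2 δ`, and the envelope lies between `φ -
δ / 2` and `φ + δ` wherever the drift is needed. Hence `G` vanishes where `φ ≤ φ zs + δ` in the
core; a nonzero slope there forces `φ > φ zs + δ`, so the Moreau drift applies; and `φ > φ zs + 3 δ`
makes the argument of `clamp` at least `1 / 2`. The cap exceeds every value of the envelope on the
core. -/
theorem exists_isMoreauPiece (hM : GradientModel b m B f p q zs) {r k δ : ℝ} (hr : 0 < r)
    (hk : 0 < k) (hδ : 0 < δ) :
    ∃ (G s : ℝ × (Fin d → ℝ) → ℝ) (sel : ℝ × (Fin d → ℝ) → ℝ × (Fin d → ℝ))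
      (C Gmax sm c ρ : ℝ), IsMoreauPiece b m f p q zs r k δ G s sel C Gmax sm c ρ := by
  have := hM.nonempty
  have hzs := hM.zs_mem
  obtain ⟨ε, hε, hDε⟩ := exists_pos_le_of_DF_le hzs.1 k
  set K := truncatedRegion zs m r ε with hKdef
  have hKf : K ⊆ feasible d m := truncatedRegion_subset hε
  have hmemK : ∀ z ∈ feasible d m, |z.1 - zs.1| ≤ r → DF zs.2 z.2 ≤ k → z ∈ K :=
    fun z hz h1 h2 => ⟨h1, hDε z.2 hz.1 h2, hz.2⟩
  have hzsK : zs ∈ K := hmemK zs hzs (by simpa using hr.le) (by rw [DF_self]; exact hk.le)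
  obtain ⟨η, c, F, hη, hc, hFne, hFK, hdrift⟩ := hM.exists_moreau_drift hr hε hzsK hδ
  set φ := logBarrier b f with hφ
  classical
  obtain ⟨sel, hselm, hΦm, hselF, hselmin⟩ :=
    exists_measurable_argmin (moreau φ η) (measurable_moreau φ η) F hFne
  have hself : ∀ z, sel z ∈ feasible d m := fun z => hKf (hFK _ (hselF z))
  obtain ⟨Hmax, hHmax⟩ := (isCompact_truncatedRegion zs m r ε).exists_bound_of_continuousOn
    (hM.continuousOn_logBarrier.mono fun z hz => (hKf hz).1)
  have hHle : ∀ z ∈ K, φ z ≤ Hmax := fun z hz => (le_abs_self _).trans (hHmax z hz)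
  set cap := Hmax + δ + 1 with hcap
  set l := φ zs + 2 * δ with hl
  have hlo : ∀ z ∈ F, φ zs ≤ φ z := fun z hz => hM.le_logBarrier (hKf (hFK z hz)).1
  obtain ⟨C₅, hstep₅⟩ := mirrorStep_moreau (cap := cap) (l := l) hη hδ
    (fun z hz => hKf (hFK z hz)) hlo hselF hselmin
  have hcl : 0 ≤ cap - φ zs := by
    have := hHle zs hzsK
    rw [hcap]; linarith
  have hne : ∀ z, moreauSlope φ η cap l δ sel z ≠ 0 →
      moreau φ η (sel z) z < cap ∧ l < moreau φ η (sel z) z := fun z hz => by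
    unfold moreauSlope at hz
    split_ifs at hz with h
    · refine ⟨h, ?_⟩
      have h1 : clamp ((moreau φ η (sel z) z - l) / δ) ≠ 0 := fun h0 => hz (by rw [h0, zero_div])
      have h2 := pos_of_clamp_ne_zero h1
      rw [div_pos_iff_of_pos_right hδ] at h2
      linarith
    · exact absurd rfl hz
  refine ⟨_, moreauSlope φ η cap l δ sel, sel, C₅, ramp ((cap - l) / δ), 1 / (δ * η),
    1 / (2 * (δ * η)) * c, 2 * η * (cap - φ zs), ⟨hstep₅, fun z => ramp_nonneg _, fun z => ?_, ?_,
    continuous_ramp.measurable.comp (((hΦm.min measurable_const).sub_const _).div_const _),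
    measurable_moreauSlope hΦm, hselm, moreauSlope_nonneg hη hδ sel, moreauSlope_le hη hδ sel, hself,
    fun z => (hFK _ (hselF z)).1, fun z hz h => ?_, by positivity, by positivity, ?_, ?_⟩⟩
  · refine ramp_mono (div_le_div_of_nonneg_right ?_ hδ.le)
    have : cappedMoreau φ η cap sel z ≤ cap := min_le_right _ _
    linarith
  · have hD : ∀ᶠ z in 𝓝 zs, DF zs.2 z.2 < k := by
      have h1 := (continuousAt_DF hzs.1 hzs.1).tendsto
      rw [DF_self] at h1
      exact h1.eventually_lt_const hk
    have ht : ∀ᶠ z in 𝓝 zs, |z.1 - zs.1| < r := by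
      have h1 : Tendsto (fun z : ℝ × (Fin d → ℝ) => |z.1 - zs.1|) (𝓝 zs) (𝓝 |zs.1 - zs.1|) :=
        Continuous.tendsto (by fun_prop) zs
      rw [sub_self, abs_zero] at h1
      exact h1.eventually_lt_const hr
    have hh : ∀ᶠ z in 𝓝 zs, φ z < φ zs + δ := by
      have h1 := (hM.continuousOn_logBarrier.continuousAt
        (isOpen_snd_mem_posOrthant.mem_nhds hzs.1)).tendsto
      exact h1.eventually_lt_const (by linarith)
    filter_upwards [hD.filter_mono nhdsWithin_le_nhds, ht.filter_mono nhdsWithin_le_nhds,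
      hh.filter_mono nhdsWithin_le_nhds, self_mem_nhdsWithin] with z h1 h2 h3 h4
    have h5 := (hdrift z (hmemK z h4 h2.le h1.le) (sel z) (hselF z) (hselmin z)).1
    refine ramp_of_nonpos (div_nonpos_of_nonpos_of_nonneg ?_ hδ.le)
    have : cappedMoreau φ η cap sel z ≤ moreau φ η (sel z) z := min_le_left _ _
    linarith
  · exact abs_sub_sel_le hη hz.1 (hself z).1 (hlo _ (hselF z)) (hne z h).1
  · intro z hz h1 h2
    obtain ⟨h3, h4⟩ := hdrift z (hmemK z hz h1 h2) (sel z) (hselF z) (hselmin z)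
    by_cases h0 : moreauSlope φ η cap l δ sel z = 0
    · rw [h0, zero_mul]
    · have h5 := (hne z h0).2
      have h6 := (h4 (by linarith)).1
      exact mul_nonneg (moreauSlope_nonneg hη hδ sel z) (hc.le.trans h6)
  · intro z hz h1 h2 h5
    have hzK := hmemK z hz h1 h2
    obtain ⟨h3, h4⟩ := hdrift z hzK (sel z) (hselF z) (hselmin z)
    obtain ⟨h6, h7⟩ := h4 (by linarith)
    refine mul_le_mul ?_ h6 hc.le (moreauSlope_nonneg hη hδ sel z)
    unfold moreauSlope
    rw [if_pos (by have := hHle z hzK; linarith)]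
    have h8 : 1 / 2 ≤ clamp ((moreau φ η (sel z) z - l) / δ) := by
      refine le_trans (le_min ?_ (by norm_num)) (min_le_clamp _)
      rw [le_div_iff₀ hδ]
      linarith
    rw [le_div_iff₀ (by positivity)]
    refine le_trans (le_of_eq ?_) h8
    field_simp

end GradientModel

namespace GradientModel

variable {b : Fin d → ℝ} {m B : ℝ} {f p : ℝ × (Fin d → ℝ) → ℝ}
  {q : ℝ × (Fin d → ℝ) → Fin d → ℝ} {zs : ℝ × (Fin d → ℝ)}

/-- Closeness to the boundary is restated through the divergence, since `W` is built from `D_F` and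
not from `κ`: a large divergence forces `κ` to be small. -/
theorem exists_boundary_drift_DF (hM : GradientModel b m B f p q zs) :
    ∃ k c : ℝ, 0 < k ∧ 0 < c ∧ ∀ z ∈ feasible d m, k < DF zs.2 z.2 →
      c ≤ kap z.2 * ∑ i, (z.2 i - zs.2 i) * (q z i - b i / z.2 i) := by
  have := hM.nonempty
  have hm := hM.m_pos
  have hd : (0 : ℝ) < d := by exact_mod_cast Fin.pos_iff_nonempty.2 hM.nonempty
  obtain ⟨ε, c, hε, hc, hbd⟩ := hM.exists_boundary_drift
  refine ⟨d * (m ^ 2 / ε), c, by positivity, hc, fun z hz h => hbd z hz ?_⟩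
  by_contra hcon
  exact absurd (DF_le_of_le_kap hε hM.zs_mem.1 hM.zs_mem.2 hz.1 hz.2 (not_le.1 hcon).le)
    (not_le.2 h)

/-- `W` is `½(ξ-ξ⋆)² + w D_F(y⋆, y)`, with `w = 1/κ(y⋆)` to normalise the taming at the minimizer,
plus one correction for each region where this function may fail: two ramps in `±(ξ-ξ⋆)`, a ramp of
`D_F`, and the Moreau piece `G`. The ramps have nonnegative drift everywhere; the drift of `G`
outside the core is only bounded below. -/
theorem exists_isLyapunov (hM : GradientModel b m B f p q zs) :
    ∃ (W α : ℝ × (Fin d → ℝ) → ℝ) (β : ℝ × (Fin d → ℝ) → Fin d → ℝ) (C : ℝ),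
      IsLyapunov b m f p q zs W α β C := by
  have := hM.nonempty
  have hm := hM.m_pos
  have hB := hM.B_nonneg
  have hzs := hM.zs_mem
  obtain ⟨R, s₀, hR, hs₀, hslope⟩ := hM.exists_slope
  obtain ⟨C₃, hC₃, hsqrt⟩ := hM.exists_sqrt_kap_mul_le
  obtain ⟨k, c₀, hk, hc₀, hbd⟩ := hM.exists_boundary_drift_DF
  obtain ⟨ε, hε, hDε⟩ := exists_pos_le_of_DF_le hzs.1 (k + 1)
  obtain ⟨δ, hδ, hlocal⟩ := hM.exists_local_drift (r := R + 1) hε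
  obtain ⟨G, s, sel, C₅, Gmax, sm, c, ρ, hG⟩ :=
    hM.exists_isMoreauPiece (r := R + 1) (k := k + 1) (by linarith) (by linarith) hδ
  have hsm0 : 0 ≤ sm := (hG.s_nonneg zs).trans (hG.s_le zs)
  have hGmax : 0 ≤ Gmax := (hG.G_nonneg zs).trans (hG.G_le zs)
  have hc := hG.c_pos
  have hρ := hG.ρ_nonneg
  set w := (kap zs.2)⁻¹ with hw
  have hw1 : 1 ≤ w := (one_le_inv₀ (kap_pos hzs.1)).2 (kap_le_one _)
  have hw0 : 0 ≤ w := by linarith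
  set C₁ := (B + 1) * (2 * m) with hC₁
  have hC₁0 : 0 ≤ C₁ := by positivity
  set CU := 2 * (R + 1) * B + C₁ with hCU
  have hCU0 : 0 ≤ CU := by positivity
  -- `A₂` comes first. Outside the core `G` may cost up to `A₂ sm CU`, which `A₁` and `A₃` have to
  -- repay.
  obtain ⟨A₂, hA₂0, hA₂⟩ : ∃ A₂, 0 ≤ A₂ ∧
      (R + 1) * B + w * C₁ + (R + 1) * B + C₃ ≤ A₂ * c :=
    ⟨((R + 1) * B + w * C₁ + (R + 1) * B + C₃) / c, by positivity,
      (div_mul_cancel₀ _ hc.ne').ge⟩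
  obtain ⟨A₁, hA₁0, hA₁⟩ : ∃ A₁, 0 ≤ A₁ ∧
      (R + 1) * B + w * C₁ + A₂ * (sm * CU) + ((R + 1) * B + C₃) ≤ A₁ * c₀ :=
    ⟨((R + 1) * B + w * C₁ + A₂ * (sm * CU) + ((R + 1) * B + C₃)) / c₀, by positivity,
      (div_mul_cancel₀ _ hc₀.ne').ge⟩
  obtain ⟨A₃, hA₃0, hA₃⟩ : ∃ A₃, 0 ≤ A₃ ∧ w * C₁ + A₂ * (sm * CU) + C₃ ≤ A₃ * s₀ :=
    ⟨(w * C₁ + A₂ * (sm * CU) + C₃) / s₀, by positivity, (div_mul_cancel₀ _ hs₀.ne').ge⟩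
  have hstep : ∃ C, MirrorStep m
      (fun z => (z.1 - zs.1) ^ 2 / 2 + A₃ * (ramp (z.1 - zs.1 - R) + ramp (-(z.1 - zs.1) - R)) +
        w * DF zs.2 z.2 + A₁ * ramp (DF zs.2 z.2 - k) + A₂ * G z)
      (fun z => z.1 - zs.1 + A₃ * (clamp (z.1 - zs.1 - R) - clamp (-(z.1 - zs.1) - R)) +
        A₂ * (s z * (z.1 - (sel z).1)))
      (fun z i => w * (z.2 i - zs.2 i) + A₁ * (clamp (DF zs.2 z.2 - k) * (z.2 i - zs.2 i)) +
        A₂ * (s z * (z.2 i - (sel z).2 i))) C := by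
    have hall := ((((mirrorStep_sq (d := d) m zs.1).add
      ((mirrorStep_ramp_fst (d := d) m zs.1 R).const_mul hA₃0)).add
      ((mirrorStep_DF hzs).const_mul hw0)).add
      ((mirrorStep_ramp_DF hzs k).const_mul hA₁0)).add (hG.step.const_mul hA₂0)
    refine ⟨1 / 2 + A₃ * 1 + w * (3 * m) + A₁ * (2 * m ^ 2 + 3 * m) + A₂ * C₅, fun z hz a v => ?_⟩
    have := hall z hz a v
    simp only [mul_zero, add_zero, zero_add] at this
    exact this
  obtain ⟨Cst, hst⟩ := hstep
  set W : ℝ × (Fin d → ℝ) → ℝ := fun z =>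
    (z.1 - zs.1) ^ 2 / 2 + A₃ * (ramp (z.1 - zs.1 - R) + ramp (-(z.1 - zs.1) - R)) +
      w * DF zs.2 z.2 + A₁ * ramp (DF zs.2 z.2 - k) + A₂ * G z with hW
  set α : ℝ × (Fin d → ℝ) → ℝ := fun z =>
    z.1 - zs.1 + A₃ * (clamp (z.1 - zs.1 - R) - clamp (-(z.1 - zs.1) - R)) +
      A₂ * (s z * (z.1 - (sel z).1)) with hα
  set β : ℝ × (Fin d → ℝ) → Fin d → ℝ := fun z i =>
    w * (z.2 i - zs.2 i) + A₁ * (clamp (DF zs.2 z.2 - k) * (z.2 i - zs.2 i)) +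
      A₂ * (s z * (z.2 i - (sel z).2 i)) with hβ
  have hWm : Measurable W := by
    have h1 := hG.measurable_G
    have h2 := continuous_ramp.measurable
    have h3 : Measurable fun z : ℝ × (Fin d → ℝ) => DF zs.2 z.2 := measurable_DF zs.2
    simp only [hW]
    fun_prop
  have hαm : Measurable α := by
    have h1 := hG.measurable_s
    have h2 := hG.measurable_sel
    have h3 := continuous_clamp.measurable
    simp only [hα]
    fun_prop
  have hβm : ∀ i, Measurable fun z => β z i := fun i => by
    have h1 := hG.measurable_s
    have h2 := hG.measurable_sel
    have h3 : Measurable fun z : ℝ × (Fin d → ℝ) => clamp (DF zs.2 z.2 - k) :=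
      continuous_clamp.measurable.comp ((measurable_DF zs.2).sub_const k)
    have h4 : Measurable fun z => (sel z).2 i := (measurable_pi_apply i).comp h2.snd
    simp only [hβ]
    fun_prop
  have hdiff : ∀ {y y' : Fin d → ℝ}, l1 y ≤ m → l1 y' ≤ m → ∀ i, |y i - y' i| ≤ 2 * m :=
    fun {y y'} hy hy' i => (Finset.single_le_sum (f := fun i => |y i - y' i|)
      (fun _ _ => abs_nonneg _) (Finset.mem_univ i)).trans (sum_abs_sub_le hy hy')
  set Cα := 1 + A₃ + A₂ * (sm * (ρ + 1)) with hCα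
  have hCα0 : 0 ≤ Cα := by positivity
  have hαb : ∀ z ∈ feasible d m, |α z| ≤ Cα * (1 + |z.1 - zs.1|) := fun z hz => by
    have h1 : |A₃ * (clamp (z.1 - zs.1 - R) - clamp (-(z.1 - zs.1) - R))| ≤ A₃ := by
      rw [abs_mul, abs_of_nonneg hA₃0]
      refine mul_le_of_le_one_right hA₃0 (abs_sub_le_iff.2 ⟨?_, ?_⟩)
      · linarith [clamp_le_one (z.1 - zs.1 - R), clamp_nonneg (-(z.1 - zs.1) - R)]
      · linarith [clamp_nonneg (z.1 - zs.1 - R), clamp_le_one (-(z.1 - zs.1) - R)]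
    have h2 : |A₂ * (s z * (z.1 - (sel z).1))| ≤ A₂ * (sm * (ρ + 1)) := by
      rw [abs_mul, abs_of_nonneg hA₂0, abs_mul, abs_of_nonneg (hG.s_nonneg z)]
      refine mul_le_mul_of_nonneg_left ?_ hA₂0
      by_cases h0 : s z = 0
      · rw [h0, zero_mul]; positivity
      · refine mul_le_mul (hG.s_le z) ?_ (abs_nonneg _) hsm0
        have h3 := hG.sq_le z hz h0
        rw [← sq_abs] at h3
        nlinarith [sq_nonneg (|z.1 - (sel z).1| - 1)]
    have h3 : |α z| ≤ |z.1 - zs.1| + A₃ + A₂ * (sm * (ρ + 1)) :=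
      (abs_add_le _ _).trans (add_le_add ((abs_add_le _ _).trans (add_le_add le_rfl h1)) h2)
    have h4 := abs_nonneg (z.1 - zs.1)
    have h5 : 0 ≤ A₂ * (sm * (ρ + 1)) := by positivity
    rw [hCα]
    nlinarith [mul_nonneg hA₃0 h4, mul_nonneg h5 h4]
  set Cβ := w * (2 * m) + A₁ * (2 * m) + A₂ * (sm * (2 * m)) with hCβ
  have hCβ0 : 0 ≤ Cβ := by positivity
  have hβb : ∀ z ∈ feasible d m, ∀ i, |β z i| ≤ Cβ := fun z hz i => by
    have h0 := hdiff hz.2 hzs.2 i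
    refine (abs_add_le _ _).trans (add_le_add ((abs_add_le _ _).trans (add_le_add ?_ ?_)) ?_)
    · rw [abs_mul, abs_of_nonneg hw0]
      exact mul_le_mul_of_nonneg_left h0 hw0
    · rw [abs_mul, abs_of_nonneg hA₁0, abs_mul, abs_of_nonneg (clamp_nonneg _)]
      refine mul_le_mul_of_nonneg_left ?_ hA₁0
      exact (mul_le_of_le_one_left (abs_nonneg _) (clamp_le_one _)).trans h0
    · rw [abs_mul, abs_of_nonneg hA₂0, abs_mul, abs_of_nonneg (hG.s_nonneg z)]
      exact mul_le_mul_of_nonneg_left (mul_le_mul (hG.s_le z) (hdiff hz.2 (hG.sel_mem z).2 i)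
        (abs_nonneg _) hsm0) hA₂0
  have hlow : ∀ z ∈ feasible d m, (z.1 - zs.1) ^ 2 / 2 + DF zs.2 z.2 ≤ W z := fun z hz => by
    have h1 := DF_nonneg hzs.1 hz.1
    have h2 := mul_nonneg hA₃0
      (add_nonneg (ramp_nonneg (z.1 - zs.1 - R)) (ramp_nonneg (-(z.1 - zs.1) - R)))
    have h3 := mul_nonneg hA₁0 (ramp_nonneg (DF zs.2 z.2 - k))
    have h4 := mul_nonneg hA₂0 (hG.G_nonneg z)
    have h5 := mul_le_mul_of_nonneg_right hw1 h1
    simp only [hW]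
    linarith
  set CW := A₃ * (2 * R + 2) + w + A₁ * (1 + k) + A₂ * Gmax with hCW
  have hCW0 : 0 ≤ CW := by positivity
  have hup : ∀ z ∈ feasible d m,
      W z ≤ (z.1 - zs.1) ^ 2 / 2 + CW * (1 + |z.1 - zs.1|) + CW * DF zs.2 z.2 := fun z hz => by
    have h1 := DF_nonneg hzs.1 hz.1
    have ht := abs_nonneg (z.1 - zs.1)
    have h2 : ramp (z.1 - zs.1 - R) + ramp (-(z.1 - zs.1) - R) ≤
        (2 * R + 2) * (1 + |z.1 - zs.1|) := by
      have a1 := (ramp_le_abs (z.1 - zs.1 - R)).trans (abs_sub _ _)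
      have a2 := (ramp_le_abs (-(z.1 - zs.1) - R)).trans (abs_sub _ _)
      rw [abs_neg] at a2
      rw [abs_of_pos hR] at a1 a2
      nlinarith [mul_nonneg hR.le ht]
    have h3 : ramp (DF zs.2 z.2 - k) ≤ DF zs.2 z.2 + k := by
      refine (ramp_le_abs _).trans ((abs_sub _ _).trans ?_)
      rw [abs_of_nonneg h1, abs_of_pos hk]
    have h4 := mul_le_mul_of_nonneg_left h2 hA₃0
    have h5 := mul_le_mul_of_nonneg_left h3 hA₁0
    have h6 := mul_le_mul_of_nonneg_left (hG.G_le z) hA₂0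
    have n1 : 0 ≤ (w + A₁ * (1 + k)) * |z.1 - zs.1| := by positivity
    have n2 : 0 ≤ A₂ * Gmax * |z.1 - zs.1| := by positivity
    have n3 : 0 ≤ (A₃ * (2 * R + 2) + A₁ * k + A₂ * Gmax) * DF zs.2 z.2 := by positivity
    simp only [hW]
    rw [hCW]
    linarith
  have htend : Tendsto W (𝓝[feasible d m] zs) (𝓝 0) := by
    have hD : Tendsto (fun z : ℝ × (Fin d → ℝ) => DF zs.2 z.2) (𝓝 zs) (𝓝 0) := by
      have h1 := (continuousAt_DF hzs.1 hzs.1).tendsto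
      rwa [DF_self] at h1
    have ht : Tendsto (fun z : ℝ × (Fin d → ℝ) => z.1 - zs.1) (𝓝 zs) (𝓝 0) := by
      have h1 : Tendsto (fun z : ℝ × (Fin d → ℝ) => z.1 - zs.1) (𝓝 zs) (𝓝 (zs.1 - zs.1)) :=
        Continuous.tendsto (by fun_prop) zs
      rwa [sub_self] at h1
    have hlim : Tendsto (fun z : ℝ × (Fin d → ℝ) => (z.1 - zs.1) ^ 2 / 2 + w * DF zs.2 z.2)
        (𝓝[feasible d m] zs) (𝓝 0) := by
      have h1 := ((ht.pow 2).div_const 2).add (hD.const_mul w)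
      simp only [ne_eq, OfNat.ofNat_ne_zero, not_false_eq_true, zero_pow, zero_div, mul_zero,
        add_zero] at h1
      exact h1.mono_left nhdsWithin_le_nhds
    -- Near `zs` the ramps and `G` vanish, and `W` reduces to its Bregman part.
    refine hlim.congr' ?_
    have e1 := hD.eventually_lt_const hk
    have e2 := ht.eventually_lt_const hR
    have e3 := ht.eventually_const_lt (neg_lt_zero.2 hR)
    filter_upwards [e1.filter_mono nhdsWithin_le_nhds, e2.filter_mono nhdsWithin_le_nhds,
      e3.filter_mono nhdsWithin_le_nhds, hG.G_zero] with z h1 h2 h3 h4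
    simp only [hW]
    rw [ramp_of_nonpos (t := z.1 - zs.1 - R) (by linarith),
      ramp_of_nonpos (t := -(z.1 - zs.1) - R) (by linarith),
      ramp_of_nonpos (t := DF zs.2 z.2 - k) (by linarith), h4]
    ring
  have hdr : ∀ z ∈ feasible d m, √(kap z.2) * (logBarrier b f z - logBarrier b f zs) ≤
      α z * p z + ∑ i, β z i * (kap z.2 * (q z i - b i / z.2 i)) := fun z hz => by
    set S := kap z.2 * ∑ i, (z.2 i - zs.2 i) * (q z i - b i / z.2 i) with hS
    set S' := kap z.2 * ∑ i, (z.2 i - (sel z).2 i) * (q z i - b i / z.2 i) with hS'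
    have hsum : ∑ i, β z i * (kap z.2 * (q z i - b i / z.2 i)) =
        w * S + A₁ * (clamp (DF zs.2 z.2 - k) * S) + A₂ * (s z * S') := by
      simp only [hS, hS', Finset.mul_sum, ← Finset.sum_add_distrib]
      exact Finset.sum_congr rfl fun i _ => by simp only [hβ]; ring
    obtain ⟨hr1, hr2⟩ := ramp_fst_drift hR hs₀ (hslope z hz).1 (hslope z hz).2
    have hUlow : -CU ≤ (z.1 - (sel z).1) * p z + S' := by
      have h1 := (abs_le.1 (hM.abs_kap_mul_sum_le hz (hG.sel_mem z).2)).1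
      -- Since `sel z` lies within `R + 1` of `ξ⋆`, for larger `|ξ - ξ⋆|` the difference `ξ - (sel
      -- z).1` has the sign of `p z` and the product is nonnegative. Otherwise it is bounded.
      have h2 : -(2 * (R + 1) * B) ≤ (z.1 - (sel z).1) * p z := by
        have hsel := abs_le.1 (hG.sel_near z)
        have hb := hM.bound_p z hz
        by_cases hfar : R + 1 < |z.1 - zs.1|
        · refine le_trans (b := 0) (neg_nonpos.2 (by positivity)) ?_
          rcases lt_abs.1 hfar with h | h
          · exact mul_nonneg (by linarith) (hs₀.le.trans ((hslope z hz).1 (by linarith)))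
          · have := (hslope z hz).2 (by linarith)
            exact mul_nonneg_of_nonpos_of_nonpos (by linarith) (by linarith)
        · have h3 := abs_le.1 (not_lt.1 hfar)
          have h4 : |z.1 - (sel z).1| ≤ 2 * (R + 1) := abs_le.2 ⟨by linarith, by linarith⟩
          have h5 : |(z.1 - (sel z).1) * p z| ≤ 2 * (R + 1) * B := by
            rw [abs_mul]; exact mul_le_mul h4 hb (abs_nonneg _) (by positivity)
          exact (abs_le.1 h5).1
      rw [hCU, hC₁]
      linarith
    have hcl : 0 ≤ clamp (DF zs.2 z.2 - k) * S := by
      by_cases h0 : clamp (DF zs.2 z.2 - k) = 0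
      · rw [h0, zero_mul]
      · exact mul_nonneg (clamp_nonneg _)
          (hc₀.le.trans (hbd z hz (by linarith [pos_of_clamp_ne_zero h0])))
    have key := drift_combination (κ := √(kap z.2)) (H := logBarrier b f z - logBarrier b f zs)
      (t := z.1 - zs.1) (p := p z) (S := S) (w := w)
      (c₁ := clamp (z.1 - zs.1 - R) - clamp (-(z.1 - zs.1) - R))
      (c₂ := clamp (DF zs.2 z.2 - k)) (s := s z) (U := (z.1 - (sel z).1) * p z + S')
      (inK := |z.1 - zs.1| ≤ R + 1 ∧ DF zs.2 z.2 ≤ k + 1) (far := R + 1 < |z.1 - zs.1|)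
      (bdry := k + 1 < DF zs.2 z.2) (δ := δ) hw0 (Real.sqrt_nonneg _)
      (Real.sqrt_le_iff.2 ⟨one_pos.le, by simpa using kap_le_one z.2⟩) hA₁0 hA₂0 hA₃0 hCU0
      (hM.bound_p z hz) (hM.abs_kap_mul_sum_le hz hzs.2)
      (sub_nonneg.2 (hM.le_logBarrier hz.1)) (hsqrt z hz) hr1 hcl (hG.s_nonneg z) (hG.s_le z)
      hUlow (by linarith) hr2 not_lt.1
      (fun h => by
        rw [clamp_of_one_le (by linarith), one_mul]
        exact hbd z hz (by linarith))
      (fun h => hG.drift_nonneg z hz h.1 h.2) (fun h => h.1)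
      (fun h h3 => hG.drift_ge z hz h.1 h.2 (by linarith))
      (fun h h3 => hlocal z ⟨h.1, hDε z.2 hz.1 h.2, hz.2⟩ (by linarith))
      (fun h => by
        rw [not_and_or, not_le, not_le] at h
        exact h) hA₂ hA₁ hA₃
    refine key.trans (le_of_eq ?_)
    rw [hsum]
    simp only [hα]
    ring
  have hCst := le_abs_self Cst
  have hCst0 := abs_nonneg Cst
  refine ⟨W, α, β, |Cst| + Cα + Cβ + CW, by positivity, hWm, hαm, hβm, fun z hz => ?_, fun z hz i => ?_,
    hlow, fun z hz => ?_, htend, hdr, fun z hz a v => ?_⟩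
  · exact (hαb z hz).trans (mul_le_mul_of_nonneg_right (by linarith) (by positivity))
  · linarith [hβb z hz i]
  · refine (hup z hz).trans (add_le_add (add_le_add le_rfl ?_) ?_)
    · exact mul_le_mul_of_nonneg_right (by linarith) (by positivity)
    · exact mul_le_mul_of_nonneg_right (by linarith) (DF_nonneg hzs.1 hz.1)
  · refine (hst z hz a v).trans (add_le_add le_rfl (mul_le_mul_of_nonneg_right (by linarith) ?_))
    exact add_nonneg (sq_nonneg _) (sum_nonneg_sq v)

end GradientModel

/-! ### Derivatives of the loss and of its expectation -/

/-- The gradient in `y` of `L(ξ, -⟨y, x⟩)`. -/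
noncomputable def lossGrad (L : ℝ → ℝ → ℝ) (z : ℝ × (Fin d → ℝ)) (x : Fin d → ℝ) (i : Fin d) : ℝ :=
  -x i * dX L z.1 (loss z.2 x)

/-- The expected loss `E[L(ξ, -⟨y, X⟩)]`. -/
noncomputable def meanLoss {Ω : Type*} [MeasurableSpace Ω] (P : Measure Ω) (X : Ω → Fin d → ℝ)
    (L : ℝ → ℝ → ℝ) (z : ℝ × (Fin d → ℝ)) : ℝ :=
  ∫ ω, L z.1 (loss z.2 (X ω)) ∂P

/-- The expected derivative in `ξ`. -/
noncomputable def meanXi {Ω : Type*} [MeasurableSpace Ω] (P : Measure Ω) (X : Ω → Fin d → ℝ)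
    (L : ℝ → ℝ → ℝ) (z : ℝ × (Fin d → ℝ)) : ℝ :=
  ∫ ω, gradXi L z (X ω) ∂P

/-- The expected gradient in `y`. -/
noncomputable def meanGrad {Ω : Type*} [MeasurableSpace Ω] (P : Measure Ω) (X : Ω → Fin d → ℝ)
    (L : ℝ → ℝ → ℝ) (z : ℝ × (Fin d → ℝ)) (i : Fin d) : ℝ :=
  ∫ ω, lossGrad L z (X ω) i ∂P

/-- The linear map `(ξ, y) ↦ (ξ, -⟨y, x⟩)`. -/
def lossMap (x : Fin d → ℝ) : ℝ × (Fin d → ℝ) →ₗ[ℝ] ℝ × ℝ where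
  toFun z := (z.1, loss z.2 x)
  map_add' z w := by
    simp only [loss, Prod.fst_add, Prod.snd_add, Pi.add_apply, add_mul, Finset.sum_add_distrib,
      neg_add, Prod.mk_add_mk]
  map_smul' c z := by
    simp only [loss, Prod.smul_fst, Prod.smul_snd, Pi.smul_apply, smul_eq_mul, RingHom.id_apply,
      Prod.smul_mk, Finset.mul_sum, mul_neg, mul_assoc]

theorem continuous_of_convexOn {L : ℝ → ℝ → ℝ}
    (hL : ConvexOn ℝ Set.univ fun p : ℝ × ℝ => L p.1 p.2) :
    Continuous fun p : ℝ × ℝ => L p.1 p.2 :=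
  continuousOn_univ.1 (hL.continuousOn isOpen_univ)

theorem measurable_dXi {L : ℝ → ℝ → ℝ} (hL : ConvexOn ℝ Set.univ fun p : ℝ × ℝ => L p.1 p.2) :
    Measurable fun p : ℝ × ℝ => dXi L p.1 p.2 := by
  have h : Continuous (Function.uncurry fun x s => L s x) :=
    (continuous_of_convexOn hL).comp continuous_swap
  exact (measurable_deriv_with_param h).comp measurable_swap

theorem measurable_dX {L : ℝ → ℝ → ℝ} (hL : ConvexOn ℝ Set.univ fun p : ℝ × ℝ => L p.1 p.2) :
    Measurable fun p : ℝ × ℝ => dX L p.1 p.2 :=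
  measurable_deriv_with_param (f := fun ξ s => L ξ s) (continuous_of_convexOn hL)

theorem measurable_loss : Measurable fun p : (Fin d → ℝ) × (Fin d → ℝ) => loss p.1 p.2 := by
  unfold loss; fun_prop

theorem measurable_gradXi {L : ℝ → ℝ → ℝ} (hL : ConvexOn ℝ Set.univ fun p : ℝ × ℝ => L p.1 p.2) :
    Measurable fun p : (ℝ × (Fin d → ℝ)) × (Fin d → ℝ) => gradXi L p.1 p.2 :=
  (measurable_dXi hL).comp (measurable_fst.fst.prodMk
    (measurable_loss.comp (measurable_fst.snd.prodMk measurable_snd)))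

theorem measurable_lossGrad {L : ℝ → ℝ → ℝ}
    (hL : ConvexOn ℝ Set.univ fun p : ℝ × ℝ => L p.1 p.2) (i : Fin d) :
    Measurable fun p : (ℝ × (Fin d → ℝ)) × (Fin d → ℝ) => lossGrad L p.1 p.2 i :=
  ((measurable_pi_apply i).comp measurable_snd).neg.mul ((measurable_dX hL).comp
    (measurable_fst.fst.prodMk (measurable_loss.comp (measurable_fst.snd.prodMk measurable_snd))))

/-- For `c = 0` nothing is known about the differentiability of `L ξ` at `u`, but the factor `c`
makes the default value of `deriv` irrelevant. For `c ≠ 0` the substitution is invertible. -/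
theorem hasDerivAt_dX_mul {L : ℝ → ℝ → ℝ} {ξ u c e : ℝ}
    (h : HasDerivAt (fun s : ℝ => L ξ (u - s * c)) e 0) : e = -c * dX L ξ u := by
  by_cases hc : c = 0
  · subst hc
    simp only [mul_zero, sub_zero] at h
    rw [neg_zero, zero_mul]
    exact h.unique (hasDerivAt_const _ _)
  · have h1 : HasDerivAt (fun t : ℝ => (u - t) / c) (-1 / c) u :=
      ((hasDerivAt_id u).const_sub u).div_const c
    have h2 : HasDerivAt (fun s : ℝ => L ξ (u - s * c)) e ((u - u) / c) := by simpa using h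
    have h3 := h2.comp u h1
    have h4 : ((fun s : ℝ => L ξ (u - s * c)) ∘ fun t : ℝ => (u - t) / c) = fun t => L ξ t := by
      funext t
      simp only [Function.comp_apply, div_mul_cancel₀ _ hc, sub_sub_cancel]
    rw [h4] at h3
    rw [dX, h3.deriv]
    field_simp

/-- Differentiability is available only for the composition with `y ↦ -⟨y, x⟩`, not for `L`.
Restricting to coordinate lines identifies the values of `deriv` in `dXi` and `dX`. -/
theorem fderiv_loss_comp {L : ℝ → ℝ → ℝ} {x : Fin d → ℝ} {z : ℝ × (Fin d → ℝ)}
    (h : DifferentiableAt ℝ (fun z : ℝ × (Fin d → ℝ) => L z.1 (loss z.2 x)) z) :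
    fderiv ℝ (fun z : ℝ × (Fin d → ℝ) => L z.1 (loss z.2 x)) z (1, 0) = gradXi L z x ∧
    ∀ i, fderiv ℝ (fun z : ℝ × (Fin d → ℝ) => L z.1 (loss z.2 x)) z (0, Pi.single i 1) =
      lossGrad L z x i := by
  set F := fun z : ℝ × (Fin d → ℝ) => L z.1 (loss z.2 x) with hF
  have key : ∀ w : ℝ × (Fin d → ℝ), HasDerivAt (fun s : ℝ => F (z + s • w)) (fderiv ℝ F z w) 0 :=
    fun w => by
    have h1 : HasDerivAt (fun s : ℝ => z + s • w) w 0 := by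
      simpa using ((hasDerivAt_id (0 : ℝ)).smul_const w).const_add z
    have h2 : HasFDerivAt F (fderiv ℝ F z) (z + (0 : ℝ) • w) := by simpa using h.hasFDerivAt
    exact h2.comp_hasDerivAt (0 : ℝ) h1
  constructor
  · have h1 := key (1, 0)
    have h2 : (fun s : ℝ => F (z + s • ((1 : ℝ), (0 : Fin d → ℝ)))) =
        fun s => L (z.1 + s) (loss z.2 x) := by
      funext s; simp [hF]
    rw [h2] at h1
    have h3 : HasDerivAt (fun s => L (z.1 + s) (loss z.2 x)) (fderiv ℝ F z (1, 0)) (z.1 - z.1) := by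
      simpa using h1
    have h4 := HasDerivAt.comp (h := fun s => id s - z.1) z.1 h3 ((hasDerivAt_id z.1).sub_const z.1)
    have h5 : ((fun s => L (z.1 + s) (loss z.2 x)) ∘ fun s => id s - z.1) =
        fun s => L s (loss z.2 x) := by
      funext s; simp
    rw [h5, mul_one] at h4
    rw [gradXi, dXi, h4.deriv]
  · intro i
    have h1 := key (0, Pi.single i 1)
    have h2 : (fun s : ℝ => F (z + s • ((0 : ℝ), (Pi.single i 1 : Fin d → ℝ)))) =
        fun s => L z.1 (loss z.2 x - s * x i) := by
      funext s
      simp only [hF, Prod.fst_add, Prod.smul_fst, smul_zero, add_zero, Prod.snd_add, Prod.smul_snd]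
      congr 1
      simp only [loss, Pi.add_apply, Pi.smul_apply, smul_eq_mul, add_mul, Finset.sum_add_distrib]
      have h3 : ∑ j, s * (Pi.single i 1 : Fin d → ℝ) j * x j = s * x i := by
        rw [Finset.sum_eq_single i (fun j _ hj => by simp [hj]) (by simp), Pi.single_eq_same,
          mul_one]
      rw [h3, neg_add, sub_eq_add_neg]
    rw [h2] at h1
    exact hasDerivAt_dX_mul h1

theorem fderiv_loss_comp_apply {L : ℝ → ℝ → ℝ} {x : Fin d → ℝ} {z : ℝ × (Fin d → ℝ)}
    (h : DifferentiableAt ℝ (fun z : ℝ × (Fin d → ℝ) => L z.1 (loss z.2 x)) z)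
    (w : ℝ × (Fin d → ℝ)) :
    fderiv ℝ (fun z : ℝ × (Fin d → ℝ) => L z.1 (loss z.2 x)) z w =
      w.1 * gradXi L z x + ∑ i, w.2 i * lossGrad L z x i := by
  obtain ⟨h1, h2⟩ := fderiv_loss_comp h
  have hw : w = w.1 • ((1 : ℝ), (0 : Fin d → ℝ)) +
      ∑ i, w.2 i • ((0 : ℝ), (Pi.single i 1 : Fin d → ℝ)) := by
    refine Prod.ext ?_ ?_
    · simp [Prod.fst_sum]
    · ext j
      simp [Prod.snd_sum, Finset.sum_apply, Pi.single_apply]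
  conv_lhs => rw [hw]
  rw [map_add, map_smul, map_sum, h1]
  congr 1
  exact Finset.sum_congr rfl fun i _ => by rw [map_smul, h2, smul_eq_mul]

theorem loss_comp_grad {L : ℝ → ℝ → ℝ} (hL : ConvexOn ℝ Set.univ fun p : ℝ × ℝ => L p.1 p.2)
    {x : Fin d → ℝ} {z : ℝ × (Fin d → ℝ)}
    (h : DifferentiableAt ℝ (fun z : ℝ × (Fin d → ℝ) => L z.1 (loss z.2 x)) z)
    (z' : ℝ × (Fin d → ℝ)) :
    L z.1 (loss z.2 x) + (z'.1 - z.1) * gradXi L z x + ∑ i, (z'.2 i - z.2 i) * lossGrad L z x i ≤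
      L z'.1 (loss z'.2 x) := by
  have h0 := fderiv_loss_comp_apply h (z' - z)
  set F := fun z : ℝ × (Fin d → ℝ) => L z.1 (loss z.2 x) with hF
  have hconv : ConvexOn ℝ Set.univ F := hL.comp_linearMap (lossMap x)
  have hline : ConvexOn ℝ Set.univ fun s : ℝ => F (AffineMap.lineMap z z' s) :=
    hconv.comp_affineMap (AffineMap.lineMap z z')
  have hd : HasDerivAt (fun s : ℝ => F (AffineMap.lineMap z z' s)) (fderiv ℝ F z (z' - z)) 0 := by
    have h2 : HasFDerivAt F (fderiv ℝ F z) (AffineMap.lineMap z z' (0 : ℝ)) := by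
      simpa using h.hasFDerivAt
    exact h2.comp_hasDerivAt (0 : ℝ) AffineMap.hasDerivAt_lineMap
  have := hline.le_slope_of_hasDerivAt (Set.mem_univ _) (Set.mem_univ _) zero_lt_one hd
  rw [slope_def_field, h0] at this
  simp only [AffineMap.lineMap_apply_one, AffineMap.lineMap_apply_zero, sub_zero, div_one,
    Prod.fst_sub, Prod.snd_sub, Pi.sub_apply, hF] at this
  linarith

section

variable {L : ℝ → ℝ → ℝ} {x : Fin d → ℝ} {z : ℝ × (Fin d → ℝ)}

theorem continuousAt_gradXi
    (h : ContDiffAt ℝ 1 (fun z : ℝ × (Fin d → ℝ) => L z.1 (loss z.2 x)) z) :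
    ContinuousAt (fun z => gradXi L z x) z := by
  have h1 := h.continuousAt_fderiv one_ne_zero
  have h2 : ContinuousAt (fun z => fderiv ℝ (fun z : ℝ × (Fin d → ℝ) => L z.1 (loss z.2 x)) z
      (1, 0)) z := h1.clm_apply continuousAt_const
  refine h2.congr ?_
  filter_upwards [h.eventually (by simp)] with w hw
  exact (fderiv_loss_comp (hw.differentiableAt one_ne_zero)).1

theorem continuousAt_lossGrad
    (h : ContDiffAt ℝ 1 (fun z : ℝ × (Fin d → ℝ) => L z.1 (loss z.2 x)) z) (i : Fin d) :
    ContinuousAt (fun z => lossGrad L z x i) z := by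
  have h1 := h.continuousAt_fderiv one_ne_zero
  have h2 : ContinuousAt (fun z => fderiv ℝ (fun z : ℝ × (Fin d → ℝ) => L z.1 (loss z.2 x)) z
      (0, Pi.single i 1)) z := h1.clm_apply continuousAt_const
  refine h2.congr ?_
  filter_upwards [h.eventually (by simp)] with w hw
  exact (fderiv_loss_comp (hw.differentiableAt one_ne_zero)).2 i

end

theorem abs_lossGrad_le (L : ℝ → ℝ → ℝ) (z : ℝ × (Fin d → ℝ)) (x : Fin d → ℝ) (i : Fin d) :
    |lossGrad L z x i| ≤ l1 x * |dX L z.1 (loss z.2 x)| := by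
  rw [lossGrad, abs_mul, abs_neg]
  exact mul_le_mul_of_nonneg_right (le_l1 x i) (abs_nonneg _)

theorem l1_nonneg (x : Fin d → ℝ) : 0 ≤ l1 x := Finset.sum_nonneg fun _ _ => abs_nonneg _

section

variable {Ω : Type*} [MeasurableSpace Ω] {P : Measure Ω} {X : Ω → Fin d → ℝ} {L : ℝ → ℝ → ℝ}

theorem measurable_gradXi_right (hL : ConvexOn ℝ Set.univ fun p : ℝ × ℝ => L p.1 p.2)
    (hX : Measurable X) (z : ℝ × (Fin d → ℝ)) : Measurable fun ω => gradXi L z (X ω) :=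
  (measurable_gradXi hL).comp (measurable_const.prodMk hX)

theorem measurable_lossGrad_right (hL : ConvexOn ℝ Set.univ fun p : ℝ × ℝ => L p.1 p.2)
    (hX : Measurable X) (z : ℝ × (Fin d → ℝ)) (i : Fin d) :
    Measurable fun ω => lossGrad L z (X ω) i :=
  (measurable_lossGrad hL i).comp (measurable_const.prodMk hX)

/-- One ball, slightly larger than needed at `z`, contains a neighbourhood of `z`. A single `Φ` thus
serves dominated convergence at `z`. -/
theorem LossRegular.exists_bound (hreg : LossRegular P X L) {z : ℝ × (Fin d → ℝ)}
    (hz : z.2 ∈ posOrthant d) : ∃ Φ : Ω → ℝ, Integrable Φ P ∧ ∀ᶠ w in 𝓝 z, ∀ᵐ ω ∂P,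
      |gradXi L w (X ω)| ≤ Φ ω ∧ ∀ i, |lossGrad L w (X ω) i| ≤ Φ ω := by
  have hl := l1_nonneg z.2
  obtain ⟨Φ, hΦ, hb⟩ := hreg.envelope (|z.1| + l1 z.2 + 1) (by positivity)
  refine ⟨Φ, hΦ, ?_⟩
  have h1 : ∀ᶠ w : ℝ × (Fin d → ℝ) in 𝓝 z, |w.1| + l1 w.2 < |z.1| + l1 z.2 + 1 := by
    have hc : Continuous fun w : ℝ × (Fin d → ℝ) => |w.1| + l1 w.2 :=
      continuous_fst.abs.add (continuous_l1.comp continuous_snd)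
    exact hc.tendsto z |>.eventually_lt_const (by linarith)
  filter_upwards [h1, isOpen_snd_mem_posOrthant.mem_nhds hz] with w hw hw'
  filter_upwards [hb] with ω hω
  have h2 := hω w.1 w.2 hw' hw.le
  refine ⟨?_, fun i => (abs_lossGrad_le L w (X ω) i).trans ?_⟩
  · have := mul_nonneg (l1_nonneg (X ω)) (abs_nonneg (dX L w.1 (loss w.2 (X ω))))
    unfold gradXi
    linarith
  · linarith [abs_nonneg (dXi L w.1 (loss w.2 (X ω)))]

theorem LossRegular.integrable_gradXi (hreg : LossRegular P X L) (hX : Measurable X)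
    (hL : ConvexOn ℝ Set.univ fun p : ℝ × ℝ => L p.1 p.2) {z : ℝ × (Fin d → ℝ)}
    (hz : z.2 ∈ posOrthant d) : Integrable (fun ω => gradXi L z (X ω)) P := by
  obtain ⟨Φ, hΦ, hb⟩ := hreg.exists_bound hz
  exact hΦ.mono' (measurable_gradXi_right hL hX z).aestronglyMeasurable
    (hb.self_of_nhds.mono fun ω h => h.1)

theorem LossRegular.integrable_lossGrad (hreg : LossRegular P X L) (hX : Measurable X)
    (hL : ConvexOn ℝ Set.univ fun p : ℝ × ℝ => L p.1 p.2) {z : ℝ × (Fin d → ℝ)}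
    (hz : z.2 ∈ posOrthant d) (i : Fin d) : Integrable (fun ω => lossGrad L z (X ω) i) P := by
  obtain ⟨Φ, hΦ, hb⟩ := hreg.exists_bound hz
  exact hΦ.mono' (measurable_lossGrad_right hL hX z i).aestronglyMeasurable
    (hb.self_of_nhds.mono fun ω h => h.2 i)

theorem LossRegular.continuousOn_meanXi (hreg : LossRegular P X L) (hX : Measurable X)
    (hL : ConvexOn ℝ Set.univ fun p : ℝ × ℝ => L p.1 p.2) :
    ContinuousOn (meanXi P X L) {z | z.2 ∈ posOrthant d} := fun z hz => by
  obtain ⟨Φ, hΦ, hb⟩ := hreg.exists_bound hz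
  refine (continuousAt_of_dominated (F := fun z ω => gradXi L z (X ω)) (bound := Φ)
    (Eventually.of_forall fun w => (measurable_gradXi_right hL hX w).aestronglyMeasurable)
    (hb.mono fun w hw => hw.mono fun ω h => h.1) hΦ ?_).continuousWithinAt
  filter_upwards [hreg.contDiffAt z.1 z.2 hz] with ω hω
  exact continuousAt_gradXi hω

theorem LossRegular.continuousOn_meanGrad (hreg : LossRegular P X L) (hX : Measurable X)
    (hL : ConvexOn ℝ Set.univ fun p : ℝ × ℝ => L p.1 p.2) (i : Fin d) :
    ContinuousOn (fun z => meanGrad P X L z i) {z | z.2 ∈ posOrthant d} := fun z hz => by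
  obtain ⟨Φ, hΦ, hb⟩ := hreg.exists_bound hz
  refine (continuousAt_of_dominated (F := fun z ω => lossGrad L z (X ω) i) (bound := Φ)
    (Eventually.of_forall fun w => (measurable_lossGrad_right hL hX w i).aestronglyMeasurable)
    (hb.mono fun w hw => hw.mono fun ω h => h.2 i) hΦ ?_).continuousWithinAt
  filter_upwards [hreg.contDiffAt z.1 z.2 hz] with ω hω
  exact continuousAt_lossGrad hω i

theorem posOrthant_subset {y : Fin d → ℝ} (hy : y ∈ posOrthant d) : y ∈ nonnegOrthant d :=
  fun i => (hy i).le

/-- The pointwise subgradient inequality is integrated. It requires differentiability at `z` only,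
so an exceptional event depending on `z` is harmless. -/
theorem meanLoss_grad (hreg : LossRegular P X L) (hX : Measurable X)
    (hL : ConvexOn ℝ Set.univ fun p : ℝ × ℝ => L p.1 p.2)
    (hint : ∀ ξ : ℝ, ∀ y ∈ nonnegOrthant d, Integrable (fun ω => L ξ (loss y (X ω))) P)
    {z z' : ℝ × (Fin d → ℝ)} (hz : z.2 ∈ posOrthant d) (hz' : z'.2 ∈ posOrthant d) :
    meanLoss P X L z + (z'.1 - z.1) * meanXi P X L z +
      ∑ i, (z'.2 i - z.2 i) * meanGrad P X L z i ≤ meanLoss P X L z' := by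
  have i1 := hint z.1 z.2 (posOrthant_subset hz)
  have i2 := (hreg.integrable_gradXi hX hL hz).const_mul (z'.1 - z.1)
  have i3 : ∀ i ∈ (Finset.univ : Finset (Fin d)),
      Integrable (fun ω => (z'.2 i - z.2 i) * lossGrad L z (X ω) i) P := fun i _ =>
    (hreg.integrable_lossGrad hX hL hz i).const_mul _
  have h1 : ∫ ω, (L z.1 (loss z.2 (X ω)) + (z'.1 - z.1) * gradXi L z (X ω) +
      ∑ i, (z'.2 i - z.2 i) * lossGrad L z (X ω) i) ∂P ≤ meanLoss P X L z' := by
    refine integral_mono_ae ((i1.add i2).add (integrable_finsetSum _ i3))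
      (hint z'.1 z'.2 (posOrthant_subset hz')) ?_
    filter_upwards [hreg.contDiffAt z.1 z.2 hz] with ω hω
    exact loss_comp_grad hL (hω.differentiableAt one_ne_zero) z'
  refine le_of_eq_of_le ?_ h1
  rw [integral_add (by exact i1.add i2) (integrable_finsetSum _ i3), integral_add i1 i2,
    integral_const_mul, integral_finsetSum _ i3]
  simp only [integral_const_mul]
  rfl

theorem integrable_sq_of_lintegral_le {u : Ω → ℝ} (hu : Measurable u) {C : ℝ≥0}
    (h : ∫⁻ ω, ENNReal.ofReal (u ω ^ 2) ∂P ≤ C) :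
    Integrable (fun ω => u ω ^ 2) P ∧ ∫ ω, u ω ^ 2 ∂P ≤ C := by
  have h1 : Integrable (fun ω => u ω ^ 2) P := by
    refine ⟨(hu.pow_const 2).aestronglyMeasurable, ?_⟩
    rw [hasFiniteIntegral_iff_ofReal (Eventually.of_forall fun ω => sq_nonneg _)]
    exact h.trans_lt ENNReal.coe_lt_top
  refine ⟨h1, ?_⟩
  rw [integral_eq_lintegral_of_nonneg_ae (Eventually.of_forall fun ω => sq_nonneg _)
    h1.aestronglyMeasurable]
  exact ENNReal.toReal_le_coe_of_le_coe h

theorem abs_integral_le_one_add [IsProbabilityMeasure P] {u : Ω → ℝ} {C : ℝ}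
    (hu2 : Integrable (fun ω => u ω ^ 2) P) (h : ∫ ω, u ω ^ 2 ∂P ≤ C) :
    |∫ ω, u ω ∂P| ≤ 1 + C := by
  refine (abs_integral_le_integral_abs).trans ?_
  have h1 : ∫ ω, |u ω| ∂P ≤ ∫ ω, (1 + u ω ^ 2) ∂P := by
    refine integral_mono_of_nonneg (Eventually.of_forall fun ω => abs_nonneg _)
      ((integrable_const _).add hu2) (Eventually.of_forall fun ω => ?_)
    have := sq_nonneg (|u ω| - 1)
    have h2 := sq_abs (u ω)
    simp only
    nlinarith
  refine h1.trans ?_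
  rw [integral_add (integrable_const _) hu2]
  simp
  exact h

theorem SecondMomentBound.exists_bound [Nonempty (Fin d)] {m : ℝ}
    (hmom : SecondMomentBound P X L m) :
    ∃ C : ℝ≥0, ∀ z ∈ feasible d m,
      (∫⁻ ω, ENNReal.ofReal (gradXi L z (X ω) ^ 2) ∂P ≤ C) ∧
      ∀ i, ∫⁻ ω, ENNReal.ofReal (lossGrad L z (X ω) i ^ 2) ∂P ≤ C := by
  obtain ⟨C, hC⟩ := hmom
  refine ⟨C, fun z hz => ⟨?_, fun i => ?_⟩⟩
  · obtain ⟨i⟩ := ‹Nonempty (Fin d)›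
    exact le_self_add.trans (hC i z.1 z.2 (posOrthant_subset hz.1) hz.2)
  · refine le_trans (le_of_eq ?_)
      (le_add_self.trans (hC i z.1 z.2 (posOrthant_subset hz.1) hz.2))
    refine lintegral_congr fun ω => ?_
    rw [lossGrad, mul_pow, neg_sq]

end

/-! ### Existence of a minimizer of `Γ_g` -/

theorem Distortion.exists_linear_lower {g : ℝ → ℝ} (hg : Distortion g) :
    ∃ α > 0, ∀ t, 0 ≤ t → g 0 + α * (t - 1) ≤ g t := by
  -- The secant slope over `[0, 1]`: convexity gives at least this growth beyond `1`, and below `1`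
  -- monotonicity suffices.
  refine ⟨g 1 - g 0, sub_pos.2 (hg.strictMonoOn (by simp) (by simp) one_pos), fun t ht => ?_⟩
  have h01 : g 0 < g 1 := hg.strictMonoOn (by simp) (by simp) one_pos
  rcases le_total t 1 with h1 | h1
  · have := hg.strictMonoOn.monotoneOn (by simp) (Set.mem_Ici.2 ht) ht
    nlinarith
  · have h2 := hg.convexOn.secant_mono (a := 0) (x := 1) (y := t) (by simp) (by simp)
      (Set.mem_Ici.2 ht) one_ne_zero (by linarith) h1
    rw [sub_zero, div_one, sub_zero, le_div_iff₀ (by linarith)] at h2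
    nlinarith

section

variable {Ω : Type*} {dom : Submodule ℝ (Ω → ℝ)} {ρ : (Ω → ℝ) → ℝ} {X : Ω → Fin d → ℝ}

theorem loss_smul (c : ℝ) (y x : Fin d → ℝ) : loss (c • y) x = c * loss y x := by
  simp only [loss, Pi.smul_apply, smul_eq_mul, Finset.mul_sum, mul_neg, mul_assoc]

theorem RiskAssumptions.loss_mem (hρ : RiskAssumptions dom ρ X) (y : Fin d → ℝ) :
    (fun ω => loss y (X ω)) ∈ dom := by
  have h1 : (fun ω => loss y (X ω)) = -∑ i, y i • fun ω => X ω i := by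
    funext ω; simp [loss]
  rw [h1]
  exact dom.neg_mem (dom.sum_mem fun i _ => dom.smul_mem _ (hρ.mem_dom i))

theorem RiskAssumptions.risk_smul (hρ : RiskAssumptions dom ρ X) {c : ℝ} (hc : 0 ≤ c)
    (y : Fin d → ℝ) : risk ρ X (c • y) = c * risk ρ X y := by
  have h1 := hρ.compatible.posHom c hc _ (hρ.loss_mem y)
  have h2 : (c • fun ω => loss y (X ω)) = fun ω => loss (c • y) (X ω) := by
    funext ω; simp [loss_smul]
  rw [h2] at h1
  exact h1

theorem RiskAssumptions.exists_mul_l1_le [Nonempty (Fin d)] (hρ : RiskAssumptions dom ρ X) :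
    ∃ c > 0, ∀ y ∈ posOrthant d, c * l1 y ≤ risk ρ X y := by
  have hsub : stdSimplex ℝ (Fin d) ⊆ nonnegOrthant d := fun y hy i => hy.1 i
  obtain ⟨i⟩ := ‹Nonempty (Fin d)›
  obtain ⟨u, hu, hmin⟩ := (isCompact_stdSimplex ℝ (Fin d)).exists_isMinOn
    ⟨_, single_mem_stdSimplex ℝ i⟩ (hρ.continuousOn.mono hsub)
  have : Nonempty (Fin d) := ⟨i⟩
  refine ⟨risk ρ X u, hρ.pos u hu, fun y hy => ?_⟩
  have hl := l1_pos hy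
  have h1 : (l1 y)⁻¹ • y ∈ stdSimplex ℝ (Fin d) := by
    refine ⟨fun j => mul_nonneg (inv_nonneg.2 hl.le) (hy j).le, ?_⟩
    simp only [Pi.smul_apply, smul_eq_mul, ← Finset.mul_sum, ← l1_eq_sum hy]
    exact inv_mul_cancel₀ hl.ne'
  have h2 : risk ρ X u ≤ (l1 y)⁻¹ * risk ρ X y := by
    rw [← hρ.risk_smul (inv_nonneg.2 hl.le)]
    exact hmin h1
  rwa [← div_eq_inv_mul, le_div_iff₀ hl] at h2

theorem continuousOn_Gam {g : ℝ → ℝ} (hρ : RiskAssumptions dom ρ X) (hg : Distortion g)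
    (hr : ∀ y ∈ posOrthant d, 0 ≤ risk ρ X y) (b : Fin d → ℝ) :
    ContinuousOn (Gam g ρ X b) (posOrthant d) := by
  refine ContinuousOn.sub (hg.contDiffOn.continuousOn.comp
    (hρ.contDiffOn.continuousOn) fun y hy => hr y hy) ?_
  refine continuousOn_finsetSum _ fun i _ => continuousOn_const.mul ?_
  exact ContinuousOn.log (continuous_apply i).continuousOn fun y hy => (hy i).ne'

theorem exists_isMinOn_Gam {g : ℝ → ℝ} {b : Fin d → ℝ} (hρ : RiskAssumptions dom ρ X)
    (hg : Distortion g) (hb : ∀ i, 0 < b i) (hb1 : ∑ i, b i = 1) :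
    ∃ y ∈ posOrthant d, IsMinOn (Gam g ρ X b) (posOrthant d) y := by
  have hne : Nonempty (Fin d) := by
    by_contra h
    rw [not_nonempty_iff] at h
    simp at hb1
  obtain ⟨c, hc, hcl⟩ := hρ.exists_mul_l1_le
  obtain ⟨α, hα, hgl⟩ := hg.exists_linear_lower
  have hr : ∀ y ∈ posOrthant d, 0 ≤ risk ρ X y := fun y hy =>
    (mul_nonneg hc.le (l1_pos hy).le).trans (hcl y hy)
  -- Half of the linear growth rate of `g ∘ r`. The logarithms, bounded by `log t ≤ lam t - 1 - log
  -- lam`, consume one half and the other half gives coercivity.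
  set lam := α * c / 2 with hlam
  have hlam0 : 0 < lam := by positivity
  have hlog : ∀ t : ℝ, 0 < t → Real.log t ≤ lam * t - 1 - Real.log lam := fun t ht => by
    have := Real.log_le_sub_one_of_pos (mul_pos hlam0 ht)
    rw [Real.log_mul hlam0.ne' ht.ne'] at this
    linarith
  -- The sublevel set through the vector of ones is bounded by coercivity. It is bounded away from
  -- the faces because a single very negative `log` cannot be compensated by the others.
  set T := Gam g ρ X b 1 with hT
  have hone : (1 : Fin d → ℝ) ∈ posOrthant d := fun i => one_pos
  have hgy : ∀ y ∈ posOrthant d, g 0 + 2 * lam * l1 y - α ≤ g (risk ρ X y) := fun y hy => by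
    have h1 := hgl _ (hr y hy)
    have h2 := mul_le_mul_of_nonneg_left (hcl y hy) hα.le
    rw [hlam]
    linarith
  have hbl : ∀ i, b i ≤ 1 := fun i => by
    rw [← hb1]; exact Finset.single_le_sum (fun j _ => (hb j).le) (Finset.mem_univ i)
  set a := -1 - Real.log lam with ha
  have hsum : ∀ y ∈ posOrthant d, ∑ i, b i * Real.log (y i) ≤ lam * l1 y + a := fun y hy => by
    calc ∑ i, b i * Real.log (y i) ≤ ∑ i, (lam * y i + b i * a) := by
          refine Finset.sum_le_sum fun i _ => ?_
          have h1 := mul_le_mul_of_nonneg_left (hlog (y i) (hy i)) (hb i).le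
          have h2 := mul_le_mul_of_nonneg_right (hbl i) (mul_pos hlam0 (hy i)).le
          rw [ha]
          nlinarith
      _ = _ := by
          rw [Finset.sum_add_distrib, ← Finset.mul_sum, ← Finset.sum_mul, hb1, one_mul,
            l1_eq_sum hy]
  set R := (T - g 0 + α + a) / lam with hR
  have hl1 : ∀ y ∈ posOrthant d, Gam g ρ X b y ≤ T → l1 y ≤ R := fun y hy hyT => by
    have h1 := hgy y hy
    have h2 := hsum y hy
    rw [hR, le_div_iff₀ hlam0]
    rw [Gam] at hyT
    linarith
  set A := T - g 0 + α + (lam * R + |a|) with hA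
  have hcoord : ∀ y ∈ posOrthant d, Gam g ρ X b y ≤ T → ∀ i, Real.exp (-A / b i) ≤ y i :=
    fun y hy hyT i => by
    rw [← Real.le_log_iff_exp_le (hy i), div_le_iff₀ (hb i)]
    have h1 := hgy y hy
    have hlR := hl1 y hy hyT
    have hl0 := (l1_pos hy).le
    have h2 : ∑ j ∈ Finset.univ.erase i, b j * Real.log (y j) ≤ lam * R + |a| := by
      calc ∑ j ∈ Finset.univ.erase i, b j * Real.log (y j)
          ≤ ∑ j ∈ Finset.univ.erase i, (lam * y j + b j * |a|) := by
            refine Finset.sum_le_sum fun j _ => ?_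
            have h1 := mul_le_mul_of_nonneg_left (hlog (y j) (hy j)) (hb j).le
            have h2 := mul_le_mul_of_nonneg_right (hbl j) (mul_pos hlam0 (hy j)).le
            have h3 := mul_le_mul_of_nonneg_left (le_abs_self a) (hb j).le
            rw [ha] at h3 ⊢
            nlinarith
        _ ≤ ∑ j, (lam * y j + b j * |a|) := by
            refine Finset.sum_le_sum_of_subset_of_nonneg (Finset.erase_subset _ _) fun j _ _ => ?_
            have := hy j
            have := hb j
            positivity
        _ = lam * l1 y + |a| := by
            rw [Finset.sum_add_distrib, ← Finset.mul_sum, ← Finset.sum_mul, hb1, one_mul,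
              l1_eq_sum hy]
        _ ≤ _ := by gcongr
    have h3 := Finset.add_sum_erase Finset.univ (fun j => b j * Real.log (y j)) (Finset.mem_univ i)
    rw [Gam] at hyT
    have h4 : 0 ≤ 2 * lam * l1 y := by positivity
    rw [hA]
    linarith
  set K : Set (Fin d → ℝ) := Set.univ.pi fun i => Set.Icc (Real.exp (-A / b i)) R with hK
  have hKc : IsCompact K := isCompact_univ_pi fun i => isCompact_Icc
  have hKpos : K ⊆ posOrthant d := fun y hy i =>
    (Real.exp_pos _).trans_le (hy i (Set.mem_univ i)).1
  have hmem : ∀ y ∈ posOrthant d, Gam g ρ X b y ≤ T → y ∈ K := fun y hy hyT i _ =>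
    ⟨hcoord y hy hyT i, apply_le_of_l1_le (hl1 y hy hyT) i⟩
  obtain ⟨y, hyK, hmin⟩ := hKc.exists_isMinOn ⟨1, hmem 1 hone le_rfl⟩
    ((continuousOn_Gam hρ hg hr b).mono hKpos)
  refine ⟨y, hKpos hyK, fun w hw => ?_⟩
  by_cases h : Gam g ρ X b w ≤ T
  · exact hmin (hmem w hw h)
  · exact (hmin (hmem 1 hone le_rfl)).trans (not_le.1 h).le

end

/-! ### The expected loss as an instance of the model -/

section

variable {Ω : Type*} [MeasurableSpace Ω] {P : Measure Ω} {X : Ω → Fin d → ℝ} {L : ℝ → ℝ → ℝ}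

theorem h_eq_logBarrier [IsProbabilityMeasure P] {b : Fin d → ℝ} {z : ℝ × (Fin d → ℝ)}
    (hint : Integrable (fun ω => L z.1 (loss z.2 (X ω))) P) :
    h P X L b z = logBarrier b (meanLoss P X L) z := by
  simp only [h, H, logBarrier, meanLoss]
  rw [integral_sub hint (integrable_const _)]
  simp

theorem sum_log_midpoint_lt {b y y' : Fin d → ℝ} (hb : ∀ i, 0 < b i) (hy : y ∈ posOrthant d)
    (hy' : y' ∈ posOrthant d) (hne : y ≠ y') :
    ∑ i, b i * Real.log (y i) + ∑ i, b i * Real.log (y' i) <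
      2 * ∑ i, b i * Real.log ((y i + y' i) / 2) := by
  obtain ⟨j, hj⟩ := Function.ne_iff.1 hne
  have hhalf : (0 : ℝ) < 1 / 2 := by norm_num
  have hadd : (1 / 2 : ℝ) + 1 / 2 = 1 := by norm_num
  rw [← Finset.sum_add_distrib, Finset.mul_sum]
  refine Finset.sum_lt_sum (fun i _ => ?_) ⟨j, Finset.mem_univ j, ?_⟩
  · have h1 := strictConcaveOn_log_Ioi.concaveOn.2 (hy i) (hy' i) hhalf.le hhalf.le hadd
    simp only [smul_eq_mul] at h1
    rw [show 1 / 2 * y i + 1 / 2 * y' i = (y i + y' i) / 2 by ring] at h1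
    nlinarith [hb i]
  · have h1 := strictConcaveOn_log_Ioi.2 (hy j) (hy' j) hj hhalf hhalf hadd
    simp only [smul_eq_mul] at h1
    rw [show 1 / 2 * y j + 1 / 2 * y' j = (y j + y' j) / 2 by ring] at h1
    nlinarith [hb j]

/-- The expected loss has a gradient model around its unique minimizer, whose second component
minimizes `Γ_g`. -/
theorem exists_gradientModel [IsProbabilityMeasure P] (hX : Measurable X)
    {dom : Submodule ℝ (Ω → ℝ)} {ρ : (Ω → ℝ) → ℝ} (hρ : RiskAssumptions dom ρ X)
    {b : Fin d → ℝ} (hb : ∀ i, 0 < b i) (hb1 : ∑ i, b i = 1) {g : ℝ → ℝ} (hg : Distortion g)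
    (hL : Represents P g ρ X L) (hreg : LossRegular P X L) {m : ℝ}
    (hm : ∀ y ∈ posOrthant d, IsMinOn (Gam g ρ X b) (posOrthant d) y → l1 y ≤ m)
    (hmom : SecondMomentBound P X L m) :
    ∃ B zs, GradientModel b m B (meanLoss P X L) (meanXi P X L) (meanGrad P X L) zs ∧
      IsMinOn (Gam g ρ X b) (posOrthant d) zs.2 := by
  obtain ⟨y, hy, hmin⟩ := exists_isMinOn_Gam hρ hg hb hb1
  have hne : Nonempty (Fin d) := by
    by_contra h
    rw [not_nonempty_iff] at h
    simp at hb1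
  obtain ⟨ξ, hξ, hgξ⟩ := hL.min_eq y hy
  obtain ⟨C, hC⟩ := hmom.exists_bound
  have hgrad : ∀ z z' : ℝ × (Fin d → ℝ), z.2 ∈ posOrthant d → z'.2 ∈ posOrthant d →
      meanLoss P X L z + (z'.1 - z.1) * meanXi P X L z +
        ∑ i, (z'.2 i - z.2 i) * meanGrad P X L z i ≤ meanLoss P X L z' := fun z z' hz hz' =>
    meanLoss_grad hreg hX hL.convexOn hL.integrable hz hz'
  -- Minimizing over `ξ` first reduces the objective to `Γ_g`, so a minimizer of `Γ_g` with its
  -- optimal `ξ` is a joint minimizer.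
  have hle : ∀ z : ℝ × (Fin d → ℝ), z.2 ∈ posOrthant d →
      logBarrier b (meanLoss P X L) (ξ, y) ≤ logBarrier b (meanLoss P X L) z := fun z hz => by
    obtain ⟨ξ', hξ', hgξ'⟩ := hL.min_eq z.2 hz
    have h1 : meanLoss P X L (ξ', z.2) ≤ meanLoss P X L z := by
      by_cases h : z.1 = ξ'
      · rw [← h]
      · exact (hξ' z.1 h).le
    have h2 := hmin hz
    simp only [Set.mem_ofPred_eq, Gam, hgξ, hgξ'] at h2
    simp only [logBarrier, meanLoss] at h1 ⊢
    linarith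
  -- The bound on the gradient is `|E u| ≤ 1 + E u²`.
  refine ⟨1 + C, (ξ, y), ⟨hb, hb1, ⟨hy, hm y hy hmin⟩, hgrad,
    hreg.continuousOn_meanXi hX hL.convexOn, hreg.continuousOn_meanGrad hX hL.convexOn,
    fun z hz => ?_, fun z hz i => ?_, fun z hz hzne => ?_⟩, hmin⟩
  · obtain ⟨h1, h2⟩ := integrable_sq_of_lintegral_le (measurable_gradXi_right hL.convexOn hX z)
      (hC z hz).1
    exact abs_integral_le_one_add h1 h2
  · obtain ⟨h1, h2⟩ := integrable_sq_of_lintegral_le (measurable_lossGrad_right hL.convexOn hX z i)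
      ((hC z hz).2 i)
    exact abs_integral_le_one_add h1 h2
  · by_cases hzy : z.2 = y
    · have h1 : z.1 ≠ ξ := fun h => hzne (Prod.ext h hzy)
      have h2 := hξ z.1 h1
      simp only [logBarrier, meanLoss, hzy]
      linarith
    -- If `z` were a minimizer with a different `y`, strict concavity of `log` would make the
    -- midpoint strictly better. The convexity of the expected loss enters through its subgradient
    -- at the midpoint.
    · refine lt_of_le_of_ne (hle z hz) fun heq => ?_
      set w : ℝ × (Fin d → ℝ) := ((z.1 + ξ) / 2, fun i => (z.2 i + y i) / 2) with hw
      have hwpos : w.2 ∈ posOrthant d := fun i => by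
        have := hz i
        have := hy i
        simp only [hw]
        linarith
      have h1 := hgrad w z hwpos hz
      have h2 := hgrad w (ξ, y) hwpos hy
      have h3 := sum_log_midpoint_lt hb hz hy hzy
      have h4 := hle w hwpos
      have h5 : ∑ i, (z.2 i - w.2 i) * meanGrad P X L w i +
          ∑ i, (y i - w.2 i) * meanGrad P X L w i = 0 := by
        rw [← Finset.sum_add_distrib]
        refine Finset.sum_eq_zero fun i _ => ?_
        simp only [hw]
        ring
      have h6 : (z.1 - w.1) * meanXi P X L w + (ξ - w.1) * meanXi P X L w = 0 := by
        simp only [hw]; ring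
      simp only [logBarrier] at heq h4
      simp only at h2
      have h7 : ∑ i, b i * Real.log (w.2 i) = ∑ i, b i * Real.log ((z.2 i + y i) / 2) := rfl
      linarith

end

/-! ### Independence of the next sample and conditional expectations -/

section Independence

variable {Ω : Type*} [mΩ : MeasurableSpace Ω] {P : Measure Ω}

/-- The initial σ-algebra is adjoined to the family as the index `none`. The past and the next
sample then correspond to disjoint sets of indices of one independent family. -/
theorem iIndep_option_elim [IsProbabilityMeasure P] {m₀ : MeasurableSpace Ω}
    {m : ℕ → MeasurableSpace Ω} (h : iIndep m P) (h₀ : Indep m₀ (⨆ k, m k) P) :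
    iIndep (fun o : Option ℕ => o.elim m₀ m) P := by
  classical
  rw [iIndep_iff] at h ⊢
  rw [Indep_iff] at h₀
  intro s f hf
  have hB : ∀ k ∈ s.eraseNone, MeasurableSet[m k] (f (some k)) := fun k hk =>
    hf (some k) (Finset.mem_eraseNone.1 hk)
  have h1 := h s.eraseNone hB
  have hBm : MeasurableSet[⨆ k, m k] (⋂ k ∈ s.eraseNone, f (some k)) :=
    Finset.measurableSet_biInter _ fun k hk => le_iSup m k _ (hB k hk)
  by_cases hn : none ∈ s
  · have h2 : ⋂ i ∈ s, f i = f none ∩ ⋂ k ∈ s.eraseNone, f (some k) := by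
      ext ω
      simp only [Set.mem_iInter, Set.mem_inter_iff, Finset.mem_eraseNone]
      refine ⟨fun hω => ⟨hω _ hn, fun k hk => hω _ hk⟩, fun hω i hi => ?_⟩
      cases i with
      | none => exact hω.1
      | some k => exact hω.2 k hi
    rw [h2, h₀ _ _ (hf none hn) hBm, h1, ← Finset.mul_prod_erase s _ hn,
      ← Finset.map_some_eraseNone, Finset.prod_map]
    rfl
  · have h2 : ⋂ i ∈ s, f i = ⋂ k ∈ s.eraseNone, f (some k) := by
      ext ω
      simp only [Set.mem_iInter, Finset.mem_eraseNone]
      refine ⟨fun hω k hk => hω _ hk, fun hω i hi => ?_⟩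
      cases i with
      | none => exact absurd hi hn
      | some k => exact hω k hi
    rw [h2, h1]
    conv_rhs => rw [← Finset.erase_eq_of_notMem hn, ← Finset.map_some_eraseNone, Finset.prod_map]
    rfl

theorem Sampling.indep_next [IsProbabilityMeasure P] {X : Ω → Fin d → ℝ}
    {z₀ : Ω → ℝ × (Fin d → ℝ)} (hz₀ : Measurable z₀) {Xs : ℕ → Ω → Fin d → ℝ}
    (hXs : ∀ k, Measurable (Xs k)) (hS : Sampling P X z₀ Xs) (k : ℕ) :
    Indep (natFiltration z₀ hz₀ Xs hXs k)
      (MeasurableSpace.comap (Xs (k + 1)) inferInstance) P := by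
  have h0 : Indep (MeasurableSpace.comap z₀ inferInstance)
      (⨆ k, MeasurableSpace.comap (Xs (k + 1)) inferInstance) P := by
    refine indep_of_indep_of_le_right ((IndepFun_iff_Indep _ _ _).1 hS.indep_init)
      (iSup_le fun j => ?_)
    exact Measurable.comap_le ((measurable_pi_apply j).comp
        (comap_measurable (fun ω (k : ℕ) => Xs (k + 1) ω)))
  have h1 := iIndep_option_elim ((iIndepFun_iff_iIndep _ _ _).1 hS.indep) h0
  have hle : ∀ o : Option ℕ, o.elim (MeasurableSpace.comap z₀ inferInstance)
      (fun k => MeasurableSpace.comap (Xs (k + 1)) inferInstance) ≤ mΩ := fun o => by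
    cases o with
    | none => exact hz₀.comap_le
    | some j => exact (hXs (j + 1)).comap_le
  -- The index `some j` stands for the sample `j + 1`, so the past up to time `k` is `none` together
  -- with `j < k`, and `some k` is the next sample.
  have h2 := indep_iSup_of_disjoint hle h1 (S := {o | ∀ j, o = some j → j < k}) (T := {some k})
    (Set.disjoint_singleton_right.2 fun h => lt_irrefl k (h k rfl))
  refine indep_of_indep_of_le_left (indep_of_indep_of_le_right h2 ?_) ?_
  · exact le_iSup₂_of_le (some k) rfl le_rfl
  · refine sup_le ?_ (iSup₂_le fun j hj => ?_)
    · exact le_iSup₂_of_le none (fun j h => by simp at h) le_rfl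
    · rw [Finset.mem_Icc] at hj
      obtain ⟨i, rfl⟩ : ∃ i, j = i + 1 := ⟨j - 1, by omega⟩
      exact le_iSup₂_of_le (some i) (fun l h => by simp at h; omega) le_rfl

variable {E V : Type*} [MeasurableSpace E] [MeasurableSpace V]

theorem lintegral_comp_of_indepFun [IsProbabilityMeasure P] {Z : Ω → E} {x : Ω → V}
    (hZ : Measurable Z) (hx : Measurable x) (hind : IndepFun Z x P) {φ : E × V → ℝ≥0∞}
    (hφ : Measurable φ) :
    ∫⁻ ω, φ (Z ω, x ω) ∂P = ∫⁻ ω, ∫⁻ v, φ (Z ω, v) ∂(P.map x) ∂P := by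
  have hlaw := (indepFun_iff_map_prod_eq_prod_map_map hZ.aemeasurable hx.aemeasurable).1 hind
  have := Measure.isProbabilityMeasure_map (μ := P) hx.aemeasurable
  rw [← lintegral_map hφ (hZ.prodMk hx), hlaw, lintegral_prod _ hφ.aemeasurable,
    lintegral_map hφ.lintegral_prod_right' hZ]

theorem integral_comp_of_indepFun [IsProbabilityMeasure P] {Z : Ω → E} {x : Ω → V}
    (hZ : Measurable Z) (hx : Measurable x) (hind : IndepFun Z x P) {φ : E × V → ℝ}
    (hφ : Measurable φ) (hint : Integrable (fun ω => φ (Z ω, x ω)) P) :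
    Integrable (fun ω => ∫ v, φ (Z ω, v) ∂(P.map x)) P ∧
      ∫ ω, φ (Z ω, x ω) ∂P = ∫ ω, ∫ v, φ (Z ω, v) ∂(P.map x) ∂P := by
  have hlaw := (indepFun_iff_map_prod_eq_prod_map_map hZ.aemeasurable hx.aemeasurable).1 hind
  have := Measure.isProbabilityMeasure_map (μ := P) hx.aemeasurable
  have := Measure.isProbabilityMeasure_map (μ := P) hZ.aemeasurable
  have hψ : StronglyMeasurable fun e => ∫ v, φ (e, v) ∂(P.map x) :=
    hφ.stronglyMeasurable.integral_prod_right'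
  have h1 : Integrable φ ((P.map Z).prod (P.map x)) := by
    rw [← hlaw, integrable_map_measure hφ.aestronglyMeasurable (hZ.prodMk hx).aemeasurable]
    exact hint
  refine ⟨h1.integral_prod_left.comp_measurable hZ, ?_⟩
  rw [← integral_map (f := φ) (hZ.prodMk hx).aemeasurable hφ.aestronglyMeasurable, hlaw,
    integral_prod _ h1, integral_map hZ.aemeasurable hψ.aestronglyMeasurable]

end Independence

/-- Conditional expectation given `m` of a function of an `m`-measurable variable and an
independent one. -/
theorem condExp_comp_of_indep {Ω E V : Type*} [MeasurableSpace E] [MeasurableSpace V]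
    {m mΩ : MeasurableSpace Ω} {P : Measure Ω} [IsProbabilityMeasure P] (hm : m ≤ mΩ)
    {Z : Ω → E} {x : Ω → V} (hZ : Measurable[m] Z) (hx : Measurable x)
    (hind : Indep m (MeasurableSpace.comap x inferInstance) P) {φ : E × V → ℝ}
    (hφ : Measurable φ) (hint : Integrable (fun ω => φ (Z ω, x ω)) P) :
    P[fun ω => φ (Z ω, x ω) | m] =ᵐ[P] fun ω => ∫ v, φ (Z ω, v) ∂(P.map x) := by
  have := Measure.isProbabilityMeasure_map (μ := P) hx.aemeasurable
  have hZ' : Measurable Z := hZ.mono hm le_rfl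
  have hψ : StronglyMeasurable fun e => ∫ v, φ (e, v) ∂(P.map x) :=
    hφ.stronglyMeasurable.integral_prod_right'
  have hindZ : ∀ {F : Type} [MeasurableSpace F] {Y : Ω → F}, Measurable[m] Y →
      IndepFun (fun ω => (Z ω, Y ω)) x P := fun {F _ Y} hY => by
    rw [IndepFun_iff_Indep]
    exact indep_of_indep_of_le_left hind (hZ.prodMk hY).comap_le
  have h0 : IndepFun Z x P := by
    rw [IndepFun_iff_Indep]
    exact indep_of_indep_of_le_left hind hZ.comap_le
  have hi := (integral_comp_of_indepFun hZ' hx h0 hφ hint).1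
  refine (ae_eq_condExp_of_forall_setIntegral_eq hm hint (fun s _ _ => hi.integrableOn)
    (fun s hs _ => ?_) ?_).symm
  -- The indicator of `s` is appended to `Z` as a real coordinate. The set integral becomes the
  -- expectation of a function of an independent pair, to which Fubini applies.
  · have hsm : Measurable[m] (s.indicator fun _ => (1 : ℝ)) := measurable_const.indicator hs
    have hφ' : Measurable fun p : (E × ℝ) × V => p.1.2 * φ (p.1.1, p.2) := by fun_prop
    have hint' : Integrable (fun ω => s.indicator (fun _ => (1 : ℝ)) ω * φ (Z ω, x ω)) P := by
      refine (hint.indicator (hm s hs)).congr (Eventually.of_forall fun ω => ?_)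
      by_cases h : ω ∈ s <;> simp [h]
    have h1 := (integral_comp_of_indepFun (hZ'.prodMk (hsm.mono hm le_rfl)) hx (hindZ hsm) hφ'
      hint').2
    simp only [integral_const_mul] at h1
    rw [← integral_indicator (hm s hs), ← integral_indicator (hm s hs)]
    refine Eq.trans (integral_congr_ae (Eventually.of_forall fun ω => ?_)) (h1.symm.trans
      (integral_congr_ae (Eventually.of_forall fun ω => ?_)))
    · by_cases h : ω ∈ s <;> simp [h]
    · by_cases h : ω ∈ s <;> simp [h]
  · exact (hψ.comp_measurable hZ).aestronglyMeasurable

/-! ### Martingales bounded in `L²` -/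

section Martingale

variable {Ω : Type*} [mΩ : MeasurableSpace Ω] {P : Measure Ω} [IsProbabilityMeasure P]
  {ℱ : Filtration ℕ mΩ} {D : ℕ → Ω → ℝ}

theorem integral_sq_sum_martingaleDiff (hD : ∀ k, StronglyMeasurable[ℱ (k + 1)] (D k))
    (hD2 : ∀ k, MemLp (D k) 2 P) (h0 : ∀ k, P[D k | ℱ k] =ᵐ[P] 0) (n : ℕ) :
    ∫ ω, (∑ k ∈ Finset.range n, D k ω) ^ 2 ∂P = ∑ k ∈ Finset.range n, ∫ ω, D k ω ^ 2 ∂P := by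
  have hsm : ∀ n, StronglyMeasurable[ℱ n] fun ω => ∑ k ∈ Finset.range n, D k ω := fun n =>
    Finset.stronglyMeasurable_fun_sum _ fun k hk =>
      (hD k).mono (ℱ.mono (Finset.mem_range.1 hk))
  have hmem : ∀ n, MemLp (fun ω => ∑ k ∈ Finset.range n, D k ω) 2 P := fun n =>
    memLp_finsetSum _ fun k _ => hD2 k
  induction n with
  | zero => simp
  | succ n ih =>
    have hmul : Integrable ((fun ω => ∑ k ∈ Finset.range n, D k ω) * D n) P :=
      (hmem n).integrable_mul (hD2 n)
    have hcross : ∫ ω, (∑ k ∈ Finset.range n, D k ω) * D n ω ∂P = 0 := by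
      have h1 := condExp_mul_of_stronglyMeasurable_left (hsm n) hmul
        ((hD2 n).integrable (by norm_num))
      have h2 : P[(fun ω => ∑ k ∈ Finset.range n, D k ω) * D n | ℱ n] =ᵐ[P] 0 := by
        filter_upwards [h1, h0 n] with ω hω hω0
        rw [hω, Pi.mul_apply, hω0]
        simp
      have h3 := integral_condExp (μ := P) (f := (fun ω => ∑ k ∈ Finset.range n, D k ω) * D n)
        (ℱ.le n)
      rw [integral_congr_ae h2] at h3
      simpa using h3.symm
    have e : (fun ω => (∑ k ∈ Finset.range (n + 1), D k ω) ^ 2) = fun ω =>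
        (∑ k ∈ Finset.range n, D k ω) ^ 2 + 2 * ((∑ k ∈ Finset.range n, D k ω) * D n ω) +
          D n ω ^ 2 := by
      funext ω
      rw [Finset.sum_range_succ]
      ring
    have i1 := (hmem n).integrable_sq
    have i2 : Integrable (fun ω => 2 * ((∑ k ∈ Finset.range n, D k ω) * D n ω)) P :=
      hmul.const_mul 2
    rw [e, integral_add (by exact i1.add i2) (hD2 n).integrable_sq, integral_add i1 i2,
      integral_const_mul, hcross, ih, Finset.sum_range_succ]
    ring

theorem martingale_sum_martingaleDiff (hD : ∀ k, StronglyMeasurable[ℱ (k + 1)] (D k))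
    (hD2 : ∀ k, MemLp (D k) 2 P) (h0 : ∀ k, P[D k | ℱ k] =ᵐ[P] 0) :
    Martingale (fun n ω => ∑ k ∈ Finset.range n, D k ω) ℱ P := by
  refine martingale_of_condExp_sub_eq_zero_nat (fun n => ?_) (fun n => ?_) fun n => ?_
  · exact Finset.stronglyMeasurable_fun_sum _ fun k hk =>
      (hD k).mono (ℱ.mono (Finset.mem_range.1 hk))
  · exact (memLp_finsetSum _ fun k _ => hD2 k).integrable (by norm_num)
  · have : ((fun ω => ∑ k ∈ Finset.range (n + 1), D k ω) - fun ω => ∑ k ∈ Finset.range n, D k ω) =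
        D n := by
      funext ω
      simp [Finset.sum_range_succ]
    rw [this]
    exact h0 n

theorem eLpNorm_two_le_of_integral_sq_le {Ω : Type*} [MeasurableSpace Ω] {P : Measure Ω} {u : Ω → ℝ} (hu : MemLp u 2 P) {K : ℝ} (hK : 0 ≤ K)
    (h : ∫ ω, u ω ^ 2 ∂P ≤ K ^ 2) : eLpNorm u 2 P ≤ ENNReal.ofReal K := by
  rw [hu.eLpNorm_eq_integral_rpow_norm (by norm_num) (by norm_num)]
  refine ENNReal.ofReal_le_ofReal ?_
  have e : ∫ ω, ‖u ω‖ ^ (ENNReal.toReal 2) ∂P = ∫ ω, u ω ^ 2 ∂P := by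
    refine integral_congr_ae (Eventually.of_forall fun ω => ?_)
    simp
  rw [e, ENNReal.toReal_ofNat, ← one_div, ← Real.sqrt_eq_rpow]
  exact Real.sqrt_le_iff.2 ⟨hK, h⟩

theorem exists_eLpNorm_sum_martingaleDiff_le (hD : ∀ k, StronglyMeasurable[ℱ (k + 1)] (D k))
    (hD2 : ∀ k, MemLp (D k) 2 P) (h0 : ∀ k, P[D k | ℱ k] =ᵐ[P] 0) {e : ℕ → ℝ}
    (he : Summable e) (hle : ∀ k, ∫ ω, D k ω ^ 2 ∂P ≤ e k) :
    ∃ C : ℝ≥0, ∀ n, eLpNorm (fun ω => ∑ k ∈ Finset.range n, D k ω) 2 P ≤ C := by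
  have he0 : ∀ k, 0 ≤ e k := fun k => (integral_nonneg fun ω => sq_nonneg _).trans (hle k)
  refine ⟨(√(∑' k, e k)).toNNReal, fun n => eLpNorm_two_le_of_integral_sq_le
    (memLp_finsetSum _ fun k _ => hD2 k) (Real.sqrt_nonneg _) ?_⟩
  rw [integral_sq_sum_martingaleDiff hD hD2 h0, Real.sq_sqrt (tsum_nonneg he0)]
  exact (Finset.sum_le_sum fun k _ => hle k).trans (he.sum_le_tsum _ fun k _ => he0 k)

theorem Martingale.exists_ae_tendsto {M : ℕ → Ω → ℝ} (hM : Martingale M ℱ P)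
    (hb : ∃ C : ℝ≥0, ∀ n, eLpNorm (M n) 2 P ≤ C) :
    ∃ Minf : Ω → ℝ, ∀ᵐ ω ∂P, Tendsto (fun n => M n ω) atTop (𝓝 (Minf ω)) := by
  obtain ⟨C, hC⟩ := hb
  refine ⟨_, hM.submartingale.ae_tendsto_limitProcess (R := C) fun n => ?_⟩
  refine (eLpNorm_le_eLpNorm_of_exponent_le (by norm_num) ?_).trans (hC n)
  exact ((hM.stronglyMeasurable n).mono (ℱ.le n)).aestronglyMeasurable

end Martingale

/-! ### One stochastic step -/

/-- The size of a stochastic gradient. -/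
noncomputable def noise (L : ℝ → ℝ → ℝ) (z : ℝ × (Fin d → ℝ)) (x : Fin d → ℝ) : ℝ :=
  1 + gradXi L z x ^ 2 + ∑ i, lossGrad L z x i ^ 2

theorem one_le_noise (L : ℝ → ℝ → ℝ) (z : ℝ × (Fin d → ℝ)) (x : Fin d → ℝ) : 1 ≤ noise L z x := by
  have h1 : 0 ≤ ∑ i, lossGrad L z x i ^ 2 := Finset.sum_nonneg fun i _ => sq_nonneg _
  unfold noise
  nlinarith [sq_nonneg (gradXi L z x)]

theorem measurable_noise {L : ℝ → ℝ → ℝ} (hL : ConvexOn ℝ Set.univ fun p : ℝ × ℝ => L p.1 p.2) :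
    Measurable fun p : (ℝ × (Fin d → ℝ)) × (Fin d → ℝ) => noise L p.1 p.2 :=
  (measurable_const.add ((measurable_gradXi hL).pow_const 2)).add
    (Finset.measurable_sum _ fun i _ => (measurable_lossGrad hL i).pow_const 2)

theorem abs_gradXi_le_sqrt_noise (L : ℝ → ℝ → ℝ) (z : ℝ × (Fin d → ℝ)) (x : Fin d → ℝ) :
    |gradXi L z x| ≤ √(noise L z x) := by
  refine Real.abs_le_sqrt ?_
  have h1 : 0 ≤ ∑ i, lossGrad L z x i ^ 2 := Finset.sum_nonneg fun i _ => sq_nonneg _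
  unfold noise
  linarith

theorem abs_lossGrad_le_sqrt_noise (L : ℝ → ℝ → ℝ) (z : ℝ × (Fin d → ℝ)) (x : Fin d → ℝ)
    (i : Fin d) : |lossGrad L z x i| ≤ √(noise L z x) := by
  refine Real.abs_le_sqrt ?_
  have h1 := Finset.single_le_sum (f := fun i => lossGrad L z x i ^ 2) (fun i _ => sq_nonneg _)
    (Finset.mem_univ i)
  unfold noise
  nlinarith [sq_nonneg (gradXi L z x)]

attribute [irreducible] noise

theorem measurable_kap : Measurable (kap : (Fin d → ℝ) → ℝ) := by
  unfold kap
  exact (Measurable.iInf fun i => measurable_pi_apply i).min measurable_const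

theorem measurable_prox (m : ℝ) :
    Measurable fun p : (Fin d → ℝ) × (Fin d → ℝ) => prox m p.1 p.2 := by
  have hw : Measurable fun p : (Fin d → ℝ) × (Fin d → ℝ) => fun i => p.1 i * Real.exp (-p.2 i) := by
    fun_prop
  have hl : Measurable fun p : (Fin d → ℝ) × (Fin d → ℝ) =>
      l1 fun i => p.1 i * Real.exp (-p.2 i) := continuous_l1.measurable.comp hw
  unfold prox
  exact Measurable.ite (measurableSet_le hl measurable_const) hw
    ((measurable_const.div hl).smul hw)

theorem gradY_eq (L : ℝ → ℝ → ℝ) (b : Fin d → ℝ) (z : ℝ × (Fin d → ℝ)) (x : Fin d → ℝ)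
    (i : Fin d) : gradY L b z x i = lossGrad L z x i - b i / z.2 i := rfl

theorem measurable_gradY {L : ℝ → ℝ → ℝ} (hL : ConvexOn ℝ Set.univ fun p : ℝ × ℝ => L p.1 p.2)
    (b : Fin d → ℝ) (i : Fin d) :
    Measurable fun p : (ℝ × (Fin d → ℝ)) × (Fin d → ℝ) => gradY L b p.1 p.2 i := by
  simp only [gradY_eq]
  exact (measurable_lossGrad hL i).sub (measurable_const.div (by fun_prop))

/-- One step of the stochastic mirror descent. -/
noncomputable def smdStep (L : ℝ → ℝ → ℝ) (b : Fin d → ℝ) (m c : ℝ) (z : ℝ × (Fin d → ℝ))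
    (x : Fin d → ℝ) : ℝ × (Fin d → ℝ) :=
  (z.1 - c * gradXi L z x, prox m z.2 fun i => c * (kap z.2 * gradY L b z x i))

theorem measurable_smdStep {L : ℝ → ℝ → ℝ}
    (hL : ConvexOn ℝ Set.univ fun p : ℝ × ℝ => L p.1 p.2) (b : Fin d → ℝ) (m c : ℝ) :
    Measurable fun p : (ℝ × (Fin d → ℝ)) × (Fin d → ℝ) => smdStep L b m c p.1 p.2 := by
  refine (measurable_fst.fst.sub ((measurable_gradXi hL).const_mul c)).prodMk
    ((measurable_prox m).comp (measurable_fst.snd.prodMk (measurable_pi_lambda _ fun i => ?_)))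
  exact ((measurable_kap.comp measurable_fst.snd).mul (measurable_gradY hL b i)).const_mul c

/-- The tamed barrier part of each coordinate is at most `1` in absolute value; the summand `1` in
`noise` pays for it. -/
theorem sq_add_sum_sq_le_noise [Nonempty (Fin d)] {L : ℝ → ℝ → ℝ} {b : Fin d → ℝ}
    (hb : ∀ i, 0 < b i) (hb1 : ∀ i, b i ≤ 1) {z : ℝ × (Fin d → ℝ)} (hz : z.2 ∈ posOrthant d)
    (x : Fin d → ℝ) (c : ℝ) :
    (c * gradXi L z x) ^ 2 + ∑ i, (c * (kap z.2 * gradY L b z x i)) ^ 2 ≤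
      (2 + 2 * d) * (c ^ 2 * noise L z x) := by
  have hk := kap_pos hz
  have h1 : ∀ i, (kap z.2 * gradY L b z x i) ^ 2 ≤ 2 * lossGrad L z x i ^ 2 + 2 := fun i => by
    rw [gradY_eq, mul_sub]
    have h2 : 0 ≤ kap z.2 * (b i / z.2 i) := by
      have := hb i; have := hz i; positivity
    have h3 : kap z.2 * (b i / z.2 i) ≤ 1 := by
      rw [← mul_div_assoc, div_le_one (hz i)]
      nlinarith [kap_le_apply z.2 i, hb1 i, hb i]
    have h4 : (kap z.2 * lossGrad L z x i) ^ 2 ≤ lossGrad L z x i ^ 2 := by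
      rw [mul_pow]
      exact mul_le_of_le_one_left (sq_nonneg _) (pow_le_one₀ hk.le (kap_le_one _))
    nlinarith [sq_nonneg (kap z.2 * lossGrad L z x i + kap z.2 * (b i / z.2 i))]
  have h2 : ∑ i, (kap z.2 * gradY L b z x i) ^ 2 ≤ 2 * ∑ i, lossGrad L z x i ^ 2 + 2 * d := by
    refine (Finset.sum_le_sum fun i _ => h1 i).trans (le_of_eq ?_)
    rw [Finset.sum_add_distrib, ← Finset.mul_sum]
    simp [mul_comm]
  have h3 : ∑ i, (c * (kap z.2 * gradY L b z x i)) ^ 2 =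
      c ^ 2 * ∑ i, (kap z.2 * gradY L b z x i) ^ 2 := by
    rw [Finset.mul_sum]
    exact Finset.sum_congr rfl fun i _ => by ring
  have h4 : 0 ≤ ∑ i, lossGrad L z x i ^ 2 := Finset.sum_nonneg fun i _ => sq_nonneg _
  rw [h3, mul_pow, ← mul_add, mul_left_comm]
  refine mul_le_mul_of_nonneg_left ?_ (sq_nonneg c)
  have h5 := one_le_noise L z x
  have h6 : (0 : ℝ) ≤ d := Nat.cast_nonneg d
  have h7 : gradXi L z x ^ 2 + ∑ i, lossGrad L z x i ^ 2 ≤ noise L z x := by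
    unfold noise; linarith
  nlinarith [sq_nonneg (gradXi L z x)]

/-- The fluctuation of a linear form of the stochastic gradient. -/
noncomputable def fluctuation (L : ℝ → ℝ → ℝ) (p : ℝ × (Fin d → ℝ) → ℝ)
    (q : ℝ × (Fin d → ℝ) → Fin d → ℝ) (α : ℝ × (Fin d → ℝ) → ℝ)
    (β : ℝ × (Fin d → ℝ) → Fin d → ℝ) (z : ℝ × (Fin d → ℝ)) (x : Fin d → ℝ) : ℝ :=
  α z * (gradXi L z x - p z) + ∑ i, β z i * (kap z.2 * (lossGrad L z x i - q z i))

theorem measurable_fluctuation {L : ℝ → ℝ → ℝ}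
    (hL : ConvexOn ℝ Set.univ fun p : ℝ × ℝ => L p.1 p.2) {p α : ℝ × (Fin d → ℝ) → ℝ}
    {q β : ℝ × (Fin d → ℝ) → Fin d → ℝ} (hp : Measurable p) (hq : ∀ i, Measurable fun z => q z i)
    (hα : Measurable α) (hβ : ∀ i, Measurable fun z => β z i) :
    Measurable fun w : (ℝ × (Fin d → ℝ)) × (Fin d → ℝ) => fluctuation L p q α β w.1 w.2 := by
  refine ((hα.comp measurable_fst).mul
    ((measurable_gradXi hL).sub (hp.comp measurable_fst))).add
    (Finset.measurable_sum _ fun i _ => ((hβ i).comp measurable_fst).mul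
      ((measurable_kap.comp measurable_fst.snd).mul ((measurable_lossGrad hL i).sub
        ((hq i).comp measurable_fst))))

section Lyapunov

variable {b : Fin d → ℝ} {m B C : ℝ} {f p : ℝ × (Fin d → ℝ) → ℝ}
  {q : ℝ × (Fin d → ℝ) → Fin d → ℝ} {zs : ℝ × (Fin d → ℝ)} {W α : ℝ × (Fin d → ℝ) → ℝ}
  {β : ℝ × (Fin d → ℝ) → Fin d → ℝ} {L : ℝ → ℝ → ℝ}

theorem IsLyapunov.W_nonneg (hW : IsLyapunov b m f p q zs W α β C)
    (hM : GradientModel b m B f p q zs) {z : ℝ × (Fin d → ℝ)} (hz : z ∈ feasible d m) :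
    0 ≤ W z := by
  have h1 := hW.lower z hz
  have h2 := DF_nonneg hM.zs_mem.1 hz.1
  nlinarith [sq_nonneg (z.1 - zs.1)]

/-- The stochastic gradient is split into its mean and its fluctuation. The mean produces the drift
inequality; the barrier term is deterministic and belongs to the mean. -/
theorem IsLyapunov.step_le (hW : IsLyapunov b m f p q zs W α β C)
    (hM : GradientModel b m B f p q zs) {z : ℝ × (Fin d → ℝ)} (hz : z ∈ feasible d m)
    (x : Fin d → ℝ) {c : ℝ} (hc : 0 ≤ c) :
    W (smdStep L b m c z x) ≤ W z - c * (√(kap z.2) * (logBarrier b f z - logBarrier b f zs)) -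
      c * fluctuation L p q α β z x + C * (2 + 2 * d) * (c ^ 2 * noise L z x) := by
  have := hM.nonempty
  have h1 := hW.step z hz (c * gradXi L z x) fun i => c * (kap z.2 * gradY L b z x i)
  have h2 := mul_le_mul_of_nonneg_left
    (sq_add_sum_sq_le_noise (L := L) hM.b_pos hM.b_le_one hz.1 x c) hW.nonneg
  have h3 := mul_le_mul_of_nonneg_left (hW.drift z hz) hc
  have h4 : α z * (c * gradXi L z x) + ∑ i, β z i * (c * (kap z.2 * gradY L b z x i)) =
      c * fluctuation L p q α β z x +
        c * (α z * p z + ∑ i, β z i * (kap z.2 * (q z i - b i / z.2 i))) := by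
    simp only [fluctuation, gradY_eq, mul_add, Finset.mul_sum]
    have : ∑ i, β z i * (c * (kap z.2 * (lossGrad L z x i - b i / z.2 i))) =
        ∑ i, c * (β z i * (kap z.2 * (lossGrad L z x i - q z i))) +
          ∑ i, c * (β z i * (kap z.2 * (q z i - b i / z.2 i))) := by
      rw [← Finset.sum_add_distrib]
      exact Finset.sum_congr rfl fun i _ => by ring
    rw [this]
    ring
  rw [h4] at h1
  have h5 : smdStep L b m c z x =
    (z.1 - c * gradXi L z x, prox m z.2 fun i => c * (kap z.2 * gradY L b z x i)) := rfl
  rw [h5]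
  linarith

theorem IsLyapunov.abs_fluctuation_le (hW : IsLyapunov b m f p q zs W α β C)
    (hM : GradientModel b m B f p q zs) {z : ℝ × (Fin d → ℝ)} (hz : z ∈ feasible d m)
    (x : Fin d → ℝ) : |fluctuation L p q α β z x| ≤
      C * (1 + d) * (1 + B) * ((1 + |z.1 - zs.1|) * √(noise L z x)) := by
  have := hM.nonempty
  have hB := hM.B_nonneg
  have hC := hW.nonneg
  set s := √(noise L z x) with hs
  have hs1 : 1 ≤ s := Real.one_le_sqrt.2 (one_le_noise L z x)
  have hbd : ∀ {u v : ℝ}, |u| ≤ s → |v| ≤ B → |u - v| ≤ (1 + B) * s := fun {u v} hu hv => by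
    have := abs_sub u v
    nlinarith
  have ht := abs_nonneg (z.1 - zs.1)
  have h1 : |α z * (gradXi L z x - p z)| ≤ C * (1 + |z.1 - zs.1|) * ((1 + B) * s) := by
    rw [abs_mul]
    exact mul_le_mul (hW.bound_α z hz)
      (hbd (abs_gradXi_le_sqrt_noise L z x) (hM.bound_p z hz)) (abs_nonneg _) (by positivity)
  have h2 : ∀ i, |β z i * (kap z.2 * (lossGrad L z x i - q z i))| ≤
      C * (1 + |z.1 - zs.1|) * ((1 + B) * s) := fun i => by
    rw [abs_mul, abs_mul, abs_of_pos (kap_pos hz.1)]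
    have h3 := hbd (abs_lossGrad_le_sqrt_noise L z x i) (hM.bound_q z hz i)
    have h4 := mul_le_of_le_one_left (abs_nonneg (lossGrad L z x i - q z i)) (kap_le_one z.2)
    refine mul_le_mul ((hW.bound_β z hz i).trans ?_) (h4.trans h3)
      (mul_nonneg (kap_pos hz.1).le (abs_nonneg _)) (by positivity)
    nlinarith
  have h3 : |∑ i, β z i * (kap z.2 * (lossGrad L z x i - q z i))| ≤
      d * (C * (1 + |z.1 - zs.1|) * ((1 + B) * s)) := by
    refine (Finset.abs_sum_le_sum_abs _ _).trans ((Finset.sum_le_sum fun i _ => h2 i).trans ?_)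
    simp
  refine (abs_add_le _ _).trans ((add_le_add h1 h3).trans (le_of_eq ?_))
  ring

end Lyapunov

/-! ### Moments of the iterates and the fluctuation martingale -/

/-- The data of the stochastic mirror descent: a gradient model for the expected loss, square
summable steps, and independent samples. -/
structure SMDModel {Ω : Type*} [MeasurableSpace Ω] (P : Measure Ω) (X : Ω → Fin d → ℝ)
    (L : ℝ → ℝ → ℝ) (b : Fin d → ℝ) (m B : ℝ) (zs : ℝ × (Fin d → ℝ)) (γ : ℕ → ℝ)
    (z₀ : Ω → ℝ × (Fin d → ℝ)) (Xs : ℕ → Ω → Fin d → ℝ) : Prop where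
  measurable_X : Measurable X
  convexOn : ConvexOn ℝ Set.univ fun p : ℝ × ℝ => L p.1 p.2
  regular : LossRegular P X L
  moment : SecondMomentBound P X L m
  model : GradientModel b m B (meanLoss P X L) (meanXi P X L) (meanGrad P X L) zs
  γ_pos : ∀ k, 0 < γ (k + 1)
  summable_sq : Summable fun k => γ (k + 1) ^ 2
  measurable_z₀ : Measurable z₀
  z₀_mem : ∀ ω, z₀ ω ∈ feasible d m
  measurable_Xs : ∀ k, Measurable (Xs k)
  sampling : Sampling P X z₀ Xs

namespace SMDModel

variable {Ω : Type*} [mΩ : MeasurableSpace Ω] {P : Measure Ω}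
  {X : Ω → Fin d → ℝ} {L : ℝ → ℝ → ℝ} {b : Fin d → ℝ} {m B C : ℝ} {zs : ℝ × (Fin d → ℝ)}
  {γ : ℕ → ℝ} {z₀ : Ω → ℝ × (Fin d → ℝ)} {Xs : ℕ → Ω → Fin d → ℝ}
  {W α : ℝ × (Fin d → ℝ) → ℝ} {β : ℝ × (Fin d → ℝ) → Fin d → ℝ}

/-- The filtration generated by the initial point and the samples. -/
abbrev filtration (hS : SMDModel P X L b m B zs γ z₀ Xs) : Filtration ℕ mΩ :=
  natFiltration z₀ hS.measurable_z₀ Xs hS.measurable_Xs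

theorem smd_mem (hS : SMDModel P X L b m B zs γ z₀ Xs) (k : ℕ) (ω : Ω) :
    smd L b m γ z₀ Xs k ω ∈ feasible d m := by
  have := hS.model.nonempty
  induction k with
  | zero => exact hS.z₀_mem ω
  | succ k ih =>
    exact ⟨prox_mem_posOrthant hS.model.m_pos ih.1 _, l1_prox_le hS.model.m_pos ih.1 _⟩

theorem measurable_z₀_filtration (hS : SMDModel P X L b m B zs γ z₀ Xs) :
    Measurable[hS.filtration 0] z₀ :=
  (comap_measurable z₀).mono le_sup_left le_rfl

theorem measurable_Xs_filtration (hS : SMDModel P X L b m B zs γ z₀ Xs) (k : ℕ) :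
    Measurable[hS.filtration (k + 1)] (Xs (k + 1)) := by
  refine (comap_measurable (Xs (k + 1))).mono (le_sup_of_le_right ?_) le_rfl
  exact le_iSup₂_of_le (f := fun j (_ : j ∈ Finset.Icc 1 (k + 1)) =>
    MeasurableSpace.comap (Xs j) inferInstance) (k + 1) (Finset.mem_Icc.2 ⟨by omega, le_rfl⟩) le_rfl

theorem measurable_smd (hS : SMDModel P X L b m B zs γ z₀ Xs) (k : ℕ) :
    Measurable[hS.filtration k] (smd L b m γ z₀ Xs k) := by
  induction k with
  | zero => exact hS.measurable_z₀_filtration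
  | succ k ih =>
    exact (measurable_smdStep hS.convexOn b m (γ (k + 1))).comp
      ((ih.mono (hS.filtration.mono (Nat.le_succ k)) le_rfl).prodMk (hS.measurable_Xs_filtration k))

theorem map_Xs (hS : SMDModel P X L b m B zs γ z₀ Xs) (k : ℕ) :
    P.map (Xs (k + 1)) = P.map X :=
  (hS.sampling.identDistrib k).map_eq

/-- The size of the stochastic gradient at step `k + 1`. -/
noncomputable def noiseAt (L : ℝ → ℝ → ℝ) (b : Fin d → ℝ) (m : ℝ) (γ : ℕ → ℝ)
    (z₀ : Ω → ℝ × (Fin d → ℝ)) (Xs : ℕ → Ω → Fin d → ℝ) (k : ℕ) (ω : Ω) : ℝ :=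
  noise L (smd L b m γ z₀ Xs k ω) (Xs (k + 1) ω)

/-- The fluctuation of the linear form `(α, β)` at step `k + 1`. -/
noncomputable def fluctuationAt (P : Measure Ω) (X : Ω → Fin d → ℝ) (L : ℝ → ℝ → ℝ)
    (b : Fin d → ℝ) (m : ℝ) (γ : ℕ → ℝ)
    (z₀ : Ω → ℝ × (Fin d → ℝ)) (Xs : ℕ → Ω → Fin d → ℝ) (α : ℝ × (Fin d → ℝ) → ℝ)
    (β : ℝ × (Fin d → ℝ) → Fin d → ℝ) (k : ℕ) (ω : Ω) : ℝ :=
  fluctuation L (meanXi P X L) (meanGrad P X L) α β (smd L b m γ z₀ Xs k ω) (Xs (k + 1) ω)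

theorem measurable_noiseAt (hS : SMDModel P X L b m B zs γ z₀ Xs) (k : ℕ) :
    Measurable[hS.filtration (k + 1)] (noiseAt L b m γ z₀ Xs k) := by
  have h : Measurable[hS.filtration (k + 1)] fun ω => (smd L b m γ z₀ Xs k ω, Xs (k + 1) ω) :=
    ((hS.measurable_smd k).mono (hS.filtration.mono (Nat.le_succ k)) le_rfl).prodMk
      (hS.measurable_Xs_filtration k)
  have h1 := (measurable_noise (L := L) hS.convexOn).comp h
  simp only [Function.comp_def] at h1
  unfold noiseAt
  exact h1

variable [IsProbabilityMeasure P]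

theorem measurable_meanXi (hS : SMDModel P X L b m B zs γ z₀ Xs) : Measurable (meanXi P X L) :=
  (StronglyMeasurable.integral_prod_right' (ν := P) (f := fun w : (ℝ × (Fin d → ℝ)) × Ω =>
    gradXi L w.1 (X w.2)) ((measurable_gradXi hS.convexOn).comp (measurable_fst.prodMk
      (hS.measurable_X.comp measurable_snd))).stronglyMeasurable).measurable

theorem measurable_meanGrad (hS : SMDModel P X L b m B zs γ z₀ Xs) (i : Fin d) :
    Measurable fun z => meanGrad P X L z i :=
  (StronglyMeasurable.integral_prod_right' (ν := P) (f := fun w : (ℝ × (Fin d → ℝ)) × Ω =>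
    lossGrad L w.1 (X w.2) i) ((measurable_lossGrad hS.convexOn i).comp (measurable_fst.prodMk
      (hS.measurable_X.comp measurable_snd))).stronglyMeasurable).measurable

theorem measurable_fluctuation (hS : SMDModel P X L b m B zs γ z₀ Xs) (hα : Measurable α)
    (hβ : ∀ i, Measurable fun z => β z i) :
    Measurable fun w : (ℝ × (Fin d → ℝ)) × (Fin d → ℝ) =>
      fluctuation L (meanXi P X L) (meanGrad P X L) α β w.1 w.2 :=
  RiskBudgeting.measurable_fluctuation hS.convexOn hS.measurable_meanXi hS.measurable_meanGrad hα hβ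

theorem measurable_fluctuationAt (hS : SMDModel P X L b m B zs γ z₀ Xs) (hα : Measurable α)
    (hβ : ∀ i, Measurable fun z => β z i) (k : ℕ) :
    Measurable[hS.filtration (k + 1)] (fluctuationAt P X L b m γ z₀ Xs α β k) :=
  (hS.measurable_fluctuation hα hβ).comp
    (((hS.measurable_smd k).mono (hS.filtration.mono (Nat.le_succ k)) le_rfl).prodMk
      (hS.measurable_Xs_filtration k))

theorem exists_lintegral_noise_le (hS : SMDModel P X L b m B zs γ z₀ Xs) :
    ∃ N : ℝ≥0, ∀ z ∈ feasible d m, ∫⁻ v, ENNReal.ofReal (noise L z v) ∂(P.map X) ≤ N := by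
  have := hS.model.nonempty
  obtain ⟨K, hK⟩ := hS.moment.exists_bound
  refine ⟨1 + K + d * K, fun z hz => ?_⟩
  have hm : Measurable fun v => ENNReal.ofReal (noise L z v) :=
    ((measurable_noise hS.convexOn).comp measurable_prodMk_left).ennreal_ofReal
  rw [lintegral_map hm hS.measurable_X]
  have h1 : ∀ ω, ENNReal.ofReal (noise L z (X ω)) = 1 + ENNReal.ofReal (gradXi L z (X ω) ^ 2) +
      ∑ i, ENNReal.ofReal (lossGrad L z (X ω) i ^ 2) := fun ω => by
    unfold noise
    rw [ENNReal.ofReal_add (by positivity) (Finset.sum_nonneg fun i _ => sq_nonneg _),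
      ENNReal.ofReal_add zero_le_one (sq_nonneg _), ENNReal.ofReal_one,
      ENNReal.ofReal_sum_of_nonneg fun i _ => sq_nonneg _]
  have m1 := ((measurable_gradXi_right hS.convexOn hS.measurable_X z).pow_const 2).ennreal_ofReal
  have m2 : ∀ i, Measurable fun ω => ENNReal.ofReal (lossGrad L z (X ω) i ^ 2) := fun i =>
    ((measurable_lossGrad_right hS.convexOn hS.measurable_X z i).pow_const 2).ennreal_ofReal
  simp only [h1]
  rw [lintegral_add_right _ (Finset.measurable_sum _ fun i _ => m2 i), lintegral_add_right _ m1,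
    lintegral_finsetSum _ fun i _ => m2 i]
  push_cast
  refine add_le_add (add_le_add (by simp) (hK z hz).1)
    ((Finset.sum_le_sum fun i _ => (hK z hz).2 i).trans (by simp))

/-- A bound on the conditional expectation of the noise, with a weight. -/
theorem integrable_mul_noiseAt (hS : SMDModel P X L b m B zs γ z₀ Xs) {N : ℝ≥0}
    (hN : ∀ z ∈ feasible d m, ∫⁻ v, ENNReal.ofReal (noise L z v) ∂(P.map X) ≤ N) (k : ℕ)
    {c : Ω → ℝ} (hc : Measurable[hS.filtration k] c) (hc0 : ∀ ω, 0 ≤ c ω) (hci : Integrable c P) :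
    Integrable (fun ω => c ω * noiseAt L b m γ z₀ Xs k ω) P ∧
      ∫ ω, c ω * noiseAt L b m γ z₀ Xs k ω ∂P ≤ N * ∫ ω, c ω ∂P := by
  have hle := hS.filtration.le k
  have hZ := hc.prodMk (hS.measurable_smd k)
  have hind : IndepFun (fun ω => (c ω, smd L b m γ z₀ Xs k ω)) (Xs (k + 1)) P := by
    rw [IndepFun_iff_Indep]
    exact indep_of_indep_of_le_left (hS.sampling.indep_next hS.measurable_z₀ hS.measurable_Xs k)
      hZ.comap_le
  have hφ : Measurable fun w : (ℝ × (ℝ × (Fin d → ℝ))) × (Fin d → ℝ) =>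
      ENNReal.ofReal (w.1.1) * ENNReal.ofReal (noise L w.1.2 w.2) :=
    (measurable_fst.fst.ennreal_ofReal).mul
      (((measurable_noise hS.convexOn).comp (measurable_fst.snd.prodMk
        measurable_snd)).ennreal_ofReal)
  have h1 := lintegral_comp_of_indepFun (hZ.mono hle le_rfl) (hS.measurable_Xs (k + 1)) hind hφ
  have hnm : Measurable (noiseAt L b m γ z₀ Xs k) :=
    (hS.measurable_noiseAt k).mono (hS.filtration.le _) le_rfl
  have hn0 : ∀ ω, 0 ≤ noiseAt L b m γ z₀ Xs k ω := fun ω =>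
    zero_le_one.trans (one_le_noise L _ _)
  have hmeas : AEStronglyMeasurable (fun ω => c ω * noiseAt L b m γ z₀ Xs k ω) P :=
    ((hc.mono hle le_rfl).mul hnm).aestronglyMeasurable
  have h2 : ∫⁻ ω, ENNReal.ofReal (c ω * noiseAt L b m γ z₀ Xs k ω) ∂P ≤
      N * ∫⁻ ω, ENNReal.ofReal (c ω) ∂P := by
    calc ∫⁻ ω, ENNReal.ofReal (c ω * noiseAt L b m γ z₀ Xs k ω) ∂P
        = ∫⁻ ω, ENNReal.ofReal (c ω) *
            ENNReal.ofReal (noise L (smd L b m γ z₀ Xs k ω) (Xs (k + 1) ω)) ∂P :=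
          lintegral_congr fun ω => ENNReal.ofReal_mul (hc0 ω)
      _ = ∫⁻ ω, ∫⁻ v, ENNReal.ofReal (c ω) *
            ENNReal.ofReal (noise L (smd L b m γ z₀ Xs k ω) v) ∂(P.map (Xs (k + 1))) ∂P := h1
      _ ≤ ∫⁻ ω, N * ENNReal.ofReal (c ω) ∂P := by
          refine lintegral_mono fun ω => ?_
          rw [hS.map_Xs, lintegral_const_mul' _ _ ENNReal.ofReal_ne_top, mul_comm]
          gcongr
          exact hN _ (hS.smd_mem k ω)
      _ = _ := lintegral_const_mul' _ _ ENNReal.coe_ne_top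
  have hfin : ∫⁻ ω, ENNReal.ofReal (c ω) ∂P = ENNReal.ofReal (∫ ω, c ω ∂P) :=
    (ofReal_integral_eq_lintegral_ofReal hci (Eventually.of_forall hc0)).symm
  have hint : Integrable (fun ω => c ω * noiseAt L b m γ z₀ Xs k ω) P := by
    refine ⟨hmeas, ?_⟩
    rw [hasFiniteIntegral_iff_ofReal (Eventually.of_forall fun ω => mul_nonneg (hc0 ω) (hn0 ω))]
    refine h2.trans_lt ?_
    rw [hfin]
    exact ENNReal.mul_lt_top ENNReal.coe_lt_top ENNReal.ofReal_lt_top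
  refine ⟨hint, ?_⟩
  rw [← ENNReal.ofReal_le_ofReal_iff (mul_nonneg N.coe_nonneg (integral_nonneg hc0)),
    ofReal_integral_eq_lintegral_ofReal hint
      (Eventually.of_forall fun ω => mul_nonneg (hc0 ω) (hn0 ω)), ENNReal.ofReal_mul N.coe_nonneg, ← hfin]
  simpa using h2

theorem integral_fluctuation_eq_zero (hS : SMDModel P X L b m B zs γ z₀ Xs)
    {z : ℝ × (Fin d → ℝ)} (hz : z.2 ∈ posOrthant d) :
    ∫ v, fluctuation L (meanXi P X L) (meanGrad P X L) α β z v ∂(P.map X) = 0 := by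
  have m1 : Measurable fun v => gradXi L z v := measurable_gradXi_right hS.convexOn measurable_id z
  have m2 : ∀ i, Measurable fun v => lossGrad L z v i := fun i =>
    measurable_lossGrad_right hS.convexOn measurable_id z i
  have hm : Measurable fun v => fluctuation L (meanXi P X L) (meanGrad P X L) α β z v := by
    unfold fluctuation
    fun_prop
  have i1 := hS.regular.integrable_gradXi hS.measurable_X hS.convexOn hz
  have i2 := fun i => hS.regular.integrable_lossGrad hS.measurable_X hS.convexOn hz i
  have j1 : Integrable (fun ω => α z * (gradXi L z (X ω) - meanXi P X L z)) P :=
    (i1.sub (integrable_const _)).const_mul _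
  have j2 : ∀ i ∈ Finset.univ, Integrable (fun ω => β z i * (kap z.2 *
      (lossGrad L z (X ω) i - meanGrad P X L z i))) P := fun i _ =>
    (((i2 i).sub (integrable_const _)).const_mul _).const_mul _
  rw [integral_map hS.measurable_X.aemeasurable hm.aestronglyMeasurable]
  unfold fluctuation
  rw [integral_add j1 (integrable_finsetSum _ j2), integral_finsetSum _ j2]
  simp only [integral_const_mul]
  rw [integral_sub i1 (integrable_const _)]
  have e1 : ∫ ω, gradXi L z (X ω) ∂P - ∫ _, meanXi P X L z ∂P = 0 := by simp [meanXi]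
  have e2 : ∀ i, ∫ ω, (lossGrad L z (X ω) i - meanGrad P X L z i) ∂P = 0 := fun i => by
    rw [integral_sub (i2 i) (integrable_const _)]
    simp [meanGrad]
  rw [e1]
  simp [e2]

theorem condExp_mul_fluctuationAt (hS : SMDModel P X L b m B zs γ z₀ Xs) (hα : Measurable α)
    (hβ : ∀ i, Measurable fun z => β z i) (k : ℕ) {a : Ω → ℝ}
    (ha : Measurable[hS.filtration k] a)
    (hint : Integrable (fun ω => a ω * fluctuationAt P X L b m γ z₀ Xs α β k ω) P) :
    P[fun ω => a ω * fluctuationAt P X L b m γ z₀ Xs α β k ω | hS.filtration k] =ᵐ[P] 0 := by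
  have hφ : Measurable fun w : (ℝ × (ℝ × (Fin d → ℝ))) × (Fin d → ℝ) =>
      w.1.1 * fluctuation L (meanXi P X L) (meanGrad P X L) α β w.1.2 w.2 :=
    measurable_fst.fst.mul ((hS.measurable_fluctuation hα hβ).comp
      (measurable_fst.snd.prodMk measurable_snd))
  have h1 := condExp_comp_of_indep (hS.filtration.le k) (ha.prodMk (hS.measurable_smd k))
    (hS.measurable_Xs (k + 1))
    (hS.sampling.indep_next hS.measurable_z₀ hS.measurable_Xs k) hφ hint
  refine h1.trans (Eventually.of_forall fun ω => ?_)
  simp only [integral_const_mul, hS.map_Xs]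
  rw [hS.integral_fluctuation_eq_zero (hS.smd_mem k ω).1, mul_zero]
  rfl

end SMDModel

namespace SMDModel

variable {Ω : Type*} [mΩ : MeasurableSpace Ω] {P : Measure Ω}
  {X : Ω → Fin d → ℝ} {L : ℝ → ℝ → ℝ} {b : Fin d → ℝ} {m B C : ℝ} {zs : ℝ × (Fin d → ℝ)}
  {γ : ℕ → ℝ} {z₀ : Ω → ℝ × (Fin d → ℝ)} {Xs : ℕ → Ω → Fin d → ℝ}
  {W α : ℝ × (Fin d → ℝ) → ℝ} {β : ℝ × (Fin d → ℝ) → Fin d → ℝ} {a : Ω → ℝ}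

/-- The tamed optimality gap at step `k`. -/
noncomputable def gapAt (P : Measure Ω) (X : Ω → Fin d → ℝ) (L : ℝ → ℝ → ℝ)
    (b : Fin d → ℝ) (m : ℝ) (zs : ℝ × (Fin d → ℝ)) (γ : ℕ → ℝ)
    (z₀ : Ω → ℝ × (Fin d → ℝ)) (Xs : ℕ → Ω → Fin d → ℝ) (k : ℕ) (ω : Ω) : ℝ :=
  √(kap (smd L b m γ z₀ Xs k ω).2) * (logBarrier b (meanLoss P X L) (smd L b m γ z₀ Xs k ω) -
    logBarrier b (meanLoss P X L) zs)

theorem gapAt_nonneg (hS : SMDModel P X L b m B zs γ z₀ Xs) (k : ℕ) (ω : Ω) :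
    0 ≤ gapAt P X L b m zs γ z₀ Xs k ω :=
  mul_nonneg (Real.sqrt_nonneg _) (sub_nonneg.2 (hS.model.le_logBarrier (hS.smd_mem k ω).1))

theorem W_smd_succ_le (hS : SMDModel P X L b m B zs γ z₀ Xs)
    (hW : IsLyapunov b m (meanLoss P X L) (meanXi P X L) (meanGrad P X L) zs W α β C)
    (k : ℕ) (ω : Ω) :
    W (smd L b m γ z₀ Xs (k + 1) ω) ≤ W (smd L b m γ z₀ Xs k ω) -
      γ (k + 1) * gapAt P X L b m zs γ z₀ Xs k ω -
      γ (k + 1) * fluctuationAt P X L b m γ z₀ Xs α β k ω +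
      C * (2 + 2 * d) * (γ (k + 1) ^ 2 * noiseAt L b m γ z₀ Xs k ω) :=
  hW.step_le hS.model (hS.smd_mem k ω) _ (hS.γ_pos k).le

theorem measurable_W_smd (hS : SMDModel P X L b m B zs γ z₀ Xs) (hW : Measurable W) (k : ℕ) :
    Measurable[hS.filtration k] fun ω => W (smd L b m γ z₀ Xs k ω) :=
  hW.comp (hS.measurable_smd k)

variable [IsProbabilityMeasure P]

/-- The linear part grows at most linearly in `t = |ξ - ξ⋆|`, and `(1 + t)² ≤ 2 + 4 W`. The second
moment of the fluctuation is thus controlled by that of the weighted `W`. The weight replaces a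
moment assumption on the initial point. -/
theorem memLp_mul_fluctuationAt (hS : SMDModel P X L b m B zs γ z₀ Xs)
    (hW : IsLyapunov b m (meanLoss P X L) (meanXi P X L) (meanGrad P X L) zs W α β C)
    {N : ℝ≥0} (hN : ∀ z ∈ feasible d m, ∫⁻ v, ENNReal.ofReal (noise L z v) ∂(P.map X) ≤ N)
    (k : ℕ) (ha : Measurable[hS.filtration k] a) (ha0 : ∀ ω, 0 ≤ a ω) (ha1 : ∀ ω, a ω ≤ 1)
    (hint : Integrable (fun ω => a ω ^ 2 * W (smd L b m γ z₀ Xs k ω)) P) :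
    MemLp (fun ω => a ω * fluctuationAt P X L b m γ z₀ Xs α β k ω) 2 P ∧
      ∫ ω, (a ω * fluctuationAt P X L b m γ z₀ Xs α β k ω) ^ 2 ∂P ≤
        (C * (1 + d) * (1 + B)) ^ 2 *
          (N * (2 + 4 * ∫ ω, a ω ^ 2 * W (smd L b m γ z₀ Xs k ω) ∂P)) := by
  set K := C * (1 + d) * (1 + B) with hK
  have ham : Measurable a := ha.mono (hS.filtration.le k) le_rfl
  have hsq1 : ∀ ω, a ω ^ 2 ≤ 1 := fun ω => pow_le_one₀ (ha0 ω) (ha1 ω)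
  have ha2 : Integrable (fun ω => a ω ^ 2) P :=
    Integrable.of_bound (ham.pow_const 2).aestronglyMeasurable 1 (Eventually.of_forall fun ω => by
      rw [Real.norm_of_nonneg (sq_nonneg _)]; exact hsq1 ω)
  have hci : Integrable (fun ω => 2 * a ω ^ 2 + 4 * (a ω ^ 2 * W (smd L b m γ z₀ Xs k ω))) P :=
    (ha2.const_mul 2).add (hint.const_mul 4)
  have hW0 : ∀ ω, 0 ≤ W (smd L b m γ z₀ Xs k ω) := fun ω =>
    hW.W_nonneg hS.model (hS.smd_mem k ω)
  obtain ⟨h1, h2⟩ := hS.integrable_mul_noiseAt hN k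
    (c := fun ω => 2 * a ω ^ 2 + 4 * (a ω ^ 2 * W (smd L b m γ z₀ Xs k ω)))
    (((ha.pow_const 2).const_mul 2).add
      (((ha.pow_const 2).mul (hS.measurable_W_smd hW.measurable_W k)).const_mul 4))
    (fun ω => by have := hW0 ω; positivity) hci
  have hpt : ∀ ω, (a ω * fluctuationAt P X L b m γ z₀ Xs α β k ω) ^ 2 ≤
      K ^ 2 * ((2 * a ω ^ 2 + 4 * (a ω ^ 2 * W (smd L b m γ z₀ Xs k ω))) *
        noiseAt L b m γ z₀ Xs k ω) := fun ω => by
    have hz := hS.smd_mem k ω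
    have hn : 0 ≤ noiseAt L b m γ z₀ Xs k ω := zero_le_one.trans (one_le_noise L _ _)
    have hf : |fluctuationAt P X L b m γ z₀ Xs α β k ω| ≤
        K * ((1 + |(smd L b m γ z₀ Xs k ω).1 - zs.1|) * √(noiseAt L b m γ z₀ Xs k ω)) :=
      hW.abs_fluctuation_le hS.model hz _
    set t := |(smd L b m γ z₀ Xs k ω).1 - zs.1| with ht
    have hf2 : fluctuationAt P X L b m γ z₀ Xs α β k ω ^ 2 ≤
        K ^ 2 * ((1 + t) ^ 2 * noiseAt L b m γ z₀ Xs k ω) := by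
      have := pow_le_pow_left₀ (abs_nonneg _) hf 2
      rw [sq_abs, mul_pow K, mul_pow (1 + t), Real.sq_sqrt hn] at this
      exact this
    have htW : (1 + t) ^ 2 ≤ 2 + 4 * W (smd L b m γ z₀ Xs k ω) := by
      have h3 := hW.lower _ hz
      have h4 := DF_nonneg hS.model.zs_mem.1 hz.1
      have h5 : t ^ 2 = ((smd L b m γ z₀ Xs k ω).1 - zs.1) ^ 2 := sq_abs _
      nlinarith [sq_nonneg (t - 1)]
    rw [mul_pow]
    calc a ω ^ 2 * fluctuationAt P X L b m γ z₀ Xs α β k ω ^ 2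
        ≤ a ω ^ 2 * (K ^ 2 * ((2 + 4 * W (smd L b m γ z₀ Xs k ω)) *
            noiseAt L b m γ z₀ Xs k ω)) := by
          refine mul_le_mul_of_nonneg_left (hf2.trans ?_) (sq_nonneg _)
          gcongr
      _ = _ := by ring
  have hζm : AEStronglyMeasurable (fun ω => a ω * fluctuationAt P X L b m γ z₀ Xs α β k ω) P :=
    (ham.mul ((hS.measurable_fluctuationAt hW.measurable_α hW.measurable_β k).mono
      (hS.filtration.le _) le_rfl)).aestronglyMeasurable
  have hsqi : Integrable (fun ω => (a ω * fluctuationAt P X L b m γ z₀ Xs α β k ω) ^ 2) P :=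
    (h1.const_mul (K ^ 2)).mono' (hζm.pow 2) (Eventually.of_forall fun ω => by
      rw [Real.norm_of_nonneg (sq_nonneg _)]; exact hpt ω)
  refine ⟨(memLp_two_iff_integrable_sq hζm).2 hsqi, ?_⟩
  refine (integral_mono hsqi (h1.const_mul (K ^ 2)) hpt).trans ?_
  rw [integral_const_mul]
  refine mul_le_mul_of_nonneg_left (h2.trans (mul_le_mul_of_nonneg_left ?_ N.coe_nonneg))
    (sq_nonneg _)
  rw [integral_add (ha2.const_mul 2) (hint.const_mul 4), integral_const_mul, integral_const_mul]
  have h3 : ∫ ω, a ω ^ 2 ∂P ≤ 1 := by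
    refine (integral_mono ha2 (integrable_const 1) hsq1).trans (by simp)
  linarith

/-- Induction on the Lyapunov inequality: the gap is dropped, the fluctuation has mean zero, and the
noise has bounded mean. Integrability has to be carried along, because that of the fluctuation at
step `k` rests on that of `W` at step `k`. -/
theorem integrable_sq_mul_W (hS : SMDModel P X L b m B zs γ z₀ Xs)
    (hW : IsLyapunov b m (meanLoss P X L) (meanXi P X L) (meanGrad P X L) zs W α β C)
    {N : ℝ≥0} (hN : ∀ z ∈ feasible d m, ∫⁻ v, ENNReal.ofReal (noise L z v) ∂(P.map X) ≤ N)
    (ha : Measurable[hS.filtration 0] a) (ha0 : ∀ ω, 0 ≤ a ω) (ha1 : ∀ ω, a ω ≤ 1)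
    (hint : Integrable (fun ω => a ω ^ 2 * W (z₀ ω)) P) (k : ℕ) :
    Integrable (fun ω => a ω ^ 2 * W (smd L b m γ z₀ Xs k ω)) P ∧
      ∫ ω, a ω ^ 2 * W (smd L b m γ z₀ Xs k ω) ∂P ≤
        ∫ ω, a ω ^ 2 * W (z₀ ω) ∂P +
          C * (2 + 2 * d) * N * ∑ j ∈ Finset.range k, γ (j + 1) ^ 2 := by
  induction k with
  | zero => exact ⟨hint, by simp [smd]⟩
  | succ k ih =>
    obtain ⟨ih1, ih2⟩ := ih
    have hC := hW.nonneg
    have hak : Measurable[hS.filtration k] a := ha.mono (hS.filtration.mono (Nat.zero_le k)) le_rfl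
    have ham : Measurable a := ha.mono (hS.filtration.le 0) le_rfl
    have hmem := (hS.memLp_mul_fluctuationAt hW hN k hak ha0 ha1 ih1).1
    have hsq1 : ∀ ω, a ω ^ 2 ≤ 1 := fun ω => pow_le_one₀ (ha0 ω) (ha1 ω)
    have hfi : Integrable (fun ω => a ω ^ 2 * fluctuationAt P X L b m γ z₀ Xs α β k ω) P := by
      have := (hmem.integrable (by norm_num)).bdd_mul (c := 1) ham.aestronglyMeasurable
        (Eventually.of_forall fun ω => by
          rw [Real.norm_of_nonneg (ha0 ω)]; exact ha1 ω)
      refine this.congr (Eventually.of_forall fun ω => ?_)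
      simp only
      ring
    have hf0 : ∫ ω, a ω ^ 2 * fluctuationAt P X L b m γ z₀ Xs α β k ω ∂P = 0 := by
      have h1 := hS.condExp_mul_fluctuationAt hW.measurable_α hW.measurable_β k
        (hak.pow_const 2) hfi
      have h2 := integral_condExp (μ := P)
        (f := fun ω => a ω ^ 2 * fluctuationAt P X L b m γ z₀ Xs α β k ω) (hS.filtration.le k)
      rw [integral_congr_ae h1] at h2
      simpa using h2.symm
    obtain ⟨hn1, hn2⟩ := hS.integrable_mul_noiseAt hN k (c := fun _ => 1) measurable_const
      (fun _ => zero_le_one) (integrable_const 1)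
    simp only [one_mul, integral_const, probReal_univ, smul_eq_mul, mul_one] at hn1 hn2
    have hbound : ∀ ω, a ω ^ 2 * W (smd L b m γ z₀ Xs (k + 1) ω) ≤
        a ω ^ 2 * W (smd L b m γ z₀ Xs k ω) -
          γ (k + 1) * (a ω ^ 2 * fluctuationAt P X L b m γ z₀ Xs α β k ω) +
          C * (2 + 2 * d) * γ (k + 1) ^ 2 * noiseAt L b m γ z₀ Xs k ω := fun ω => by
      have h1 := mul_le_mul_of_nonneg_left (hS.W_smd_succ_le hW k ω) (sq_nonneg (a ω))
      have h2 : 0 ≤ a ω ^ 2 * (γ (k + 1) * gapAt P X L b m zs γ z₀ Xs k ω) :=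
        mul_nonneg (sq_nonneg _) (mul_nonneg (hS.γ_pos k).le (hS.gapAt_nonneg k ω))
      have hn : 0 ≤ noiseAt L b m γ z₀ Xs k ω := zero_le_one.trans (one_le_noise L _ _)
      have h3 : a ω ^ 2 * (C * (2 + 2 * d) * (γ (k + 1) ^ 2 * noiseAt L b m γ z₀ Xs k ω)) ≤
          C * (2 + 2 * d) * (γ (k + 1) ^ 2 * noiseAt L b m γ z₀ Xs k ω) :=
        mul_le_of_le_one_left (by positivity) (hsq1 ω)
      linarith
    have hrhs : Integrable (fun ω => a ω ^ 2 * W (smd L b m γ z₀ Xs k ω) -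
          γ (k + 1) * (a ω ^ 2 * fluctuationAt P X L b m γ z₀ Xs α β k ω) +
          C * (2 + 2 * d) * γ (k + 1) ^ 2 * noiseAt L b m γ z₀ Xs k ω) P :=
      (ih1.sub (hfi.const_mul _)).add (hn1.const_mul _)
    have hWm : Measurable fun ω => W (smd L b m γ z₀ Xs (k + 1) ω) :=
      (hS.measurable_W_smd hW.measurable_W (k + 1)).mono (hS.filtration.le _) le_rfl
    have hnext : Integrable (fun ω => a ω ^ 2 * W (smd L b m γ z₀ Xs (k + 1) ω)) P := by
      refine hrhs.mono' ((ham.pow_const 2).mul hWm).aestronglyMeasurable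
        (Eventually.of_forall fun ω => ?_)
      rw [Real.norm_of_nonneg (mul_nonneg (sq_nonneg _)
        (hW.W_nonneg hS.model (hS.smd_mem (k + 1) ω)))]
      exact hbound ω
    refine ⟨hnext, (integral_mono hnext hrhs hbound).trans ?_⟩
    have i1 : Integrable (fun ω => a ω ^ 2 * W (smd L b m γ z₀ Xs k ω) -
          γ (k + 1) * (a ω ^ 2 * fluctuationAt P X L b m γ z₀ Xs α β k ω)) P :=
      ih1.sub (hfi.const_mul _)
    rw [integral_add i1 (hn1.const_mul _), integral_sub ih1 (hfi.const_mul _), integral_const_mul,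
      integral_const_mul, hf0, Finset.sum_range_succ]
    have h4 : C * (2 + 2 * d) * γ (k + 1) ^ 2 * ∫ ω, noiseAt L b m γ z₀ Xs k ω ∂P ≤
        C * (2 + 2 * d) * γ (k + 1) ^ 2 * N := mul_le_mul_of_nonneg_left hn2 (by positivity)
    linarith

/-- Weighted second moments of the iterates are bounded. -/
theorem exists_integral_sq_mul_W_le (hS : SMDModel P X L b m B zs γ z₀ Xs)
    (hW : IsLyapunov b m (meanLoss P X L) (meanXi P X L) (meanGrad P X L) zs W α β C)
    (ha : Measurable[hS.filtration 0] a) (ha0 : ∀ ω, 0 ≤ a ω) (ha1 : ∀ ω, a ω ≤ 1)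
    (hint : Integrable (fun ω => a ω ^ 2 * W (z₀ ω)) P) :
    ∃ K, ∀ k, Integrable (fun ω => a ω ^ 2 * W (smd L b m γ z₀ Xs k ω)) P ∧
      ∫ ω, a ω ^ 2 * W (smd L b m γ z₀ Xs k ω) ∂P ≤ K := by
  obtain ⟨N, hN⟩ := hS.exists_lintegral_noise_le
  have hC := hW.nonneg
  refine ⟨∫ ω, a ω ^ 2 * W (z₀ ω) ∂P + C * (2 + 2 * d) * N * ∑' j, γ (j + 1) ^ 2, fun k => ?_⟩
  obtain ⟨h1, h2⟩ := hS.integrable_sq_mul_W hW hN ha ha0 ha1 hint k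
  refine ⟨h1, h2.trans (add_le_add le_rfl (mul_le_mul_of_nonneg_left ?_ (by positivity)))⟩
  exact hS.summable_sq.sum_le_tsum _ fun j _ => sq_nonneg _

/-- The weighted sums of fluctuations form a martingale bounded in `L²`. -/
theorem martingale_fluctuation (hS : SMDModel P X L b m B zs γ z₀ Xs)
    (hW : IsLyapunov b m (meanLoss P X L) (meanXi P X L) (meanGrad P X L) zs W α β C)
    (ha : Measurable[hS.filtration 0] a) (ha0 : ∀ ω, 0 ≤ a ω) (ha1 : ∀ ω, a ω ≤ 1)
    (hint : Integrable (fun ω => a ω ^ 2 * W (z₀ ω)) P) :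
    Martingale (fun n ω => ∑ k ∈ Finset.range n,
      γ (k + 1) * (a ω * fluctuationAt P X L b m γ z₀ Xs α β k ω)) hS.filtration P ∧
    ∃ K : ℝ≥0, ∀ n, eLpNorm (fun ω => ∑ k ∈ Finset.range n,
      γ (k + 1) * (a ω * fluctuationAt P X L b m γ z₀ Xs α β k ω)) 2 P ≤ K := by
  obtain ⟨N, hN⟩ := hS.exists_lintegral_noise_le
  obtain ⟨K, hK⟩ := hS.exists_integral_sq_mul_W_le hW ha ha0 ha1 hint
  have hak : ∀ k, Measurable[hS.filtration k] a := fun k =>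
    ha.mono (hS.filtration.mono (Nat.zero_le k)) le_rfl
  have hmem := fun k => hS.memLp_mul_fluctuationAt hW hN k (hak k) ha0 ha1 (hK k).1
  have h1 : ∀ k, StronglyMeasurable[hS.filtration (k + 1)]
      fun ω => γ (k + 1) * (a ω * fluctuationAt P X L b m γ z₀ Xs α β k ω) := fun k =>
    (((hak (k + 1)).mul (hS.measurable_fluctuationAt hW.measurable_α hW.measurable_β
      k)).const_mul _).stronglyMeasurable
  have h2 : ∀ k, MemLp (fun ω => γ (k + 1) * (a ω * fluctuationAt P X L b m γ z₀ Xs α β k ω)) 2 P :=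
    fun k => (hmem k).1.const_mul _
  have h3 : ∀ k, P[fun ω => γ (k + 1) * (a ω * fluctuationAt P X L b m γ z₀ Xs α β k ω) |
      hS.filtration k] =ᵐ[P] 0 := fun k => by
    have h4 := hS.condExp_mul_fluctuationAt hW.measurable_α hW.measurable_β k
      (a := fun ω => γ (k + 1) * a ω) ((hak k).const_mul _) (by
        simp only [mul_assoc]
        exact (h2 k).integrable (by norm_num))
    simpa only [mul_assoc] using h4
  refine ⟨martingale_sum_martingaleDiff h1 h2 h3,
    exists_eLpNorm_sum_martingaleDiff_le h1 h2 h3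
      (hS.summable_sq.mul_right ((C * (1 + d) * (1 + B)) ^ 2 * (N * (2 + 4 * K)))) fun k => ?_⟩
  simp only [mul_pow]
  rw [integral_const_mul]
  refine mul_le_mul_of_nonneg_left ?_ (sq_nonneg _)
  have h5 := (hmem k).2
  simp only [mul_pow] at h5 ⊢
  refine h5.trans ?_
  have := (hK k).2
  gcongr

theorem ae_summable_sq_mul_noiseAt (hS : SMDModel P X L b m B zs γ z₀ Xs) :
    ∀ᵐ ω ∂P, Summable fun k => γ (k + 1) ^ 2 * noiseAt L b m γ z₀ Xs k ω := by
  obtain ⟨N, hN⟩ := hS.exists_lintegral_noise_le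
  have hn := fun k => hS.integrable_mul_noiseAt hN k (c := fun _ => γ (k + 1) ^ 2) measurable_const
    (fun _ => sq_nonneg _) (integrable_const _)
  have hn0 : ∀ k ω, 0 ≤ γ (k + 1) ^ 2 * noiseAt L b m γ z₀ Xs k ω := fun k ω =>
    mul_nonneg (sq_nonneg _) (zero_le_one.trans (one_le_noise L _ _))
  have hm : ∀ k, Measurable fun ω => γ (k + 1) ^ 2 * noiseAt L b m γ z₀ Xs k ω := fun k =>
    ((hS.measurable_noiseAt k).mono (hS.filtration.le _) le_rfl).const_mul _
  have h1 : ∫⁻ ω, ∑' k, ENNReal.ofReal (γ (k + 1) ^ 2 * noiseAt L b m γ z₀ Xs k ω) ∂P ≠ ∞ := by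
    rw [lintegral_tsum fun k => (hm k).ennreal_ofReal.aemeasurable]
    have h2 : ∀ k, ∫⁻ ω, ENNReal.ofReal (γ (k + 1) ^ 2 * noiseAt L b m γ z₀ Xs k ω) ∂P ≤
        ENNReal.ofReal (N * γ (k + 1) ^ 2) := fun k => by
      rw [← ofReal_integral_eq_lintegral_ofReal (hn k).1 (Eventually.of_forall (hn0 k))]
      refine ENNReal.ofReal_le_ofReal ((hn k).2.trans (by simp))
    refine ne_top_of_le_ne_top ?_ (ENNReal.tsum_le_tsum h2)
    exact (hS.summable_sq.mul_left _).tsum_ofReal_ne_top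
  filter_upwards [ae_lt_top' (AEMeasurable.tsum fun k =>
    (hm k).ennreal_ofReal.aemeasurable) h1] with ω hω
  refine (ENNReal.summable_toReal hω.ne).congr fun k => ?_
  rw [ENNReal.toReal_ofReal (hn0 k ω)]

end SMDModel

/-! ### Pathwise convergence argument -/

/-- A non-negative sequence that decreases up to a convergent series converges. -/
theorem summable_and_tendsto_of_le_sub_add {w c e : ℕ → ℝ} {l : ℝ} (hw : ∀ n, 0 ≤ w n)
    (hc : ∀ n, 0 ≤ c n) (he : Tendsto (fun n => ∑ k ∈ Finset.range n, e k) atTop (𝓝 l))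
    (h : ∀ n, w (n + 1) ≤ w n - c n + e n) :
    Summable c ∧ ∃ l', Tendsto w atTop (𝓝 l') := by
  -- This corrected sequence is nonincreasing and bounded below, as in the Robbins-Siegmund lemma.
  set T : ℕ → ℝ := fun n => w n + ∑ k ∈ Finset.range n, c k - ∑ k ∈ Finset.range n, e k with hT
  have hanti : Antitone T := antitone_nat_of_succ_le fun n => by
    simp only [hT, Finset.sum_range_succ]
    linarith [h n]
  obtain ⟨A, hA⟩ := he.bddAbove_range
  have hA' : ∀ n, ∑ k ∈ Finset.range n, e k ≤ A := fun n => hA ⟨n, rfl⟩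
  have hcs : ∀ n, 0 ≤ ∑ k ∈ Finset.range n, c k := fun n => Finset.sum_nonneg fun k _ => hc k
  have hsum : Summable c := by
    refine summable_of_sum_range_le (c := T 0 + A) hc fun n => ?_
    have h1 := hanti (Nat.zero_le n)
    have h2 := hw n
    have h3 := hA' n
    simp only [hT] at h1 ⊢
    linarith
  have hbdd : BddBelow (Set.range T) := ⟨-A, by
    rintro _ ⟨n, rfl⟩
    simp only [hT]
    linarith [hw n, hcs n, hA' n]⟩
  refine ⟨hsum, (⨅ n, T n) - ∑' k, c k + l, ?_⟩
  have h1 := ((tendsto_atTop_ciInf hanti hbdd).sub hsum.hasSum.tendsto_sum_nat).add he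
  refine h1.congr fun n => ?_
  simp only [hT]
  ring

section Deterministic

variable {b : Fin d → ℝ} {m B C : ℝ} {f p : ℝ × (Fin d → ℝ) → ℝ}
  {q : ℝ × (Fin d → ℝ) → Fin d → ℝ} {zs : ℝ × (Fin d → ℝ)} {W α : ℝ × (Fin d → ℝ) → ℝ}
  {β : ℝ × (Fin d → ℝ) → Fin d → ℝ}

theorem IsLyapunov.tendsto_of_tendsto_zero (hW : IsLyapunov b m f p q zs W α β C)
    (hM : GradientModel b m B f p q zs) {z : ℕ → ℝ × (Fin d → ℝ)} (hz : ∀ n, z n ∈ feasible d m)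
    (h : Tendsto (fun n => W (z n)) atTop (𝓝 0)) : Tendsto z atTop (𝓝 zs) := by
  have := hM.nonempty
  have hm := hM.m_pos
  have h1 : Tendsto (fun n => ((z n).1 - zs.1) ^ 2) atTop (𝓝 0) := by
    refine squeeze_zero (fun n => sq_nonneg _) (fun n => ?_) (by simpa using h.const_mul 2)
    have h2 := hW.lower _ (hz n)
    have h3 := DF_nonneg hM.zs_mem.1 (hz n).1
    linarith
  have h2 : ∀ i, Tendsto (fun n => ((z n).2 i - zs.2 i) ^ 2) atTop (𝓝 0) := fun i => by
    refine squeeze_zero (fun n => sq_nonneg _) (fun n => ?_)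
      (by simpa using h.const_mul (4 * m))
    have h3 := hW.lower _ (hz n)
    have h4 := DF_ge_sum_sq hM.zs_mem.1 (hz n).1 hM.zs_mem.2 (hz n).2
    have h5 := Finset.single_le_sum (f := fun i => (zs.2 i - (z n).2 i) ^ 2)
      (fun i _ => sq_nonneg _) (Finset.mem_univ i)
    rw [div_le_iff₀ (by positivity)] at h4
    have h6 : DF zs.2 (z n).2 ≤ W (z n) := by nlinarith [sq_nonneg ((z n).1 - zs.1)]
    have h7 := mul_le_mul_of_nonneg_right h6 (by positivity : 0 ≤ 4 * m)
    have h8 : ((z n).2 i - zs.2 i) ^ 2 = (zs.2 i - (z n).2 i) ^ 2 := by ring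
    linarith
  have key : ∀ {u : ℕ → ℝ} {l : ℝ}, Tendsto (fun n => (u n - l) ^ 2) atTop (𝓝 0) →
      Tendsto u atTop (𝓝 l) := fun {u l} hu => by
    have h3 := hu.sqrt
    simp only [Real.sqrt_sq_eq_abs, Real.sqrt_zero] at h3
    exact tendsto_iff_dist_tendsto_zero.2 h3
  exact (key h1).prodMk_nhds (tendsto_pi_nhds.2 fun i => key (h2 i))

/-- If the limit `l` of `W` were positive, the sequence would eventually stay in a compact part of
the orthant away from `zs`. The tamed gap has a positive minimum there, and summability would pass
to `s`. -/
theorem IsLyapunov.tendsto_of_summable (hW : IsLyapunov b m f p q zs W α β C)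
    (hM : GradientModel b m B f p q zs) {z : ℕ → ℝ × (Fin d → ℝ)} (hz : ∀ n, z n ∈ feasible d m)
    {l : ℝ} (hl : Tendsto (fun n => W (z n)) atTop (𝓝 l)) {s : ℕ → ℝ} (hs0 : ∀ n, 0 ≤ s n)
    (hs : ¬ Summable s)
    (hsum : Summable fun n => s n * (√(kap (z n).2) * (logBarrier b f (z n) - logBarrier b f zs))) :
    Tendsto z atTop (𝓝 zs) := by
  have := hM.nonempty
  refine hW.tendsto_of_tendsto_zero hM hz ?_
  have hl0 : 0 ≤ l := ge_of_tendsto' hl fun n => hW.W_nonneg hM (hz n)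
  rcases hl0.eq_or_lt with rfl | hlpos
  · exact hl
  exfalso
  obtain ⟨A, hA⟩ := hl.bddAbove_range
  have hA' : ∀ n, W (z n) ≤ A := fun n => hA ⟨n, rfl⟩
  obtain ⟨ε, hε, hDε⟩ := exists_pos_le_of_DF_le hM.zs_mem.1 A
  have hA0 : 0 ≤ A := (hW.W_nonneg hM (hz 0)).trans (hA' 0)
  set K := truncatedRegion zs m (1 + 2 * A) ε with hK
  have hzK : ∀ n, z n ∈ K := fun n => by
    have h1 := hW.lower _ (hz n)
    have h2 := DF_nonneg hM.zs_mem.1 (hz n).1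
    have h3 := hA' n
    refine ⟨?_, hDε _ (hz n).1 (by nlinarith [sq_nonneg ((z n).1 - zs.1)]), (hz n).2⟩
    have h4 := sq_abs ((z n).1 - zs.1)
    nlinarith [sq_nonneg (|(z n).1 - zs.1| - 1), abs_nonneg ((z n).1 - zs.1)]
  have hnb : ∀ᶠ w in 𝓝[feasible d m] zs, W w < l / 2 :=
    hW.tendsto.eventually_lt_const (half_pos hlpos)
  rw [eventually_nhdsWithin_iff] at hnb
  obtain ⟨U, hUsub, hUo, hzsU⟩ := mem_nhds_iff.1 hnb
  have hout : ∀ᶠ n in atTop, z n ∈ K \ U := by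
    filter_upwards [hl.eventually_const_lt (half_lt_self hlpos)] with n hn
    exact ⟨hzK n, fun hU => absurd (hUsub hU (hz n)) (not_lt.2 hn.le)⟩
  set G : ℝ × (Fin d → ℝ) → ℝ := fun w => √(kap w.2) * (logBarrier b f w - logBarrier b f zs)
    with hG
  have hcont : ContinuousOn G (K \ U) := by
    refine ContinuousOn.mul ?_ ?_
    · exact ((continuous_kap.comp continuous_snd).sqrt).continuousOn
    · exact (hM.continuousOn_logBarrier.mono fun w hw =>
        (truncatedRegion_subset hε hw.1).1).sub continuousOn_const
  have hcomp : IsCompact (K \ U) := (isCompact_truncatedRegion zs m _ ε).diff hUo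
  obtain ⟨n₀, hn₀⟩ := hout.exists
  obtain ⟨w, hw, hmin⟩ := hcomp.exists_isMinOn ⟨_, hn₀⟩ hcont
  have hGw : 0 < G w := by
    have hwpos := (truncatedRegion_subset hε hw.1).1
    refine mul_pos (Real.sqrt_pos.2 (kap_pos hwpos)) (sub_pos.2 (hM.lt_of_ne w hwpos ?_))
    rintro rfl
    exact hw.2 hzsU
  refine hs ?_
  have h1 : Summable fun n => s n * G w := by
    refine Summable.of_norm_bounded_eventually_nat hsum ?_
    filter_upwards [hout] with n hn
    rw [Real.norm_of_nonneg (mul_nonneg (hs0 n) hGw.le)]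
    exact mul_le_mul_of_nonneg_left (hmin hn) (hs0 n)
  exact (summable_mul_right_iff hGw.ne').1 h1

end Deterministic

/-! ### Almost sure convergence -/

namespace SMDModel

variable {Ω : Type*} [mΩ : MeasurableSpace Ω] {P : Measure Ω} [IsProbabilityMeasure P]
  {X : Ω → Fin d → ℝ} {L : ℝ → ℝ → ℝ} {b : Fin d → ℝ} {m B C : ℝ} {zs : ℝ × (Fin d → ℝ)}
  {γ : ℕ → ℝ} {z₀ : Ω → ℝ × (Fin d → ℝ)} {Xs : ℕ → Ω → Fin d → ℝ}
  {W α : ℝ × (Fin d → ℝ) → ℝ} {β : ℝ × (Fin d → ℝ) → Fin d → ℝ}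

/-- Almost sure convergence of the stochastic mirror descent. -/
theorem ae_tendsto_smd (hS : SMDModel P X L b m B zs γ z₀ Xs)
    (hγ : ¬ Summable fun n => γ (n + 1)) :
    ∀ᵐ ω ∂P, Tendsto (fun n => smd L b m γ z₀ Xs n ω) atTop (𝓝 zs) := by
  obtain ⟨W, α, β, C, hW⟩ := hS.model.exists_isLyapunov
  have hW0 : ∀ ω, 0 ≤ W (z₀ ω) := fun ω => hW.W_nonneg hS.model (hS.z₀_mem ω)
  -- No moment of `z⁰` is assumed here. The weight makes `a² W(z⁰)` bounded, keeps the martingale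
  -- property because it is `F₀`-measurable, and being positive can be divided out along each path.
  set a : Ω → ℝ := fun ω => (1 + W (z₀ ω))⁻¹ with ha
  have ham : Measurable[hS.filtration 0] a :=
    ((hW.measurable_W.comp hS.measurable_z₀_filtration).const_add 1).inv
  have hapos : ∀ ω, 0 < a ω := fun ω => by
    have := hW0 ω
    simp only [ha]; positivity
  have ha1 : ∀ ω, a ω ≤ 1 := fun ω => inv_le_one_of_one_le₀ (by linarith [hW0 ω])
  have hint : Integrable (fun ω => a ω ^ 2 * W (z₀ ω)) P := by
    refine Integrable.of_bound (C := 1) (((ham.mono (hS.filtration.le 0) le_rfl).pow_const 2).mul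
      (hW.measurable_W.comp hS.measurable_z₀)).aestronglyMeasurable
      (Eventually.of_forall fun ω => ?_)
    have h1 := hW0 ω
    rw [Real.norm_of_nonneg (by positivity)]
    have h2 : a ω * W (z₀ ω) ≤ 1 := by
      simp only [ha]
      rw [inv_mul_le_one₀ (by positivity)]
      linarith
    have h3 := mul_le_of_le_one_left (mul_nonneg (hapos ω).le h1) (ha1 ω)
    rw [sq, mul_assoc]
    linarith
  obtain ⟨hmart, hbd⟩ := hS.martingale_fluctuation hW ham (fun ω => (hapos ω).le) ha1 hint
  obtain ⟨Minf, hMinf⟩ := Martingale.exists_ae_tendsto hmart hbd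
  filter_upwards [hMinf, hS.ae_summable_sq_mul_noiseAt] with ω hω1 hω2
  have he : Tendsto (fun n => ∑ k ∈ Finset.range n,
      (-(γ (k + 1) * fluctuationAt P X L b m γ z₀ Xs α β k ω) +
        C * (2 + 2 * d) * (γ (k + 1) ^ 2 * noiseAt L b m γ z₀ Xs k ω))) atTop
      (𝓝 (-((a ω)⁻¹ * Minf ω) + C * (2 + 2 * d) *
        ∑' k, γ (k + 1) ^ 2 * noiseAt L b m γ z₀ Xs k ω)) := by
    refine ((hω1.const_mul (a ω)⁻¹).neg.add
      (hω2.hasSum.tendsto_sum_nat.const_mul (C * (2 + 2 * d)))).congr fun n => ?_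
    rw [Finset.sum_add_distrib, Finset.sum_neg_distrib, Finset.mul_sum, Finset.mul_sum]
    congr 2
    refine Finset.sum_congr rfl fun k _ => ?_
    rw [mul_left_comm, inv_mul_cancel_left₀ (hapos ω).ne']
  obtain ⟨h1, l, h2⟩ := summable_and_tendsto_of_le_sub_add
    (w := fun n => W (smd L b m γ z₀ Xs n ω))
    (c := fun n => γ (n + 1) * gapAt P X L b m zs γ z₀ Xs n ω)
    (fun n => hW.W_nonneg hS.model (hS.smd_mem n ω))
    (fun n => mul_nonneg (hS.γ_pos n).le (hS.gapAt_nonneg n ω)) he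
    (fun n => by
      have := hS.W_smd_succ_le hW n ω
      linarith)
  exact hW.tendsto_of_summable hS.model (fun n => hS.smd_mem n ω) h2
    (fun n => (hS.γ_pos n).le) hγ h1

end SMDModel

/-! ### Weighted averages and the pathwise rate -/

theorem sum_Icc_one_eq_sum_range {M : Type*} [AddCommMonoid M] (F : ℕ → M) (n : ℕ) :
    ∑ k ∈ Finset.Icc 1 n, F k = ∑ k ∈ Finset.range n, F (k + 1) := by
  induction n with
  | zero => simp
  | succ n ih => rw [Finset.sum_Icc_succ_top (by omega), ih, Finset.sum_range_succ]

/-- From `log x ≤ 2 √x` and `κ(w) ≤ wᵢ`, the product `√κ(w) log(yᵢ / wᵢ)` is at most `2 √m`. The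
initial divergence is thereby controlled without integrability assumptions on `y⁰`. -/
theorem sqrt_kap_mul_DF_le [Nonempty (Fin d)] {y w : Fin d → ℝ} {m : ℝ} (hy : y ∈ posOrthant d)
    (hw : w ∈ posOrthant d) (hym : l1 y ≤ m) (hwm : l1 w ≤ m) :
    √(kap w) * DF y w ≤ d * (2 * m * √m) + m := by
  have hm : 0 < m := (l1_pos hy).trans_le hym
  have hs1 : √(kap w) ≤ 1 := Real.sqrt_le_iff.2 ⟨one_pos.le, by simpa using kap_le_one w⟩
  have h1 : ∀ i, √(kap w) * (y i * Real.log (y i / w i)) ≤ 2 * m * √m := fun i => by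
    have hyi := hy i
    have hwi := hw i
    have hpos : 0 < y i / w i := div_pos hyi hwi
    have hlog : Real.log (y i / w i) ≤ 2 * √(y i / w i) := by
      have h2 := Real.log_le_sub_one_of_pos (Real.sqrt_pos.2 hpos)
      rw [Real.log_sqrt hpos.le] at h2
      linarith
    have h3 : √(kap w) * √(y i / w i) ≤ √m := by
      rw [← Real.sqrt_mul (kap_pos hw).le]
      refine Real.sqrt_le_sqrt ?_
      have h4 : kap w * (y i / w i) ≤ w i * (y i / w i) :=
        mul_le_mul_of_nonneg_right (kap_le_apply w i) hpos.le
      rw [mul_div_cancel₀ _ hwi.ne'] at h4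
      exact h4.trans (apply_le_of_l1_le hym i)
    calc √(kap w) * (y i * Real.log (y i / w i))
        ≤ √(kap w) * (y i * (2 * √(y i / w i))) := by gcongr
      _ = 2 * y i * (√(kap w) * √(y i / w i)) := by ring
      _ ≤ 2 * m * √m := by
        have := apply_le_of_l1_le hym i
        gcongr
  have h2 : √(kap w) * ∑ i, w i ≤ m := by
    rw [← l1_eq_sum hw]
    exact (mul_le_of_le_one_left (l1_pos hw).le hs1).trans hwm
  have h3 : 0 ≤ √(kap w) * ∑ i, y i := by
    rw [← l1_eq_sum hy]
    exact mul_nonneg (Real.sqrt_nonneg _) (l1_pos hy).le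
  have h4 : √(kap w) * ∑ i, y i * Real.log (y i / w i) ≤ d * (2 * m * √m) := by
    rw [Finset.mul_sum]
    refine (Finset.sum_le_sum fun i _ => h1 i).trans (by simp)
  unfold DF
  linarith

theorem average_eq (γ : ℕ → ℝ) (z : ℕ → ℝ × (Fin d → ℝ)) (n : ℕ) :
    average γ z n = (∑ k ∈ Finset.range n, γ (k + 1))⁻¹ •
      ∑ k ∈ Finset.range n, γ (k + 1) • z k := by
  rw [average, sum_Icc_one_eq_sum_range γ, sum_Icc_one_eq_sum_range fun k => γ k • z (k - 1)]
  simp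

theorem sum_mul_average_sub {γ : ℕ → ℝ} {z : ℕ → ℝ × (Fin d → ℝ)} {n : ℕ}
    (hS : 0 < ∑ k ∈ Finset.range n, γ (k + 1)) :
    (∑ k ∈ Finset.range n, γ (k + 1) * ((z k).1 - (average γ z n).1) = 0) ∧
      ∀ i, ∑ k ∈ Finset.range n, γ (k + 1) * ((z k).2 i - (average γ z n).2 i) = 0 := by
  constructor
  · have : (∑ k ∈ Finset.range n, γ (k + 1)) * (average γ z n).1 =
        ∑ k ∈ Finset.range n, γ (k + 1) * (z k).1 := by
      rw [average_eq, Prod.smul_fst, Prod.fst_sum, smul_eq_mul, mul_inv_cancel_left₀ hS.ne']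
      rfl
    simp only [mul_sub, Finset.sum_sub_distrib, ← Finset.sum_mul, this, sub_self]
  · intro i
    have : (∑ k ∈ Finset.range n, γ (k + 1)) * (average γ z n).2 i =
        ∑ k ∈ Finset.range n, γ (k + 1) * (z k).2 i := by
      rw [average_eq, Prod.smul_snd, Prod.snd_sum, Pi.smul_apply, smul_eq_mul,
        mul_inv_cancel_left₀ hS.ne', Finset.sum_apply]
      rfl
    simp only [mul_sub, Finset.sum_sub_distrib, ← Finset.sum_mul, this, sub_self]

theorem average_mem_posOrthant {γ : ℕ → ℝ} (hγ : ∀ k, 0 < γ (k + 1))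
    {z : ℕ → ℝ × (Fin d → ℝ)} (hz : ∀ k, (z k).2 ∈ posOrthant d) {n : ℕ} (hn : 1 ≤ n) :
    (average γ z n).2 ∈ posOrthant d := fun i => by
  have hne : (Finset.range n).Nonempty := Finset.nonempty_range_iff.2 (by omega)
  rw [average_eq, Prod.smul_snd, Prod.snd_sum, Pi.smul_apply, smul_eq_mul, Finset.sum_apply]
  exact mul_pos (inv_pos.2 (Finset.sum_pos (fun k _ => hγ k) hne))
    (Finset.sum_pos (fun k _ => mul_pos (hγ k) (hz k i)) hne)

/-- Jensen's inequality: in the subgradient inequality at the average, the linear terms cancel. -/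
theorem GradientModel.sum_mul_logBarrier_average_le {b : Fin d → ℝ} {m B : ℝ}
    {f p : ℝ × (Fin d → ℝ) → ℝ} {q : ℝ × (Fin d → ℝ) → Fin d → ℝ} {zs : ℝ × (Fin d → ℝ)}
    (hM : GradientModel b m B f p q zs) {γ : ℕ → ℝ} (hγ : ∀ k, 0 < γ (k + 1))
    {z : ℕ → ℝ × (Fin d → ℝ)} (hz : ∀ k, (z k).2 ∈ posOrthant d) {n : ℕ} (hn : 1 ≤ n) :
    (∑ k ∈ Finset.range n, γ (k + 1)) *
        (logBarrier b f (average γ z n) - logBarrier b f zs) ≤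
      ∑ k ∈ Finset.range n, γ (k + 1) * (logBarrier b f (z k) - logBarrier b f zs) := by
  have hne : (Finset.range n).Nonempty := Finset.nonempty_range_iff.2 (by omega)
  have hS : 0 < ∑ k ∈ Finset.range n, γ (k + 1) := Finset.sum_pos (fun k _ => hγ k) hne
  have hav := average_mem_posOrthant hγ hz hn
  obtain ⟨h1, h2⟩ := sum_mul_average_sub (z := z) hS
  set w := average γ z n with hw
  have h3 : ∑ k ∈ Finset.range n, γ (k + 1) * (logBarrier b f w - logBarrier b f zs +
      (((z k).1 - w.1) * p w + ∑ i, ((z k).2 i - w.2 i) * (q w i - b i / w.2 i))) ≤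
      ∑ k ∈ Finset.range n, γ (k + 1) * (logBarrier b f (z k) - logBarrier b f zs) := by
    refine Finset.sum_le_sum fun k _ => mul_le_mul_of_nonneg_left ?_ (hγ k).le
    linarith [hM.logBarrier_grad hav (hz k)]
  refine le_of_eq_of_le ?_ h3
  have h4 : ∑ k ∈ Finset.range n, γ (k + 1) * (((z k).1 - w.1) * p w) = 0 := by
    simp only [← mul_assoc]
    rw [← Finset.sum_mul, h1, zero_mul]
  have h5 : ∑ k ∈ Finset.range n, γ (k + 1) *
      ∑ i, ((z k).2 i - w.2 i) * (q w i - b i / w.2 i) = 0 := by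
    simp only [Finset.mul_sum]
    rw [Finset.sum_comm]
    refine Finset.sum_eq_zero fun i _ => ?_
    simp only [← mul_assoc]
    rw [← Finset.sum_mul, h2 i, zero_mul]
  simp only [mul_add, Finset.sum_add_distrib, h4, h5, ← Finset.sum_mul, add_zero]

/-- A sequence with summable second moments is dominated by a square integrable variable. -/
theorem exists_memLp_two_dominating {Ω : Type*} [MeasurableSpace Ω] {P : Measure Ω}
    {A : ℕ → Ω → ℝ} (hA : ∀ n, Measurable (A n))
    {e : ℕ → ℝ} (he : Summable e) (hi : ∀ n, Integrable (fun ω => A n ω ^ 2) P)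
    (hle : ∀ n, ∫ ω, A n ω ^ 2 ∂P ≤ e n) :
    ∃ Z : Ω → ℝ, MemLp Z 2 P ∧ ∀ᵐ ω ∂P, ∀ n, A n ω ≤ Z ω := by
  set S : Ω → ℝ≥0∞ := fun ω => ∑' n, ENNReal.ofReal (A n ω ^ 2) with hS
  have hm : ∀ n, Measurable fun ω => ENNReal.ofReal (A n ω ^ 2) := fun n =>
    ((hA n).pow_const 2).ennreal_ofReal
  have hSm : Measurable S := Measurable.tsum hm
  have hfin : ∫⁻ ω, S ω ∂P ≠ ∞ := by
    rw [hS, lintegral_tsum fun n => (hm n).aemeasurable]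
    refine ne_top_of_le_ne_top he.tsum_ofReal_ne_top (ENNReal.tsum_le_tsum fun n => ?_)
    rw [← ofReal_integral_eq_lintegral_ofReal (hi n) (Eventually.of_forall fun ω => sq_nonneg _)]
    exact ENNReal.ofReal_le_ofReal (hle n)
  have hZm : Measurable fun ω => √(S ω).toReal := hSm.ennreal_toReal.sqrt
  refine ⟨fun ω => √(S ω).toReal, ?_, ?_⟩
  · rw [memLp_two_iff_integrable_sq hZm.aestronglyMeasurable]
    simp only [Real.sq_sqrt ENNReal.toReal_nonneg]
    exact integrable_toReal_of_lintegral_ne_top hSm.aemeasurable hfin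
  · filter_upwards [ae_lt_top hSm hfin] with ω hω n
    refine Real.le_sqrt_of_sq_le ?_
    rw [← ENNReal.ofReal_le_iff_le_toReal hω.ne]
    exact ENNReal.le_tsum n

theorem min_iInf_iInf_pos [Nonempty (Fin d)] {n : ℕ} (hn : 1 ≤ n) {y : ℕ → Fin d → ℝ}
    (hy : ∀ k, y k ∈ posOrthant d) : 0 < min (⨅ k : Fin n, ⨅ i, y k i) 1 := by
  have : Nonempty (Fin n) := ⟨⟨0, hn⟩⟩
  obtain ⟨k, hk⟩ := exists_eq_ciInf_of_finite (f := fun k : Fin n => ⨅ i, y k i)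
  obtain ⟨i, hi⟩ := exists_eq_ciInf_of_finite (f := fun i => y k i)
  rw [← hk, ← hi]
  exact lt_min (hy k i) one_pos

theorem min_iInf_iInf_le_kap {n k : ℕ} (hk : k < n) (y : ℕ → Fin d → ℝ) :
    min (⨅ k : Fin n, ⨅ i, y k i) 1 ≤ kap (y k) :=
  min_le_min_right 1 (ciInf_le (Set.finite_range fun k : Fin n => ⨅ i, y k i).bddBelow ⟨k, hk⟩)

/-- The minimum is below `κ(y⁰)` and below `κ(yᵏ)`, hence below their geometric mean. One factor is
an `F₀`-measurable weight, the other is the factor in the drift inequality. -/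
theorem min_iInf_iInf_le_sqrt_mul_sqrt [Nonempty (Fin d)] {n k : ℕ} (hk : k < n)
    {y : ℕ → Fin d → ℝ} (hy : ∀ k, y k ∈ posOrthant d) :
    min (⨅ k : Fin n, ⨅ i, y k i) 1 ≤ √(kap (y 0)) * √(kap (y k)) := by
  have h0 := (min_iInf_iInf_pos (by omega : 1 ≤ n) hy).le
  have h1 := Real.sqrt_le_sqrt (min_iInf_iInf_le_kap (by omega : 0 < n) y)
  have h2 := Real.sqrt_le_sqrt (min_iInf_iInf_le_kap hk y)
  calc min (⨅ k : Fin n, ⨅ i, y k i) 1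
      = √(min (⨅ k : Fin n, ⨅ i, y k i) 1) * √(min (⨅ k : Fin n, ⨅ i, y k i) 1) :=
        (Real.mul_self_sqrt h0).symm
    _ ≤ _ := mul_le_mul h1 h2 (Real.sqrt_nonneg _) (Real.sqrt_nonneg _)

namespace SMDModel

variable {Ω : Type*} [mΩ : MeasurableSpace Ω] {P : Measure Ω}
  {X : Ω → Fin d → ℝ} {L : ℝ → ℝ → ℝ} {b : Fin d → ℝ} {m B C : ℝ} {zs : ℝ × (Fin d → ℝ)}
  {γ : ℕ → ℝ} {z₀ : Ω → ℝ × (Fin d → ℝ)} {Xs : ℕ → Ω → Fin d → ℝ}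
  {W α : ℝ × (Fin d → ℝ) → ℝ} {β : ℝ × (Fin d → ℝ) → Fin d → ℝ}

/-- The weighted average of the bounds `B √κ(y⁰) |ξᵏ - ξ⋆| + c` on the tamed gaps. -/
noncomputable def meanGapBound (L : ℝ → ℝ → ℝ) (b : Fin d → ℝ) (m B c : ℝ)
    (zs : ℝ × (Fin d → ℝ)) (γ : ℕ → ℝ) (z₀ : Ω → ℝ × (Fin d → ℝ)) (Xs : ℕ → Ω → Fin d → ℝ)
    (n : ℕ) (ω : Ω) : ℝ :=
  (∑ k ∈ Finset.range n, γ (k + 1))⁻¹ * ∑ k ∈ Finset.range n, γ (k + 1) *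
    (B * (√(kap (z₀ ω).2) * |(smd L b m γ z₀ Xs k ω).1 - zs.1|) + c)

theorem sum_mul_gapAt_le (hS : SMDModel P X L b m B zs γ z₀ Xs)
    (hW : IsLyapunov b m (meanLoss P X L) (meanXi P X L) (meanGrad P X L) zs W α β C)
    (n : ℕ) (ω : Ω) :
    ∑ k ∈ Finset.range n, γ (k + 1) * gapAt P X L b m zs γ z₀ Xs k ω ≤ W (z₀ ω) -
      W (smd L b m γ z₀ Xs n ω) -
      ∑ k ∈ Finset.range n, γ (k + 1) * fluctuationAt P X L b m γ z₀ Xs α β k ω +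
      C * (2 + 2 * d) * ∑ k ∈ Finset.range n, γ (k + 1) ^ 2 * noiseAt L b m γ z₀ Xs k ω := by
  induction n with
  | zero => simp [smd]
  | succ n ih =>
    have := hS.W_smd_succ_le hW n ω
    simp only [Finset.sum_range_succ]
    linarith

/-- The pathwise bound on the optimality gap of the averages. -/
theorem kmin_mul_gap_average_le (hS : SMDModel P X L b m B zs γ z₀ Xs)
    (hW : IsLyapunov b m (meanLoss P X L) (meanXi P X L) (meanGrad P X L) zs W α β C) {c : ℝ}
    (hc : ∀ z ∈ feasible d m, √(kap z.2) * (logBarrier b (meanLoss P X L) z -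
      logBarrier b (meanLoss P X L) zs) ≤ √(kap z.2) * ((z.1 - zs.1) * meanXi P X L z) + c)
    (hc0 : 0 ≤ c) {n : ℕ} (hn : 1 ≤ n) (ω : Ω) :
    (logBarrier b (meanLoss P X L) (average γ (fun k => smd L b m γ z₀ Xs k ω) n) -
        logBarrier b (meanLoss P X L) zs) *
      (min (⨅ k : Fin n, ⨅ i, (smd L b m γ z₀ Xs k ω).2 i) 1 *
        ∑ k ∈ Finset.range (n + 1), γ (k + 1)) ≤
    √(kap (z₀ ω).2) * W (z₀ ω) -
      ∑ k ∈ Finset.range n, γ (k + 1) * (√(kap (z₀ ω).2) *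
        fluctuationAt P X L b m γ z₀ Xs α β k ω) +
      C * (2 + 2 * d) * (∑ k ∈ Finset.range n, γ (k + 1) ^ 2 * noiseAt L b m γ z₀ Xs k ω) +
      γ (n + 1) * meanGapBound L b m B c zs γ z₀ Xs n ω := by
  have hne' := hS.model.nonempty
  have hB := hS.model.B_nonneg
  have hC := hW.nonneg
  set φ := logBarrier b (meanLoss P X L) with hφ
  set z : ℕ → ℝ × (Fin d → ℝ) := fun k => smd L b m γ z₀ Xs k ω with hz
  have hzm : ∀ k, z k ∈ feasible d m := fun k => hS.smd_mem k ω
  set κ := min (⨅ k : Fin n, ⨅ i, (smd L b m γ z₀ Xs k ω).2 i) 1 with hκ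
  have hκ0 : 0 < κ := min_iInf_iInf_pos hn (y := fun k => (z k).2) fun k => (hzm k).1
  set a := √(kap (z₀ ω).2) with ha
  have ha0 : 0 ≤ a := Real.sqrt_nonneg _
  have ha1 : a ≤ 1 := Real.sqrt_le_iff.2 ⟨one_pos.le, by simpa using kap_le_one (z₀ ω).2⟩
  have hκle : ∀ k < n, κ ≤ a * √(kap (z k).2) := fun k hk =>
    min_iInf_iInf_le_sqrt_mul_sqrt hk (y := fun k => (z k).2) fun k => (hzm k).1
  have hnonneg : ∀ k, 0 ≤ φ (z k) - φ zs := fun k =>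
    sub_nonneg.2 (hS.model.le_logBarrier (hzm k).1)
  have hgap : ∀ k < n, κ * (φ (z k) - φ zs) ≤ a * gapAt P X L b m zs γ z₀ Xs k ω := fun k hk => by
    have h1 := mul_le_mul_of_nonneg_right (hκle k hk) (hnonneg k)
    rw [mul_assoc] at h1
    exact h1
  set S := ∑ k ∈ Finset.range n, γ (k + 1) with hSdef
  have hSpos : 0 < S := Finset.sum_pos (fun k _ => hS.γ_pos k)
    (Finset.nonempty_range_iff.2 (by omega))
  set G := φ (average γ z n) - φ zs with hG
  have hJ : S * G ≤ ∑ k ∈ Finset.range n, γ (k + 1) * (φ (z k) - φ zs) :=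
    hS.model.sum_mul_logBarrier_average_le hS.γ_pos (fun k => (hzm k).1) hn
  have hJκ : κ * (S * G) ≤
      ∑ k ∈ Finset.range n, γ (k + 1) * (a * gapAt P X L b m zs γ z₀ Xs k ω) := by
    refine (mul_le_mul_of_nonneg_left hJ hκ0.le).trans ?_
    rw [Finset.mul_sum]
    refine Finset.sum_le_sum fun k hk => ?_
    rw [mul_left_comm]
    exact mul_le_mul_of_nonneg_left (hgap k (Finset.mem_range.1 hk)) (hS.γ_pos k).le
  have h1 : κ * (S * G) ≤ a * W (z₀ ω) -
      ∑ k ∈ Finset.range n, γ (k + 1) * (a * fluctuationAt P X L b m γ z₀ Xs α β k ω) +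
      C * (2 + 2 * d) * (∑ k ∈ Finset.range n, γ (k + 1) ^ 2 * noiseAt L b m γ z₀ Xs k ω) := by
    have h2 := mul_le_mul_of_nonneg_left (hS.sum_mul_gapAt_le hW n ω) ha0
    have e1 : a * ∑ k ∈ Finset.range n, γ (k + 1) * gapAt P X L b m zs γ z₀ Xs k ω =
        ∑ k ∈ Finset.range n, γ (k + 1) * (a * gapAt P X L b m zs γ z₀ Xs k ω) := by
      rw [Finset.mul_sum]; exact Finset.sum_congr rfl fun k _ => by ring
    have e2 : a * ∑ k ∈ Finset.range n, γ (k + 1) * fluctuationAt P X L b m γ z₀ Xs α β k ω =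
        ∑ k ∈ Finset.range n, γ (k + 1) * (a * fluctuationAt P X L b m γ z₀ Xs α β k ω) := by
      rw [Finset.mul_sum]; exact Finset.sum_congr rfl fun k _ => by ring
    have h3 : 0 ≤ C * (2 + 2 * d) *
        ∑ k ∈ Finset.range n, γ (k + 1) ^ 2 * noiseAt L b m γ z₀ Xs k ω :=
      mul_nonneg (by positivity) (Finset.sum_nonneg fun k _ =>
        mul_nonneg (sq_nonneg _) (zero_le_one.trans (one_le_noise L _ _)))
    have h4 := mul_le_of_le_one_left h3 ha1
    have h5 : 0 ≤ a * W (smd L b m γ z₀ Xs n ω) :=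
      mul_nonneg ha0 (hW.W_nonneg hS.model (hzm n))
    rw [mul_add, mul_sub, mul_sub, e1, e2] at h2
    linarith
  -- The sum in the denominator has `n + 1` terms and the average only `n`. The leftover `γ_{n+1} κ
  -- G` is bounded by averaging crude bounds on the individual gaps.
  have h2 : κ * G ≤ meanGapBound L b m B c zs γ z₀ Xs n ω := by
    have h3 : ∀ k, a * gapAt P X L b m zs γ z₀ Xs k ω ≤ B * (a * |(z k).1 - zs.1|) + c := fun k => by
      have h4 := hc (z k) (hzm k)
      have h5 : √(kap (z k).2) * (((z k).1 - zs.1) * meanXi P X L (z k)) ≤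
          |(z k).1 - zs.1| * B := by
        refine (le_abs_self _).trans ?_
        rw [abs_mul, abs_mul, abs_of_nonneg (Real.sqrt_nonneg _)]
        refine (mul_le_of_le_one_left (by positivity) (Real.sqrt_le_iff.2
          ⟨one_pos.le, by simpa using kap_le_one (z k).2⟩)).trans ?_
        exact mul_le_mul_of_nonneg_left (hS.model.bound_p _ (hzm k)) (abs_nonneg _)
      have h6 : gapAt P X L b m zs γ z₀ Xs k ω ≤ |(z k).1 - zs.1| * B + c := h4.trans (by linarith)
      have h7 := mul_le_mul_of_nonneg_left h6 ha0
      have h8 := mul_le_of_le_one_left hc0 ha1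
      linarith
    rw [meanGapBound, inv_mul_eq_div, le_div_iff₀ hSpos]
    refine le_trans (le_of_eq (by ring)) (hJκ.trans (Finset.sum_le_sum fun k _ =>
      mul_le_mul_of_nonneg_left (h3 k) (hS.γ_pos k).le))
  have h3 := mul_le_mul_of_nonneg_left h2 (hS.γ_pos n).le
  rw [Finset.sum_range_succ]
  linarith

theorem measurable_meanGapBound (hS : SMDModel P X L b m B zs γ z₀ Xs) (c : ℝ) (n : ℕ) :
    Measurable[hS.filtration n] (meanGapBound L b m B c zs γ z₀ Xs n) := by
  have h0 : Measurable[hS.filtration n] fun ω => √(kap (z₀ ω).2) :=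
    (measurable_kap.comp (hS.measurable_z₀_filtration.mono
      (hS.filtration.mono (Nat.zero_le n)) le_rfl).snd).sqrt
  unfold meanGapBound
  refine Measurable.const_mul (Finset.measurable_sum _ fun k hk => ?_) _
  have h1 : Measurable[hS.filtration n] (smd L b m γ z₀ Xs k) :=
    (hS.measurable_smd k).mono (hS.filtration.mono (Finset.mem_range.1 hk).le) le_rfl
  exact (((h0.mul (continuous_abs.measurable.comp (h1.fst.sub_const _))).const_mul B).add_const c).const_mul _

/-- Cauchy-Schwarz for the weighted average, followed by `(ξ - ξ⋆)² ≤ 2 W`, reduces second moments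
to those of the weighted `W`. -/
theorem meanGapBound_sq_le (hS : SMDModel P X L b m B zs γ z₀ Xs)
    (hW : IsLyapunov b m (meanLoss P X L) (meanXi P X L) (meanGrad P X L) zs W α β C) (c : ℝ)
    (n : ℕ) (ω : Ω) : meanGapBound L b m B c zs γ z₀ Xs n ω ^ 2 ≤
      (∑ k ∈ Finset.range n, γ (k + 1))⁻¹ * ∑ k ∈ Finset.range n, γ (k + 1) *
        (4 * B ^ 2 * (√(kap (z₀ ω).2) ^ 2 * W (smd L b m γ z₀ Xs k ω)) + 2 * c ^ 2) := by
  set a := √(kap (z₀ ω).2) with ha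
  set S := ∑ k ∈ Finset.range n, γ (k + 1) with hSdef
  have hS0 : 0 ≤ S := Finset.sum_nonneg fun k _ => (hS.γ_pos k).le
  set u : ℕ → ℝ := fun k => B * (a * |(smd L b m γ z₀ Xs k ω).1 - zs.1|) + c with hu
  have h1 : (∑ k ∈ Finset.range n, γ (k + 1) * u k) ^ 2 ≤
      S * ∑ k ∈ Finset.range n, γ (k + 1) * u k ^ 2 :=
    Finset.sum_sq_le_sum_mul_sum_of_sq_le_mul _ (fun k _ => (hS.γ_pos k).le)
      (fun k _ => mul_nonneg (hS.γ_pos k).le (sq_nonneg _)) fun k _ => (by ring : _ = _).le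
  have h2 : ∀ k, u k ^ 2 ≤ 4 * B ^ 2 * (a ^ 2 * W (smd L b m γ z₀ Xs k ω)) + 2 * c ^ 2 := fun k => by
    have hz := hS.smd_mem k ω
    have h3 := hW.lower _ hz
    have h4 := DF_nonneg hS.model.zs_mem.1 hz.1
    have h5 := sq_abs ((smd L b m γ z₀ Xs k ω).1 - zs.1)
    have h6 : |(smd L b m γ z₀ Xs k ω).1 - zs.1| ^ 2 ≤ 2 * W (smd L b m γ z₀ Xs k ω) := by
      linarith
    have h7 := mul_le_mul_of_nonneg_left h6 (by positivity : 0 ≤ 2 * B ^ 2 * a ^ 2)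
    simp only [hu]
    nlinarith [sq_nonneg (B * (a * |(smd L b m γ z₀ Xs k ω).1 - zs.1|) - c)]
  have h3 : ∑ k ∈ Finset.range n, γ (k + 1) * u k ^ 2 ≤ ∑ k ∈ Finset.range n, γ (k + 1) *
      (4 * B ^ 2 * (a ^ 2 * W (smd L b m γ z₀ Xs k ω)) + 2 * c ^ 2) :=
    Finset.sum_le_sum fun k _ => mul_le_mul_of_nonneg_left (h2 k) (hS.γ_pos k).le
  have h4 : meanGapBound L b m B c zs γ z₀ Xs n ω = S⁻¹ * ∑ k ∈ Finset.range n, γ (k + 1) * u k :=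
    rfl
  rw [h4, mul_pow]
  rcases hS0.eq_or_lt with h0 | hpos
  · rw [← h0]; simp
  · calc S⁻¹ ^ 2 * (∑ k ∈ Finset.range n, γ (k + 1) * u k) ^ 2
        ≤ S⁻¹ ^ 2 * (S * ∑ k ∈ Finset.range n, γ (k + 1) * u k ^ 2) := by gcongr
      _ = S⁻¹ * ∑ k ∈ Finset.range n, γ (k + 1) * u k ^ 2 := by field_simp
      _ ≤ _ := by gcongr

end SMDModel

/-! ### The rate in expectation form: domination in `L²` and choice of the martingale -/

namespace SMDModel

variable {Ω : Type*} [mΩ : MeasurableSpace Ω] {P : Measure Ω} [IsProbabilityMeasure P]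
  {X : Ω → Fin d → ℝ} {L : ℝ → ℝ → ℝ} {b : Fin d → ℝ} {m B C : ℝ} {zs : ℝ × (Fin d → ℝ)}
  {γ : ℕ → ℝ} {z₀ : Ω → ℝ × (Fin d → ℝ)} {Xs : ℕ → Ω → Fin d → ℝ}
  {W α : ℝ × (Fin d → ℝ) → ℝ} {β : ℝ × (Fin d → ℝ) → Fin d → ℝ}

theorem integrable_noiseAt (hS : SMDModel P X L b m B zs γ z₀ Xs) (k : ℕ) :
    Integrable (noiseAt L b m γ z₀ Xs k) P := by
  obtain ⟨N, hN⟩ := hS.exists_lintegral_noise_le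
  simpa using (hS.integrable_mul_noiseAt hN k (c := fun _ => 1) measurable_const
    (fun _ => zero_le_one) (integrable_const 1)).1

theorem integral_noise_le {P : Measure Ω} {L : ℝ → ℝ → ℝ}
    (hL : ConvexOn ℝ Set.univ fun p : ℝ × ℝ => L p.1 p.2) {N : ℝ≥0}
    {z : ℝ × (Fin d → ℝ)} (hN : ∫⁻ v, ENNReal.ofReal (noise L z v) ∂(P.map X) ≤ N) :
    ∫ v, noise L z v ∂(P.map X) ≤ N := by
  have hm : Measurable fun v => noise L z v :=
    (measurable_noise hL).comp measurable_prodMk_left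
  have h0 : ∀ v, 0 ≤ noise L z v := fun v => zero_le_one.trans (one_le_noise L z v)
  rw [integral_eq_lintegral_of_nonneg_ae (Eventually.of_forall h0) hm.aestronglyMeasurable]
  exact ENNReal.toReal_le_coe_of_le_coe hN

theorem condExp_noiseAt_le (hS : SMDModel P X L b m B zs γ z₀ Xs) {N : ℝ≥0}
    (hN : ∀ z ∈ feasible d m, ∫⁻ v, ENNReal.ofReal (noise L z v) ∂(P.map X) ≤ N) (k : ℕ) :
    P[noiseAt L b m γ z₀ Xs k | hS.filtration k] ≤ᵐ[P] fun _ => (N : ℝ) := by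
  have hi := hS.integrable_noiseAt k
  unfold noiseAt at hi ⊢
  have h1 := condExp_comp_of_indep (hS.filtration.le k) (hS.measurable_smd k)
    (hS.measurable_Xs (k + 1))
    (hS.sampling.indep_next hS.measurable_z₀ hS.measurable_Xs k)
    (φ := fun w => noise L w.1 w.2) (measurable_noise hS.convexOn) hi
  simp only [hS.map_Xs] at h1
  filter_upwards [h1] with ω hω
  rw [hω]
  exact integral_noise_le hS.convexOn (hN _ (hS.smd_mem k ω))

/-- A square integrable variable dominating the terms `γ_{n+1} A_n`. -/
theorem exists_memLp_two_ge_meanGapBound (hS : SMDModel P X L b m B zs γ z₀ Xs)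
    (hW : IsLyapunov b m (meanLoss P X L) (meanXi P X L) (meanGrad P X L) zs W α β C) (c : ℝ)
    (hint : Integrable (fun ω => √(kap (z₀ ω).2) ^ 2 * W (z₀ ω)) P) :
    (∀ n, Integrable (fun ω => γ (n + 1) * meanGapBound L b m B c zs γ z₀ Xs n ω) P) ∧
    ∃ Z : Ω → ℝ, MemLp Z 2 P ∧ ∀ᵐ ω ∂P, ∀ n,
      γ (n + 1) * meanGapBound L b m B c zs γ z₀ Xs n ω ≤ Z ω := by
  have ham : Measurable[hS.filtration 0] fun ω => √(kap (z₀ ω).2) :=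
    (measurable_kap.comp hS.measurable_z₀_filtration.snd).sqrt
  obtain ⟨K, hK⟩ := hS.exists_integral_sq_mul_W_le hW ham (fun ω => Real.sqrt_nonneg _)
    (fun ω => Real.sqrt_le_iff.2 ⟨one_pos.le, by simpa using kap_le_one (z₀ ω).2⟩) hint
  have hAm : ∀ n, Measurable (meanGapBound L b m B c zs γ z₀ Xs n) := fun n =>
    (hS.measurable_meanGapBound c n).mono (hS.filtration.le n) le_rfl
  set K' := 4 * B ^ 2 * K + 2 * c ^ 2 with hK'
  have hK0 : 0 ≤ K := (integral_nonneg fun ω => mul_nonneg (sq_nonneg _)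
    (hW.W_nonneg hS.model (hS.smd_mem 0 ω))).trans (hK 0).2
  have hterm : ∀ k, Integrable (fun ω => γ (k + 1) * (4 * B ^ 2 *
      (√(kap (z₀ ω).2) ^ 2 * W (smd L b m γ z₀ Xs k ω)) + 2 * c ^ 2)) P := fun k =>
    (((hK k).1.const_mul _).add (integrable_const _)).const_mul _
  have hsq : ∀ n, Integrable (fun ω => meanGapBound L b m B c zs γ z₀ Xs n ω ^ 2) P ∧
      ∫ ω, meanGapBound L b m B c zs γ z₀ Xs n ω ^ 2 ∂P ≤ K' := fun n => by
    have hdom := (integrable_finsetSum (Finset.range n) fun k _ => hterm k).const_mul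
      (∑ k ∈ Finset.range n, γ (k + 1))⁻¹
    have h1 : Integrable (fun ω => meanGapBound L b m B c zs γ z₀ Xs n ω ^ 2) P :=
      hdom.mono' ((hAm n).pow_const 2).aestronglyMeasurable (Eventually.of_forall fun ω => by
        rw [Real.norm_of_nonneg (sq_nonneg _)]; exact hS.meanGapBound_sq_le hW c n ω)
    refine ⟨h1, (integral_mono h1 hdom fun ω => hS.meanGapBound_sq_le hW c n ω).trans ?_⟩
    rw [integral_const_mul, integral_finsetSum _ fun k _ => hterm k]
    have h2 : ∑ k ∈ Finset.range n, ∫ ω, γ (k + 1) * (4 * B ^ 2 *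
        (√(kap (z₀ ω).2) ^ 2 * W (smd L b m γ z₀ Xs k ω)) + 2 * c ^ 2) ∂P ≤
        ∑ k ∈ Finset.range n, γ (k + 1) * K' := by
      refine Finset.sum_le_sum fun k _ => ?_
      rw [integral_const_mul, integral_add ((hK k).1.const_mul _) (integrable_const _),
        integral_const_mul]
      refine mul_le_mul_of_nonneg_left ?_ (hS.γ_pos k).le
      have h3 := mul_le_mul_of_nonneg_left (hK k).2 (by positivity : 0 ≤ 4 * B ^ 2)
      simp only [integral_const, probReal_univ, one_smul]
      linarith
    rw [← Finset.sum_mul] at h2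
    have hS0 : 0 ≤ ∑ k ∈ Finset.range n, γ (k + 1) :=
      Finset.sum_nonneg fun k _ => (hS.γ_pos k).le
    refine (mul_le_mul_of_nonneg_left h2 (inv_nonneg.2 hS0)).trans ?_
    rw [← mul_assoc]
    exact mul_le_of_le_one_left (by positivity) inv_mul_le_one
  have hm2 : ∀ n, MemLp (meanGapBound L b m B c zs γ z₀ Xs n) 2 P := fun n =>
    (memLp_two_iff_integrable_sq (hAm n).aestronglyMeasurable).2 (hsq n).1
  refine ⟨fun n => ((hm2 n).integrable (by norm_num)).const_mul _, ?_⟩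
  -- The second moments of the averages are bounded by `K'`, so multiplying by `γ_{n+1}` makes them
  -- summable, and one variable dominates all terms.
  refine exists_memLp_two_dominating (fun n => (hAm n).const_mul _)
    (hS.summable_sq.mul_right K') (fun n => ?_) fun n => ?_
  · simp only [mul_pow]
    exact (hsq n).1.const_mul _
  · simp only [mul_pow]
    rw [integral_const_mul]
    exact mul_le_mul_of_nonneg_left (hsq n).2 (sq_nonneg _)

theorem le_condExp_of_ae_le {Ω : Type*} {m mΩ : MeasurableSpace Ω} {P : Measure Ω}
    [IsProbabilityMeasure P] (hm : m ≤ mΩ) {R V : Ω → ℝ} (hR : StronglyMeasurable[m] R)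
    (hRi : Integrable R P) (hV : Integrable V P) (h : R ≤ᵐ[P] V) : R ≤ᵐ[P] P[V | m] := by
  have := condExp_mono (m := m) hRi hV h
  rwa [condExp_of_stronglyMeasurable hm hR hRi] at this

/-- The rate for the averaged iterates. -/
theorem exists_rate (hS : SMDModel P X L b m B zs γ z₀ Xs)
    (hz2 : MemLp (fun ω => (z₀ ω).1) 2 P) :
    ∃ (M Y : ℕ → Ω → ℝ) (N : ℝ),
      Martingale M hS.filtration P ∧
      (∃ C : ℝ≥0, ∀ n, eLpNorm (M n) 2 P ≤ C) ∧
      (∃ Minf : Ω → ℝ, ∀ᵐ ω ∂P, Tendsto (fun n => M n ω) atTop (𝓝 (Minf ω))) ∧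
      (∀ n ω, 0 ≤ Y n ω) ∧
      (∀ n, StronglyMeasurable[hS.filtration n] (Y n)) ∧
      (∀ n, Integrable (Y n) P) ∧
      (∀ n, P[Y (n + 1) | hS.filtration n] ≤ᵐ[P] fun _ => N ^ 2) ∧
      ∀ᵐ ω ∂P, ∀ n : ℕ, 1 ≤ n →
        logBarrier b (meanLoss P X L) (average γ (fun k => smd L b m γ z₀ Xs k ω) n) -
            logBarrier b (meanLoss P X L) zs ≤
          ((1 / 2) * ((z₀ ω).1 - zs.1) ^ 2 + DF zs.2 (z₀ ω).2 - M n ω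
            + (1 / 2) * max m 1 *
              ∑ k ∈ Finset.range (n + 1), γ (k + 1) ^ 2 * Y (k + 1) ω) /
          (min (⨅ k : Fin n, ⨅ i, (smd L b m γ z₀ Xs k ω).2 i) 1 *
            ∑ k ∈ Finset.range (n + 1), γ (k + 1)) := by
  have hne := hS.model.nonempty
  obtain ⟨W, α, β, C, hW⟩ := hS.model.exists_isLyapunov
  obtain ⟨c, hc0, hc⟩ := hS.model.exists_sqrt_kap_mul_le
  obtain ⟨N, hN⟩ := hS.exists_lintegral_noise_le
  have hC := hW.nonneg
  set a : Ω → ℝ := fun ω => √(kap (z₀ ω).2) with ha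
  have ha0 : ∀ ω, 0 ≤ a ω := fun ω => Real.sqrt_nonneg _
  have ha1 : ∀ ω, a ω ≤ 1 := fun ω =>
    Real.sqrt_le_iff.2 ⟨one_pos.le, by simpa using kap_le_one (z₀ ω).2⟩
  have ham : Measurable[hS.filtration 0] a :=
    (measurable_kap.comp hS.measurable_z₀_filtration.snd).sqrt
  have ht2 : MemLp (fun ω => (z₀ ω).1 - zs.1) 2 P := hz2.sub (memLp_const _)
  set CD := (d : ℝ) * (2 * m * √m) + m with hCD
  -- The excess of `a W(z⁰)` over `½(ξ⁰ - ξ⋆)²`. It is linear in `|ξ⁰ - ξ⋆|`, hence square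
  -- integrable.
  set R : Ω → ℝ := fun ω => C * |(z₀ ω).1 - zs.1| + (C + C * CD) with hR
  have hR2 : MemLp R 2 P := by
    have h1 : MemLp (fun ω => C * |(z₀ ω).1 - zs.1|) 2 P := ht2.abs.const_mul C
    have h2 : MemLp (fun _ : Ω => C + C * CD) 2 P := memLp_const _
    exact h1.add h2
  have haW : ∀ ω, a ω * W (z₀ ω) ≤ (1 / 2) * ((z₀ ω).1 - zs.1) ^ 2 + R ω := fun ω => by
    have h1 := mul_le_mul_of_nonneg_left (hW.upper _ (hS.z₀_mem ω)) (ha0 ω)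
    have h2 := mul_le_mul_of_nonneg_left (sqrt_kap_mul_DF_le hS.model.zs_mem.1 (hS.z₀_mem ω).1
      hS.model.zs_mem.2 (hS.z₀_mem ω).2) hC
    have h3 := mul_le_of_le_one_left
      (by positivity : 0 ≤ ((z₀ ω).1 - zs.1) ^ 2 / 2 + C * (1 + |(z₀ ω).1 - zs.1|)) (ha1 ω)
    simp only [hR, ha] at h1 h3 ⊢
    linarith
  have hW0 : ∀ ω, 0 ≤ W (z₀ ω) := fun ω => hW.W_nonneg hS.model (hS.z₀_mem ω)
  have hint : Integrable (fun ω => a ω ^ 2 * W (z₀ ω)) P := by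
    refine Integrable.mono' ((ht2.integrable_sq.const_mul (1 / 2)).add
      (hR2.integrable (by norm_num)))
      (((ham.mono (hS.filtration.le 0) le_rfl).pow_const 2).mul
        (hW.measurable_W.comp hS.measurable_z₀)).aestronglyMeasurable
      (Eventually.of_forall fun ω => ?_)
    have h1 := mul_nonneg (ha0 ω) (hW0 ω)
    rw [Real.norm_of_nonneg (mul_nonneg (sq_nonneg _) (hW0 ω)), sq, mul_assoc]
    exact (mul_le_of_le_one_left h1 (ha1 ω)).trans (haW ω)
  obtain ⟨hm1, Km, hKm⟩ := hS.martingale_fluctuation hW ham ha0 ha1 hint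
  obtain ⟨hAi, Z, hZ2, hZ⟩ := hS.exists_memLp_two_ge_meanGapBound hW c hint
  -- For every `n`, `V` dominates the `F_n`-measurable variable `γ_{n+1} A_n + R`, where `A_n` is
  -- `meanGapBound`; therefore so does `E[V | F_n]`. The latter is a martingale bounded in `L²`, so
  -- subtracting it in `M` absorbs both excess terms into `-M_n`.
  set V : Ω → ℝ := fun ω => Z ω + R ω with hV
  have hV2 : MemLp V 2 P := hZ2.add hR2
  have hRm : ∀ n, Measurable[hS.filtration n] R := fun n => by
    have h1 := (hS.measurable_z₀_filtration.mono (hS.filtration.mono (Nat.zero_le n)) le_rfl).fst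
    exact ((continuous_abs.measurable.comp (h1.sub_const _)).const_mul C).add_const _
  have hVle : ∀ᵐ ω ∂P, ∀ n, γ (n + 1) * meanGapBound L b m B c zs γ z₀ Xs n ω + R ω ≤
      (P[V | hS.filtration n]) ω := by
    refine ae_all_iff.2 fun n => le_condExp_of_ae_le (hS.filtration.le n)
      (((hS.measurable_meanGapBound c n).const_mul _).add (hRm n)).stronglyMeasurable
      ((hAi n).add (hR2.integrable (by norm_num))) (hV2.integrable (by norm_num)) ?_
    filter_upwards [hZ] with ω hω
    exact add_le_add (hω n) le_rfl
  set M : ℕ → Ω → ℝ := (fun n ω => ∑ k ∈ Finset.range n,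
    γ (k + 1) * (a ω * fluctuationAt P X L b m γ z₀ Xs α β k ω)) -
      fun n => P[V | hS.filtration n] with hM
  have hMm : Martingale M hS.filtration P := hm1.sub (martingale_condExp V hS.filtration P)
  have hMb : ∃ C : ℝ≥0, ∀ n, eLpNorm (M n) 2 P ≤ C := by
    refine ⟨Km + (eLpNorm V 2 P).toNNReal, fun n => ?_⟩
    have h1 : AEStronglyMeasurable (fun ω => ∑ k ∈ Finset.range n,
        γ (k + 1) * (a ω * fluctuationAt P X L b m γ z₀ Xs α β k ω)) P :=
      ((hm1.stronglyMeasurable n).mono (hS.filtration.le n)).aestronglyMeasurable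
    refine (eLpNorm_sub_le h1 integrable_condExp.aestronglyMeasurable (by norm_num)).trans ?_
    rw [ENNReal.coe_add, ENNReal.coe_toNNReal hV2.eLpNorm_lt_top.ne]
    exact add_le_add (hKm n) (eLpNorm_condExp_le_eLpNorm V (by norm_num))
  -- The factor `2` compensates the `½` in front of the noise sum; `max m 1` is only used to be at
  -- least `1`.
  set cY := 2 * (C * (2 + 2 * d)) with hcY
  have hcY0 : 0 ≤ cY := by positivity
  -- The value at `0` is arbitrary: the bounds involve `Y (k + 1)` only.
  set Y : ℕ → Ω → ℝ := fun n => Nat.casesOn n (fun _ => 0)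
    fun k ω => cY * noiseAt L b m γ z₀ Xs k ω with hY
  have hn0 : ∀ k ω, 0 ≤ noiseAt L b m γ z₀ Xs k ω := fun k ω =>
    zero_le_one.trans (one_le_noise L _ _)
  have hYs : ∀ k, Y (k + 1) = cY • noiseAt L b m γ z₀ Xs k := fun k => rfl
  have hY0 : ∀ n ω, 0 ≤ Y n ω := fun n ω => by
    cases n with
    | zero => exact le_rfl
    | succ k => rw [hYs]; exact mul_nonneg hcY0 (hn0 k ω)
  refine ⟨M, Y, √(cY * N), hMm, hMb, Martingale.exists_ae_tendsto hMm hMb, hY0, fun n => ?_,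
    fun n => ?_, fun n => ?_, ?_⟩
  · cases n with
    | zero => exact stronglyMeasurable_const
    | succ k => rw [hYs]; exact ((hS.measurable_noiseAt k).const_smul cY).stronglyMeasurable
  · cases n with
    | zero => exact integrable_const 0
    | succ k => rw [hYs]; exact (hS.integrable_noiseAt k).smul cY
  · rw [hYs, Real.sq_sqrt (mul_nonneg hcY0 N.coe_nonneg)]
    have h1 := condExp_smul (μ := P) cY (noiseAt L b m γ z₀ Xs n) (hS.filtration n)
    filter_upwards [h1, hS.condExp_noiseAt_le hN n] with ω h2 h3
    refine le_of_eq_of_le h2 ?_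
    exact mul_le_mul_of_nonneg_left h3 hcY0
  · filter_upwards [hVle] with ω hω n hn
    have hkpos : 0 < min (⨅ k : Fin n, ⨅ i, (smd L b m γ z₀ Xs k ω).2 i) 1 :=
      min_iInf_iInf_pos hn (y := fun k => (smd L b m γ z₀ Xs k ω).2) fun k => (hS.smd_mem k ω).1
    have hSpos : 0 < ∑ k ∈ Finset.range (n + 1), γ (k + 1) :=
      Finset.sum_pos (fun k _ => hS.γ_pos k) Finset.nonempty_range_add_one
    rw [le_div_iff₀ (mul_pos hkpos hSpos)]
    refine (hS.kmin_mul_gap_average_le hW hc hc0 hn ω).trans ?_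
    have h1 := hω n
    have h2 := haW ω
    -- The estimate of `a W(z⁰)` already replaced the initial divergence by a constant, so `D_F(y⋆,
    -- y⁰)` in the numerator enters only through its sign.
    have h3 := DF_nonneg hS.model.zs_mem.1 (hS.z₀_mem ω).1
    have h4 : M n ω = ∑ k ∈ Finset.range n,
        γ (k + 1) * (a ω * fluctuationAt P X L b m γ z₀ Xs α β k ω) -
          (P[V | hS.filtration n]) ω := rfl
    have h5 : C * (2 + 2 * d) * (∑ k ∈ Finset.range n, γ (k + 1) ^ 2 * noiseAt L b m γ z₀ Xs k ω) ≤
        (1 / 2) * max m 1 * ∑ k ∈ Finset.range (n + 1), γ (k + 1) ^ 2 * Y (k + 1) ω := by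
      have h6 : ∑ k ∈ Finset.range (n + 1), γ (k + 1) ^ 2 * Y (k + 1) ω =
          cY * ∑ k ∈ Finset.range (n + 1), γ (k + 1) ^ 2 * noiseAt L b m γ z₀ Xs k ω := by
        rw [Finset.mul_sum]
        refine Finset.sum_congr rfl fun k _ => ?_
        rw [hYs, Pi.smul_apply, smul_eq_mul]
        ring
      have h7 : ∑ k ∈ Finset.range n, γ (k + 1) ^ 2 * noiseAt L b m γ z₀ Xs k ω ≤
          ∑ k ∈ Finset.range (n + 1), γ (k + 1) ^ 2 * noiseAt L b m γ z₀ Xs k ω := by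
        rw [Finset.sum_range_succ]
        exact le_add_of_nonneg_right (mul_nonneg (sq_nonneg _) (hn0 n ω))
      have h8 : 0 ≤ ∑ k ∈ Finset.range (n + 1), γ (k + 1) ^ 2 * noiseAt L b m γ z₀ Xs k ω :=
        Finset.sum_nonneg fun k _ => mul_nonneg (sq_nonneg _) (hn0 k ω)
      rw [h6]
      calc _ ≤ C * (2 + 2 * d) *
            ∑ k ∈ Finset.range (n + 1), γ (k + 1) ^ 2 * noiseAt L b m γ z₀ Xs k ω :=
            mul_le_mul_of_nonneg_left h7 (by positivity)
        _ = (1 / 2) * 1 * (cY *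
            ∑ k ∈ Finset.range (n + 1), γ (k + 1) ^ 2 * noiseAt L b m γ z₀ Xs k ω) := by
            rw [hcY]; ring
        _ ≤ _ := by
            gcongr
            exact le_max_right _ _
    rw [h4]
    simp only [ha] at h2 ⊢
    linarith

end SMDModel

end RiskBudgeting

/-! ### The theorem -/

open RiskBudgeting in
theorem mainTheorem3 {Ω : Type*} [MeasurableSpace Ω] (P : Measure Ω) [IsProbabilityMeasure P]
    {d : ℕ} (X : Ω → Fin d → ℝ) (hX : Measurable X)
    (dom : Submodule ℝ (Ω → ℝ)) (ρ : (Ω → ℝ) → ℝ) (hρ : RiskAssumptions dom ρ X)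
    (b : Fin d → ℝ) (hb : ∀ i, 0 < b i) (hb1 : ∑ i, b i = 1)
    (g : ℝ → ℝ) (hg : Distortion g)
    (L : ℝ → ℝ → ℝ) (hL : Represents P g ρ X L) (hreg : LossRegular P X L)
    (m : ℝ) (hm : ∀ y ∈ posOrthant d, IsMinOn (Gam g ρ X b) (posOrthant d) y → l1 y ≤ m)
    (hmom : SecondMomentBound P X L m)
    (γ : ℕ → ℝ) (hγ : ∀ k, 1 ≤ k → 0 < γ k)
    (hγ1 : ¬ Summable fun n => γ (n + 1)) (hγ2 : Summable fun n => γ (n + 1) ^ 2)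
    (z₀ : Ω → ℝ × (Fin d → ℝ)) (hz₀ : Measurable z₀)
    (hz₀pos : ∀ ω, (z₀ ω).2 ∈ posOrthant d) (hz₀m : ∀ ω, l1 (z₀ ω).2 ≤ m)
    (Xs : ℕ → Ω → Fin d → ℝ) (hXs : ∀ k, Measurable (Xs k)) (hS : Sampling P X z₀ Xs) :
    ∃ zs : ℝ × (Fin d → ℝ), zs.2 ∈ posOrthant d ∧
      (∀ z : ℝ × (Fin d → ℝ), z.2 ∈ posOrthant d → z ≠ zs → h P X L b zs < h P X L b z) ∧
      IsMinOn (Gam g ρ X b) (posOrthant d) zs.2 ∧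
      (∀ᵐ ω ∂P, Tendsto (fun n => smd L b m γ z₀ Xs n ω) atTop (𝓝 zs)) ∧
      (MemLp (fun ω => (z₀ ω).1) 2 P →
        ∃ (M Y : ℕ → Ω → ℝ) (N : ℝ),
          Martingale M (natFiltration z₀ hz₀ Xs hXs) P ∧
          (∃ C : ℝ≥0, ∀ n, eLpNorm (M n) 2 P ≤ C) ∧
          (∃ Minf : Ω → ℝ, ∀ᵐ ω ∂P, Tendsto (fun n => M n ω) atTop (𝓝 (Minf ω))) ∧
          (∀ n ω, 0 ≤ Y n ω) ∧
          (∀ n, StronglyMeasurable[natFiltration z₀ hz₀ Xs hXs n] (Y n)) ∧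
          (∀ n, Integrable (Y n) P) ∧
          (∀ n, P[Y (n + 1) | natFiltration z₀ hz₀ Xs hXs n] ≤ᵐ[P] fun _ => N ^ 2) ∧
          ∀ᵐ ω ∂P, ∀ n : ℕ, 1 ≤ n →
            h P X L b (average γ (fun k => smd L b m γ z₀ Xs k ω) n) - h P X L b zs ≤
              ((1 / 2) * ((z₀ ω).1 - zs.1) ^ 2 + DF zs.2 (z₀ ω).2 - M n ω
                + (1 / 2) * max m 1 *
                  ∑ k ∈ Finset.range (n + 1), γ (k + 1) ^ 2 * Y (k + 1) ω) /
              (min (⨅ k : Fin n, ⨅ i, (smd L b m γ z₀ Xs k ω).2 i) 1 *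
                ∑ k ∈ Finset.range (n + 1), γ (k + 1))) := by
  obtain ⟨B, zs, hM, hmin⟩ := exists_gradientModel hX hρ hb hb1 hg hL hreg hm hmom
  have hS : SMDModel P X L b m B zs γ z₀ Xs :=
    ⟨hX, hL.convexOn, hreg, hmom, hM, fun k => hγ (k + 1) (Nat.le_add_left 1 k), hγ2, hz₀,
      fun ω => ⟨hz₀pos ω, hz₀m ω⟩, hXs, hS⟩
  have hh : ∀ z : ℝ × (Fin d → ℝ), z.2 ∈ posOrthant d →
      h P X L b z = logBarrier b (meanLoss P X L) z := fun z hz =>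
    h_eq_logBarrier (hL.integrable z.1 z.2 (posOrthant_subset hz))
  refine ⟨zs, hM.zs_mem.1, fun z hz hne => ?_, hmin, hS.ae_tendsto_smd hγ1, fun hz2 => ?_⟩
  · rw [hh zs hM.zs_mem.1, hh z hz]
    exact hM.lt_of_ne z hz hne
  · obtain ⟨M, Y, N, h1, h2, h3, h4, h5, h6, h7, h8⟩ := hS.exists_rate hz2
    refine ⟨M, Y, N, h1, h2, h3, h4, h5, h6, h7, ?_⟩
    filter_upwards [h8] with ω hω n hn
    rw [hh zs hM.zs_mem.1,
      hh _ (average_mem_posOrthant hS.γ_pos (fun k => (hS.smd_mem k ω).1) hn)]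
    exact hω n hn
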